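/- **Setting.** Consider $\min\{\phi(z):=f(z)+h(z): Az=b\}$ with $A:\mathbb R^n\to\mathbb R^l$ linear, $b\in\mathbb R^l$, $f$ real-valued, $h:\mathbb R^n\to(-\infty,\infty]$. For $c\ge0$ put $\phi_c:=\phi+\frac c2\|A\cdot-b\|^2$. Assume: (A1) $A\ne0$ and $\mathcal F:=\{z\in\mathrm{dom}\,h:Az=b\}\neq\emptyset$; (A2) $h$ is proper, convex and lower semicontinuous; (A3) $f$ is differentiable at every point of $\mathrm{dom}\,h$ (it need not be convex), and there are $L\ge m>0$ with $\|\nabla f(z')-\nabla f(z)\|\le L\|z'-z\|$ and $f(z')-f(z)-\langle\nabla f(z),z'-z\rangle\ge-\frac m2\|z'-z\|^2$ for all $z,z'\in\mathrm{dom}\,h$; (A4) $\bar c\ge0$ is such that $\phi^*_{\bar c}:=\inf\phi_{\bar c}>-\infty$. A triple $(\hat z,\hat v,\hat p)$ is a $(\hat\rho,\hat\eta)$-approximate stationary point if $\hat v\in\nabla f(\hat z)+\partial h(\hat z)+A^*\hat p$, $\|\hat v\|\le\hat\rho$ and $\|A\hat z-b\|\le\hat\eta$. **Method.** Let $\theta\in(0,1]$,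 $z_0\in\mathrm{dom}\,h$, $\hat\rho,\hat\eta>0$, $c_1>2\bar c$. Put $\tau_\theta=\frac{\theta}{16-17\theta}$ if $\theta\le\frac{16}{19}$ and $\tau_\theta=\frac12$ otherwise; $\lambda=\tau_\theta/m$; and let $\sigma_\theta$ be the unique positive root of $\big(\frac34+\frac{2(1-\theta)(3\tau_\theta+1)}{\theta\tau_\theta}\big)\sigma^2+\frac{8-7\theta}{2\theta}\sigma-\frac18=0$. *ACG iteration* for $\min\psi_s+\psi_n$ with parameters $(M_s,\mu)$ from $x_0$: with $y_0=x_0$, $A_0=0$, $\Gamma_0\equiv0$ and $\ell_{\psi_s}(\cdot;x):=\psi_s(x)+\langle\nabla\psi_s(x),\cdot-x\rangle$, $$A_{j+1}=A_j+\tfrac{\mu A_j+1+\sqrt{(\mu A_j+1)^2+4M_s(\mu A_j+1)A_j}}{2M_s},\qquad \tilde x_j=\tfrac{A_j}{A_{j+1}}x_j+\tfrac{A_{j+1}-A_j}{A_{j+1}}y_j,$$ $$\Gamma_{j+1}=\tfrac{A_j}{A_{j+1}}\Gamma_j+\tfrac{A_{j+1}-A_j}{A_{j+1}}\ell_{\psi_s}(\cdot;\tilde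 x_j),\qquad y_{j+1}=\mathrm{argmin}\{\Gamma_{j+1}+\psi_n+\tfrac1{2A_{j+1}}\|\cdot-y_0\|^2\},$$ $$x_{j+1}=\tfrac{A_j}{A_{j+1}}x_j+\tfrac{A_{j+1}-A_j}{A_{j+1}}y_{j+1},\qquad u_{j+1}=\tfrac{y_0-y_{j+1}}{A_{j+1}},$$ $$\eta_{j+1}=(\psi_s+\psi_n)(x_{j+1})-\Gamma_{j+1}(y_{j+1})-\psi_n(y_{j+1})-\langle u_{j+1},x_{j+1}-y_{j+1}\rangle.$$ *Static method* with penalty $c$: let $L_c=L+c\|A\|^2$, $\sigma=\min\{(\lambda L_c+1)^{-1/2},\sigma_\theta\}$, $p_0=0$. For $k=1,2,\dots$: let $g_k=f+(1-\theta)\langle p_{k-1},A\cdot-b\rangle+\frac c2\|A\cdot-b\|^2$ and run ACG with $\psi_s=\lambda g_k+\frac{\tau_\theta}2\|\cdot-z_{k-1}\|^2$, $\psi_n=\lambda h+\frac{1-\tau_\theta}2\|\cdot-z_{k-1}\|^2$, $(M_s,\mu)=(\lambda L_c+\tau_\theta,1-\tau_\theta)$, $x_0=z_{k-1}$, until the first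 $j\ge1$ at which $(z_k,v_k,\varepsilon_k)=(x_j,u_j,\eta_j)$ satisfies $\|v_k\|^2+2\varepsilon_k\le\sigma^2\|v_k+z_{k-1}-z_k\|^2$. With $g_\lambda:=\lambda g_k+\frac12\|\cdot-z_{k-1}\|^2-\langle v_k,\cdot\rangle$ compute $$\hat z_k=\mathrm{argmin}_u\{\langle\nabla g_\lambda(z_k),u-z_k\rangle+\tfrac{\lambda L_c+1}2\|u-z_k\|^2+\lambda h(u)\},$$ $$\hat v_k=\tfrac1\lambda[v_k+z_{k-1}-z_k+(\lambda L_c+1)(z_k-\hat z_k)]+\nabla g_k(\hat z_k)-\nabla g_k(z_k),\qquad \hat p_k=(1-\theta)p_{k-1}+c(A\hat z_k-b).$$ If $\|\hat v_k\|\le\hat\rho$, stop with output $(\hat z_k,\hat v_k,\hat p_k)$; otherwise set $p_k=(1-\theta)p_{k-1}+c(Az_k-b)$ and continue. *Dynamic $\theta$-IPAAL method*: start with $c=c_1$; run the static method from $z_0$; if its output satisfies $\|A\hat z-b\|\le\hat\eta$, stop and output it; otherwise double $c$ and repeat (again from $z_0$ and $p_0=0$). **Notation.** $\log_1^+(t):=\max\{\log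 t,1\}$ (equal to $1$ at $t=0$), $\kappa_\theta:=1+\frac{16(1-\theta)}{\theta\tau_\theta}$, $R_0:=\inf\{\lambda[\phi(z)-\phi^*_{\bar c}]+\|z-z_0\|^2:z\in\mathcal F\}$, and for $X\ge0$ $$\mathcal B(X):=\max\Big\{1,\Big\lceil\tfrac{R_0}{\lambda^2\hat\rho^2}\Big\rceil\Big\}\Big[\sqrt{\lambda\max\{c_1,X\}}\,\|A\|+\sqrt{\lambda L+1}\,\log_1^+\big(\tfrac X{c_1}\big)\Big]\log_1^+\big(\lambda(L+\max\{c_1,X\}\|A\|^2)+1\big).$$ Further conditions, with $\mathcal L(\alpha):=\{z:\phi_{\bar c}(z)\le\alpha\}$: (B1) there is $\bar z\in\mathrm{int}(\mathrm{dom}\,h)$ with $A\bar z=b$; (B2) $D(\alpha):=\mathrm{diam}\,\mathcal L(\alpha)<\infty$ for all $\alpha\in\mathbb R$; (B3) $S(\alpha):=\inf\{s\ge0:\partial h(z)\subseteq \bar B(0,s)+N_{\mathrm{dom}\,h}(z)\ \forall z\in\mathcal L(\alpha)\}<\infty$ for all $\alpha\in\mathbb R$. With $\sigma^+(A)$ the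 smallest positive eigenvalue of $(A^*A)^{1/2}$ and $\alpha:=\frac{\kappa_\theta R_0}\lambda+\max\{\phi_{\bar c}(z_0),\phi_{\bar c}(\bar z)\}$, put $$N_0:=\frac1{\sigma^+(A)}\Big(1+\frac{\max\{\sqrt{3\kappa_\theta R_0},D(\alpha)\}}{\mathrm{dist}_{\partial(\mathrm{dom}\,h)}(\bar z)}\Big)\Big[\|\nabla f(z_0)\|+LD(\alpha)+S(\alpha)+\Big(L+\frac{14}{\lambda\sqrt\theta}\Big)\sqrt{3\kappa_\theta R_0}\Big],$$ the quotient being $0$ if $\mathrm{dom}\,h=\mathbb R^n$. **Theorem 3.3.** For every $\theta\in(0,1]$ there is a constant $C>0$ depending only on $\theta$ such that, for all data as above: a) under (A1)–(A4) the dynamic $\theta$-IPAAL method stops with a $(\hat\rho,\hat\eta)$-approximate stationary point after a total of at most $C\,\mathcal B\big(\frac{R_0}{\lambda\hat\eta^2}\big)$ ACG iterations; b) if in addition (B2), (B3) hold and $\bar z$ is any point as in (B1), it does so after a total of at most $C\,\mathcal B\big(\frac{N_0}{\hat\eta}\big)$ ACG iterations. In particular, for a fixed problem, $\theta$, $z_0$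 and $c_1$, there is a constant $K$ such that for all $\hat\rho,\hat\eta\in(0,\frac12]$ the number of ACG iterations is at most $K\frac{\log(1/\hat\eta)}{\hat\eta\hat\rho^2}$ under (A1)–(A4), and (with another $K$) at most $K\frac{\log(1/\hat\eta)}{\sqrt{\hat\eta}\,\hat\rho^2}$ if (B1)–(B3) also hold. -/

import Mathlib

open scoped Pointwise

noncomputable section

namespace IPAAL

/-- The Euclidean space of dimension `n`. -/
abbrev Vec (n : ℕ) := EuclideanSpace ℝ (Fin n)

/-- `log₁⁺ t = max {log t, 1}` (its value at `t = 0` is `1`). -/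
def logOne (t : ℝ) : ℝ := max (Real.log t) 1

/-! ### The problem `min { f z + h z : A z = b }` -/

/-- The data of the problem: the operator `A`, the vector `b`, the smooth part `f`, the extended
real valued part `h`, the curvature constants `L` and `m`, and the scalar `cbar` for which the
quadratic penalty function is bounded below. Only the values of `f` near `dom h` matter. -/
structure Problem (n l : ℕ) where
  A : Vec n →L[ℝ] Vec l
  b : Vec l
  f : Vec n → ℝ
  h : Vec n → EReal
  L : ℝ
  m : ℝ
  cbar : ℝ

namespace Problem

variable {n l : ℕ} (P : Problem n l)

/-- The effective domain of `h`. -/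
def dom : Set (Vec n) := {z | P.h z < ⊤}

/-- The real value of `h`; it is only used at points of `dom h`. -/
def hr (z : Vec n) : ℝ := (P.h z).toReal

/-- The feasible set. -/
def feasible : Set (Vec n) := {z | z ∈ P.dom ∧ P.A z = P.b}

/-- The objective `f + h` (on `dom h`). -/
def phi (z : Vec n) : ℝ := P.f z + P.hr z

/-- The quadratic penalty function `f + h + (c / 2) ‖A · - b‖ ^ 2` (on `dom h`). -/
def phiPen (c : ℝ) (z : Vec n) : ℝ := P.phi z + c / 2 * ‖P.A z - P.b‖ ^ 2

/-- The infimum of the penalty function with parameter `cbar`. -/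
def phiStar : ℝ := sInf (P.phiPen P.cbar '' P.dom)

/-- The subdifferential of `h`. -/
def subdiff (z : Vec n) : Set (Vec n) :=
  {u | ∀ w : Vec n, P.h z + ((inner ℝ u (w - z) : ℝ) : EReal) ≤ P.h w}

/-- The normal cone of `dom h` at a point `z` of `dom h`. -/
def normalCone (z : Vec n) : Set (Vec n) := {u | ∀ w ∈ P.dom, inner ℝ u (w - z) ≤ 0}

/-- The standing assumptions (A1)--(A4). -/
structure Standing : Prop where
  A_ne_zero : P.A ≠ 0
  feasible_nonempty : P.feasible.Nonempty
  h_proper : (∀ z, P.h z ≠ ⊥) ∧ ∃ z, P.h z < ⊤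
  h_convex : Convex ℝ {q : Vec n × ℝ | P.h q.1 ≤ (q.2 : EReal)}
  h_lsc : LowerSemicontinuous P.h
  m_pos : 0 < P.m
  m_le_L : P.m ≤ P.L
  f_diff : ∀ z ∈ P.dom, DifferentiableAt ℝ P.f z
  grad_lipschitz : ∀ z ∈ P.dom, ∀ w ∈ P.dom,
    ‖gradient P.f w - gradient P.f z‖ ≤ P.L * ‖w - z‖
  lower_curvature : ∀ z ∈ P.dom, ∀ w ∈ P.dom,
    - (P.m / 2) * ‖w - z‖ ^ 2 ≤ P.f w - (P.f z + inner ℝ (gradient P.f z) (w - z))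
  cbar_nonneg : 0 ≤ P.cbar
  penalty_bddBelow : BddBelow (P.phiPen P.cbar '' P.dom)

/-- `(ρ, η)`-approximate stationary points: `v ∈ ∇f(z) + ∂h(z) + A^* p`, `‖v‖ ≤ ρ`,
`‖A z - b‖ ≤ η`. -/
def IsApproxStationary (ρ η : ℝ) (z v : Vec n) (p : Vec l) : Prop :=
  v ∈ {gradient P.f z} + P.subdiff z + {ContinuousLinearMap.adjoint P.A p} ∧
    ‖v‖ ≤ ρ ∧ ‖P.A z - P.b‖ ≤ η

/-! ### The additional assumptions -/

/-- Sublevel sets of the penalty function with parameter `cbar`. -/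
def sublevel (α : ℝ) : Set (Vec n) := {z | z ∈ P.dom ∧ P.phiPen P.cbar z ≤ α}

/-- (B1) for the point `zbar`: a Slater point. -/
def IsSlater (zbar : Vec n) : Prop := zbar ∈ interior P.dom ∧ P.A zbar = P.b

/-- (B2): all sublevel sets are bounded. -/
def BoundedLevels : Prop := ∀ α : ℝ, Bornology.IsBounded (P.sublevel α)

/-- The diameter `D(α)` of a sublevel set. -/
def D (α : ℝ) : ℝ := Metric.diam (P.sublevel α)

/-- The radii `s ≥ 0` with `∂h(z) ⊆ B(0, s) + N_{dom h}(z)` for all `z` in the sublevel set. -/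
def radii (α : ℝ) : Set ℝ :=
  {s | 0 ≤ s ∧ ∀ z ∈ P.sublevel α, P.subdiff z ⊆ Metric.closedBall 0 s + P.normalCone z}

/-- (B3): such radii exist for every level, i.e. `S(α) < ∞`. -/
def BoundedSubdiff : Prop := ∀ α : ℝ, (P.radii α).Nonempty

/-- The infimum `S(α)` of these radii. -/
def S (α : ℝ) : ℝ := sInf (P.radii α)

end Problem

/-! ### Parameters of the method -/

/-- The number `τ_θ`. -/
def tau (θ : ℝ) : ℝ := if θ ≤ 16 / 19 then θ / (16 - 17 * θ) else 1 / 2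

/-- Leading coefficient of the quadratic equation for `σ_θ`. -/
def quadA (θ : ℝ) : ℝ := 3 / 4 + 2 * (1 - θ) * (3 * tau θ + 1) / (θ * tau θ)

/-- Linear coefficient of the quadratic equation for `σ_θ`. -/
def quadB (θ : ℝ) : ℝ := (8 - 7 * θ) / (2 * θ)

/-- The number `σ_θ`, the only positive root of `quadA θ * s ^ 2 + quadB θ * s - 1 / 8 = 0`
(see `sigmaTheta_spec`). -/
def sigmaTheta (θ : ℝ) : ℝ :=
  (- quadB θ + √(quadB θ ^ 2 + quadA θ / 2)) / (2 * quadA θ)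

theorem tau_pos {θ : ℝ} (h0 : 0 < θ) : 0 < tau θ := by
  unfold tau
  split_ifs with h
  · apply div_pos h0
    linarith
  · norm_num

theorem sigmaTheta_spec {θ : ℝ} (h0 : 0 < θ) (h1 : θ ≤ 1) (s : ℝ) :
    (0 < s ∧ quadA θ * s ^ 2 + quadB θ * s - 1 / 8 = 0) ↔ s = sigmaTheta θ := by
  have ht := tau_pos h0
  have ha : 0 < quadA θ := by
    unfold quadA
    have h2 : 0 ≤ 1 - θ := by linarith
    positivity
  have hb : 0 < quadB θ := by
    unfold quadB
    apply div_pos <;> linarith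
  have hs : quadB θ < √(quadB θ ^ 2 + quadA θ / 2) := by
    apply Real.lt_sqrt_of_sq_lt
    linarith
  have hq : √(quadB θ ^ 2 + quadA θ / 2) ^ 2 = quadB θ ^ 2 + quadA θ / 2 :=
    Real.sq_sqrt (by positivity)
  have hpos : 0 < sigmaTheta θ := by
    unfold sigmaTheta
    apply div_pos <;> linarith
  have hroot : quadA θ * sigmaTheta θ ^ 2 + quadB θ * sigmaTheta θ - 1 / 8 = 0 := by
    unfold sigmaTheta
    generalize √(quadB θ ^ 2 + quadA θ / 2) = w at hq
    have hane := ha.ne'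
    field_simp
    linear_combination 8 * hq
  constructor
  · rintro ⟨hsp, he⟩
    have hf : (s - sigmaTheta θ) * (quadA θ * (s + sigmaTheta θ) + quadB θ) = 0 := by
      linear_combination he - hroot
    rcases mul_eq_zero.mp hf with h | h
    · linarith
    · have : 0 < quadA θ * (s + sigmaTheta θ) + quadB θ := by positivity
      linarith
  · rintro rfl
    exact ⟨hpos, hroot⟩

/-! ### The accelerated composite gradient (ACG) method -/

section ACG

variable {n : ℕ}

/-- A minimizer of `F` over the set `s`, here the effective domain of the objective (in every use
below the minimizer exists and is unique). -/
def argminOn (s : Set (Vec n)) (F : Vec n → ℝ) : Vec n :=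
  Classical.epsilon (fun y => y ∈ s ∧ ∀ w ∈ s, F y ≤ F w)

/-- The affine approximation of `ψ` at `w`. -/
def linearization (ψ : Vec n → ℝ) (w z : Vec n) : ℝ :=
  ψ w + inner ℝ (gradient ψ w) (z - w)

/-- The iterates `A_j`, `x_j`, `y_j`, `Γ_j` of the ACG method. -/
structure ACGState (n : ℕ) where
  a : ℝ
  x : Vec n
  y : Vec n
  Γ : Vec n → ℝ

/-- The initial state of the ACG method started at `x0`. -/
def acgInit (x0 : Vec n) : ACGState n := ⟨0, x0, x0, fun _ => 0⟩

/-- One iteration of the ACG method for `min ψs + ψn`, where `s` is the effective domain of `ψn`,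
with parameters `M`, `μ` and starting point `x0`. -/
def acgStep (s : Set (Vec n)) (ψs ψn : Vec n → ℝ) (M μ : ℝ) (x0 : Vec n) (q : ACGState n) :
    ACGState n :=
  let aNew := q.a + (μ * q.a + 1 + √((μ * q.a + 1) ^ 2 + 4 * M * (μ * q.a + 1) * q.a)) / (2 * M)
  let xTilde := (q.a / aNew) • q.x + ((aNew - q.a) / aNew) • q.y
  let ΓNew : Vec n → ℝ := fun z =>
    q.a / aNew * q.Γ z + (aNew - q.a) / aNew * linearization ψs xTilde z
  let yNew := argminOn s (fun y => ΓNew y + ψn y + 1 / (2 * aNew) * ‖y - x0‖ ^ 2)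
  ⟨aNew, (q.a / aNew) • q.x + ((aNew - q.a) / aNew) • yNew, yNew, ΓNew⟩

/-- The residual `u_j` (for `j ≥ 1`) of the ACG method. -/
def acgU (x0 : Vec n) (q : ACGState n) : Vec n := (1 / q.a) • (x0 - q.y)

/-- The residual `η_j` (for `j ≥ 1`) of the ACG method. -/
def acgEps (ψs ψn : Vec n → ℝ) (x0 : Vec n) (q : ACGState n) : ℝ :=
  ψs q.x + ψn q.x - q.Γ q.y - ψn q.y - inner ℝ (acgU x0 q) (q.x - q.y)

end ACG

/-! ### The static and the dynamic method -/

namespace Problem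

variable {n l : ℕ} (P : Problem n l)

/-- The prox-stepsize `λ = τ_θ / m`. -/
def lam (θ : ℝ) : ℝ := tau θ / P.m

/-- `L_c = L + c ‖A‖ ^ 2`. -/
def Lc (c : ℝ) : ℝ := P.L + c * ‖P.A‖ ^ 2

/-- The relative accuracy `σ`. -/
def sig (θ c : ℝ) : ℝ := min (1 / √(P.lam θ * P.Lc c + 1)) (sigmaTheta θ)

/-- The smooth part `g_k` of the augmented Lagrangian, where `p` is the previous multiplier. -/
def g (θ c : ℝ) (p : Vec l) (z : Vec n) : ℝ :=
  P.f z + (1 - θ) * inner ℝ p (P.A z - P.b) + c / 2 * ‖P.A z - P.b‖ ^ 2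

/-- The smooth part `ψ_s` of the prox subproblem with prox center `z0`. -/
def psiS (θ c : ℝ) (z0 : Vec n) (p : Vec l) (z : Vec n) : ℝ :=
  P.lam θ * P.g θ c p z + tau θ / 2 * ‖z - z0‖ ^ 2

/-- The composite part `ψ_n` (on `dom h`) of the prox subproblem with prox center `z0`. -/
def psiN (θ : ℝ) (z0 : Vec n) (z : Vec n) : ℝ :=
  P.lam θ * P.hr z + (1 - tau θ) / 2 * ‖z - z0‖ ^ 2

/-- The smooth function `g_λ` of the refinement procedure, with prox center `z0`. -/
def gLam (θ c : ℝ) (z0 : Vec n) (p : Vec l) (v : Vec n) (z : Vec n) : ℝ :=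
  P.lam θ * P.g θ c p z + 1 / 2 * ‖z - z0‖ ^ 2 - inner ℝ v z

/-- The refined point of the refinement procedure applied to `(z, v)`. -/
def refineZ (θ c : ℝ) (z0 : Vec n) (p : Vec l) (z v : Vec n) : Vec n :=
  argminOn P.dom (fun u => inner ℝ (gradient (P.gLam θ c z0 p v) z) (u - z)
    + (P.lam θ * P.Lc c + 1) / 2 * ‖u - z‖ ^ 2 + P.lam θ * P.hr u)

/-- The refined residual of the refinement procedure applied to `(z, v)`. -/
def refineV (θ c : ℝ) (z0 : Vec n) (p : Vec l) (z v : Vec n) : Vec n :=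
  (1 / P.lam θ) • ((v + z0 - z) + (P.lam θ * P.Lc c + 1) • (z - P.refineZ θ c z0 p z v))
    + gradient (P.g θ c p) (P.refineZ θ c z0 p z v) - gradient (P.g θ c p) z

end Problem

/-- A configuration of the dynamic method. `running c z p q`: the penalty parameter is `c`, the
static method is in an outer iteration with previous iterate and multiplier `(z, p)`, and the ACG
method, called on the prox subproblem with center `z`, is in state `q`. `halted z v p`: the method
has stopped with output `(z, v, p)`. -/
inductive Config (n l : ℕ) where
  | running (c : ℝ) (z : Vec n) (p : Vec l) (q : ACGState n) : Config n l
  | halted (z v : Vec n) (p : Vec l) : Config n l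

namespace Problem

variable {n l : ℕ} (P : Problem n l)

open Classical in
/-- One step of the dynamic method on the configuration `κ`; it performs exactly one ACG iteration
unless the method has already stopped. After the ACG iteration:
* if the ACG stopping test fails, the ACG method goes on;
* otherwise the accepted point is refined, and if the refined residual is larger than `ρ`, the next
  outer iteration of the static method begins;
* otherwise the static method ends, and the method stops if the feasibility test with tolerance `η`
  passes; if not, the static method is restarted from `z0` (and the zero multiplier) with the
  penalty parameter doubled. -/
def step (θ : ℝ) (z0 : Vec n) (ρ η : ℝ) (κ : Config n l) : Config n l :=
  match κ with
  | Config.halted z v p => Config.halted z v p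
  | Config.running c zPrev pPrev q =>
    let ψs := P.psiS θ c zPrev pPrev
    let ψn := P.psiN θ zPrev
    let qNew := acgStep P.dom ψs ψn (P.lam θ * P.Lc c + tau θ) (1 - tau θ) zPrev q
    let z := qNew.x
    let v := acgU zPrev qNew
    let ε := acgEps ψs ψn zPrev qNew
    if ‖v‖ ^ 2 + 2 * ε ≤ P.sig θ c ^ 2 * ‖v + zPrev - z‖ ^ 2 then
      let zHat := P.refineZ θ c zPrev pPrev z v
      let vHat := P.refineV θ c zPrev pPrev z v
      let pHat := (1 - θ) • pPrev + c • (P.A zHat - P.b)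
      if ‖vHat‖ ≤ ρ then
        if ‖P.A zHat - P.b‖ ≤ η then Config.halted zHat vHat pHat
        else Config.running (2 * c) z0 0 (acgInit z0)
      else Config.running c z ((1 - θ) • pPrev + c • (P.A z - P.b)) (acgInit z)
    else Config.running c zPrev pPrev qNew

/-- The dynamic method, started with penalty parameter `c1` at `z0`, stops after at most `B` ACG
iterations in total, and its output is a `(ρ, η)`-approximate stationary point. -/
def FindsWithin (θ : ℝ) (z0 : Vec n) (c1 ρ η B : ℝ) : Prop :=
  ∃ (N : ℕ) (z v : Vec n) (p : Vec l), (N : ℝ) ≤ B ∧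
    (P.step θ z0 ρ η)^[N] (Config.running c1 z0 0 (acgInit z0)) = Config.halted z v p ∧
    P.IsApproxStationary ρ η z v p

/-! ### The quantities in the complexity bounds -/

/-- `R₀ = inf { λ [(f + h)(z) - φ*] + ‖z - z₀‖ ^ 2 : z feasible }`. -/
def R0 (θ : ℝ) (z0 : Vec n) : ℝ :=
  sInf ((fun z => P.lam θ * (P.phi z - P.phiStar) + ‖z - z0‖ ^ 2) '' P.feasible)

end Problem

/-- The constant `κ_θ`. -/
def kappa (θ : ℝ) : ℝ := 1 + 16 * (1 - θ) / (θ * tau θ)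

namespace Problem

variable {n l : ℕ} (P : Problem n l)

/-- The smallest positive eigenvalue of `(A^* A)^{1/2}`, that is, the least `s > 0` such that `s ^ 2`
is an eigenvalue of `A^* A`. -/
def sigmaPlus : ℝ :=
  sInf {s : ℝ | 0 < s ∧ Module.End.HasEigenvalue
    ((ContinuousLinearMap.adjoint P.A ∘L P.A : Vec n →L[ℝ] Vec n) : Vec n →ₗ[ℝ] Vec n) (s ^ 2)}

/-- The level `α = κ_θ R₀ / λ + max { φ_c̄(z₀), φ_c̄(z̄) }`. -/
def level (θ : ℝ) (z0 zbar : Vec n) : ℝ :=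
  kappa θ * P.R0 θ z0 / P.lam θ + max (P.phiPen P.cbar z0) (P.phiPen P.cbar zbar)

open Classical in
/-- The quotient of `t` by the distance from `zbar` to the boundary of `dom h`. If `dom h` is the
whole space, its boundary is empty, the distance is infinite and the quotient is zero. -/
def divBoundaryDist (t : ℝ) (zbar : Vec n) : ℝ :=
  if frontier P.dom = ∅ then 0 else t / Metric.infDist zbar (frontier P.dom)

/-- The constant `N₀`. -/
def N0 (θ : ℝ) (z0 zbar : Vec n) : ℝ :=
  let α := P.level θ z0 zbar
  let r := √(3 * kappa θ * P.R0 θ z0)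
  1 / P.sigmaPlus * (1 + P.divBoundaryDist (max r (P.D α)) zbar) *
    (‖gradient P.f z0‖ + P.L * P.D α + P.S α + (P.L + 14 / (P.lam θ * √θ)) * r)

/-- The complexity expression
`⌈R₀/(λ²ρ²)⌉ [√(λ max{c₁, X}) ‖A‖ + √(λL + 1) log₁⁺(X/c₁)] log₁⁺(λ(L + max{c₁, X}‖A‖²) + 1)`,
in which `⌈R₀/(λ²ρ²)⌉` is replaced by `1` in the degenerate case `R₀ = 0`. -/
def complexity (θ : ℝ) (z0 : Vec n) (c1 ρ X : ℝ) : ℝ :=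
  (max 1 ⌈P.R0 θ z0 / (P.lam θ ^ 2 * ρ ^ 2)⌉₊ : ℕ) *
    (√(P.lam θ * max c1 X) * ‖P.A‖ + √(P.lam θ * P.L + 1) * logOne (X / c1)) *
    logOne (P.lam θ * (P.L + max c1 X * ‖P.A‖ ^ 2) + 1)

end Problem

end IPAAL

end

namespace IPAAL

/-! ### Elementary facts -/

/-! Three counts are combined: ACG iterations per prox subproblem, outer iterations per static run
(bounded independently of `c`), and the penalties tried.

Inner count. Since `λ m = τ_θ ≤ 1/2`, the quadratic moved into `ψ_s` makes it convex and leaves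
`ψ_n` strongly convex with modulus `1 - τ_θ`. The ACG weights grow geometrically, and the relative
test passes once the weight reaches `8/σ²` (`ACGOutput.test`); this takes `O(√(λ L_c + 1) log₁⁺(λ
L_c + 1))` iterations (`Standing.exists_acg_large`).

Outer count. Write `r` for the residual `v + z₀ - z` of a prox step from `z₀` to `z`. The step
lowers the augmented Lagrangian by nearly `‖r‖²/2`, while the damped multiplier update raises it by
a telescoping multiple of `‖p‖²` plus a multiple of `‖Δp‖²/c`. `merit` subtracts the telescoping
part. Comparing two consecutive subproblems (`InexactProx.dual_increment`) bounds `‖Δp‖²/c` by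
telescoping differences and a multiple of `‖r‖²`; adding `omega` times that inequality gives a
potential that drops by `‖r‖²/16` per iteration (`potential_succ`). The potential is nonnegative
because it is nonincreasing and has nonnegative partial sums. So `∑ ‖r‖² ≤ (64/θ) R₀`, and `λ ‖v̂‖ ≤
3 ‖r‖` bounds the number of outer iterations by a multiple of `max {1, ⌈R₀/(λ²ρ²)⌉}`.

Feasibility. The potential also bounds `‖p‖²/c` and the Lagrangian at the refined points; completing
a square gives `λ c ‖A ẑ - b‖² ≤ 160 R₀/θ²`. With a Slater point the multipliers themselves are
bounded: either `‖p̂‖ ≤ (1 - θ) ‖p‖`, or `⟨p̂, A ẑ - b⟩ ≥ 0` and testing the stationarity inclusion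
with `ẑ - z̄` bounds `A^* p̂`. This gives `c ‖A ẑ - b‖ ≤ 6 N₀/θ`.

Hence a penalty of order `R₀/(λη²)`, respectively `N₀/η`, suffices. Under doubling the `√c` parts of
the inner counts form a geometric sum dominated by the last penalty, and the remaining part is
multiplied by the logarithmic number of runs (`Standing.findsWithin`). -/

theorem one_le_logOne (t : ℝ) : 1 ≤ logOne t := le_max_right _ _

theorem log_le_logOne (t : ℝ) : Real.log t ≤ logOne t := le_max_left _ _

theorem logOne_mono {s t : ℝ} (hs : 0 < s) (h : s ≤ t) : logOne s ≤ logOne t :=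
  max_le_max_right _ (Real.log_le_log hs h)

/-- Multiplying the argument of `logOne` by a constant multiplies its value by a constant. -/
theorem logOne_mul_le {a t : ℝ} (ha : 1 ≤ a) (ht : 0 < t) :
    logOne (a * t) ≤ (1 + Real.log a) * logOne t := by
  have h1 := one_le_logOne t
  have h2 := log_le_logOne t
  have h3 := Real.log_nonneg ha
  refine max_le ?_ ?_
  · rw [Real.log_mul (by linarith) ht.ne']
    nlinarith
  · nlinarith

/-- The limit `t → 0`. It removes the error of a convex combination, of a slightly shrunken ball,
and of an infimum that need not be attained. -/
theorem le_of_forall_small_add {x y k : ℝ} (h : ∀ t : ℝ, 0 < t → t < 1 → x ≤ y + t * k) :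
    x ≤ y := by
  by_contra! hlt
  have hk : 0 < |k| + 1 := by positivity
  set t := min (1 / 2) ((x - y) / (2 * (|k| + 1))) with ht
  have ht0 : 0 < t := lt_min (by norm_num) (div_pos (by linarith) (by linarith))
  have ht1 : t < 1 := (min_le_left _ _).trans_lt (by norm_num)
  have h2 : t * (2 * (|k| + 1)) ≤ x - y := by
    have := min_le_right (1 / 2) ((x - y) / (2 * (|k| + 1)))
    rw [← ht, le_div_iff₀ (by linarith)] at this
    exact this
  have h3 : t * k ≤ t * |k| := by gcongr; exact le_abs_self k
  have := h t ht0 ht1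
  nlinarith

/-! ### Strong convexity and quadratic growth at minimizers -/

section Convex

variable {E : Type*} [NormedAddCommGroup E] [InnerProductSpace ℝ E]

/-- The exact convexity identity for a squared distance. -/
theorem norm_combo_sq (x y z : E) {a b : ℝ} (hab : a + b = 1) :
    ‖a • x + b • y - z‖ ^ 2 = a * ‖x - z‖ ^ 2 + b * ‖y - z‖ ^ 2 - a * b * ‖x - y‖ ^ 2 := by
  have e1 : a • x + b • y - z = a • (x - z) + b • (y - z) := by
    have : z = (a + b) • z := by rw [hab, one_smul]
    nth_rewrite 1 [this]
    module
  have e2 : x - y = (x - z) - (y - z) := by abel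
  rw [e1, e2]
  simp only [← real_inner_self_eq_norm_sq, inner_add_left, inner_add_right, inner_sub_left,
    inner_sub_right, real_inner_smul_left, real_inner_smul_right]
  obtain rfl : b = 1 - a := by linarith
  rw [real_inner_comm x y, real_inner_comm x z, real_inner_comm y z]
  ring

theorem strongConvexOn_sq_dist {s : Set E} (hs : Convex ℝ s) (m : ℝ) (z : E) :
    StrongConvexOn s m (fun x => m / 2 * ‖x - z‖ ^ 2) := by
  refine ⟨hs, fun x _ y _ a b _ _ hab => ?_⟩
  simp only [smul_eq_mul]
  rw [norm_combo_sq x y z hab]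
  apply le_of_eq
  ring

/-- Quadratic growth of a strongly convex function at a minimizer. -/
theorem strongConvexOn_growth {s : Set E} {m : ℝ} {F : E → ℝ} (hF : StrongConvexOn s m F) {y : E}
    (hy : y ∈ s) (hmin : ∀ w ∈ s, F y ≤ F w) {w : E} (hw : w ∈ s) :
    F y + m / 2 * ‖w - y‖ ^ 2 ≤ F w := by
  apply le_of_forall_small_add (k := m / 2 * ‖w - y‖ ^ 2)
  intro t ht0 ht1
  have h := hF.2 hw hy ht0.le (sub_nonneg.2 ht1.le) (by ring)
  have h2 := hmin _ (hF.1 hw hy ht0.le (sub_nonneg.2 ht1.le) (by ring))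
  simp only [smul_eq_mul] at h
  have h3 : t * (F y + m / 2 * ‖w - y‖ ^ 2) ≤ t * (F w + t * (m / 2 * ‖w - y‖ ^ 2)) := by
    nlinarith
  exact le_of_mul_le_mul_left h3 ht0

/-- A function that is minimal at `y` after adding `a / 2 ‖· - z‖ ^ 2` has the subgradient
`a (z - y)` there. -/
theorem convexOn_subgradient_of_prox {s : Set E} {F : E → ℝ} (hF : ConvexOn ℝ s F) {a : ℝ}
    {y z : E} (hy : y ∈ s)
    (hmin : ∀ w ∈ s, F y + a / 2 * ‖y - z‖ ^ 2 ≤ F w + a / 2 * ‖w - z‖ ^ 2) {w : E} (hw : w ∈ s) :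
    F y + inner ℝ (a • (z - y)) (w - y) ≤ F w := by
  have hS : StrongConvexOn s a (fun x => F x + a / 2 * ‖x - z‖ ^ 2) := by
    have := (strongConvexOn_zero.2 hF).add (strongConvexOn_sq_dist hF.1 a z)
    refine ⟨hF.1, fun x hx y hy p q hp hq hpq => ?_⟩
    have h2 := this.2 hx hy hp hq hpq
    simpa using h2
  have h := strongConvexOn_growth hS hy hmin hw
  have e : ‖w - z‖ ^ 2 = ‖w - y‖ ^ 2 + ‖y - z‖ ^ 2 - 2 * inner ℝ (z - y) (w - y) := by
    have : w - z = (w - y) - (z - y) := by abel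
    rw [this, norm_sub_sq_real, norm_sub_rev z y, real_inner_comm]
    ring
  rw [e] at h
  rw [real_inner_smul_left]
  linarith

end Convex

/-! ### Convexity and semicontinuity of `h` -/

namespace Problem

variable {n l : ℕ} {P : Problem n l}

theorem Standing.coe_hr (hP : P.Standing) {z : Vec n} (hz : z ∈ P.dom) :
    ((P.hr z : ℝ) : EReal) = P.h z :=
  EReal.coe_toReal (ne_of_lt hz) (hP.h_proper.1 z)

theorem Standing.mem_dom_of_le (_ : P.Standing) {z : Vec n} {t : ℝ} (h : P.h z ≤ (t : EReal)) :
    z ∈ P.dom := h.trans_lt (EReal.coe_lt_top t)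

theorem Standing.hr_le (hP : P.Standing) {z : Vec n} {t : ℝ} (h : P.h z ≤ (t : EReal)) :
    P.hr z ≤ t := by
  rw [← EReal.coe_le_coe_iff, hP.coe_hr (hP.mem_dom_of_le h)]
  exact h

theorem Standing.convexOn_hr (hP : P.Standing) : ConvexOn ℝ P.dom P.hr := by
  have key : ∀ x ∈ P.dom, ∀ y ∈ P.dom, ∀ a b : ℝ, 0 ≤ a → 0 ≤ b → a + b = 1 →
      P.h (a • x + b • y) ≤ ((a • P.hr x + b • P.hr y : ℝ) : EReal) := by
    intro x hx y hy a b ha hb hab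
    have h1 : ((x, P.hr x) : Vec n × ℝ) ∈ {q : Vec n × ℝ | P.h q.1 ≤ (q.2 : EReal)} :=
      (hP.coe_hr hx).ge
    have h2 : ((y, P.hr y) : Vec n × ℝ) ∈ {q : Vec n × ℝ | P.h q.1 ≤ (q.2 : EReal)} :=
      (hP.coe_hr hy).ge
    exact hP.h_convex h1 h2 ha hb hab
  refine ⟨fun x hx y hy a b ha hb hab => hP.mem_dom_of_le (key x hx y hy a b ha hb hab), ?_⟩
  intro x hx y hy a b ha hb hab
  exact hP.hr_le (key x hx y hy a b ha hb hab)

theorem Standing.convex_dom (hP : P.Standing) : Convex ℝ P.dom := hP.convexOn_hr.1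

/-- A proper lower semicontinuous convex function decreases at most linearly. -/
theorem Standing.hr_lower_bound (hP : P.Standing) {x : Vec n} (hx : x ∈ P.dom) :
    ∃ K : ℝ, 0 ≤ K ∧ ∀ w ∈ P.dom, - K - K * ‖w - x‖ ≤ P.hr w := by
  -- `h` has a minimum on the unit ball around `x`. For a farther `w`, convexity on the segment from
  -- `x` to `w`, evaluated at distance one from `x`, turns this minimum into a linear lower bound.
  obtain ⟨y, -, hymin⟩ := LowerSemicontinuousOn.exists_isMinOn (s := Metric.closedBall x 1)
    ⟨x, by simp⟩ (isCompact_closedBall x 1) (hP.h_lsc.lowerSemicontinuousOn _)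
  have hyx : P.h y ≤ P.h x := hymin (Metric.mem_closedBall_self zero_le_one)
  have hyd : y ∈ P.dom := lt_of_le_of_lt hyx hx
  have hball : ∀ w ∈ P.dom, ‖w - x‖ ≤ 1 → P.hr y ≤ P.hr w := by
    intro w hw h1
    apply hP.hr_le
    rw [hP.coe_hr hw]
    exact hymin (by simpa [dist_eq_norm] using h1)
  refine ⟨|P.hr y| + |P.hr x|, by positivity, fun w hw => ?_⟩
  have ay := neg_abs_le (P.hr y)
  have ax := le_abs_self (P.hr x)
  have ax0 := abs_nonneg (P.hr x)
  have ay0 := abs_nonneg (P.hr y)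
  rcases le_total ‖w - x‖ 1 with h1 | h1
  · have := hball w hw h1
    have := mul_nonneg (add_nonneg ay0 ax0) (norm_nonneg (w - x))
    linarith
  · set r := ‖w - x‖ with hr
    have hr0 : 0 < r := by linarith
    have hi : r⁻¹ ≤ 1 := inv_le_one_of_one_le₀ h1
    have hi0 : 0 < r⁻¹ := inv_pos.2 hr0
    have hm := hP.convexOn_hr.1 hw hx hi0.le (sub_nonneg.2 hi) (by ring)
    have hc := hP.convexOn_hr.2 hw hx hi0.le (sub_nonneg.2 hi) (by ring)
    have hb := hball _ hm (by
      have : r⁻¹ • w + (1 - r⁻¹) • x - x = r⁻¹ • (w - x) := by module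
      rw [this, norm_smul, Real.norm_of_nonneg hi0.le, ← hr, inv_mul_cancel₀ hr0.ne'])
    simp only [smul_eq_mul] at hc
    have h3 : r * P.hr y ≤ P.hr w + (r - 1) * P.hr x := by
      have h4 := mul_le_mul_of_nonneg_left (hb.trans hc) hr0.le
      have h5 : r * (r⁻¹ * P.hr w + (1 - r⁻¹) * P.hr x) = P.hr w + (r - 1) * P.hr x := by
        field_simp
      rwa [h5] at h4
    nlinarith

/-- Existence of minimizers of `h` plus an affine function plus a squared distance. -/
theorem Standing.exists_argmin (hP : P.Standing) {t a : ℝ} (ht : 0 < t) (ha : 0 < a)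
    (g z : Vec n) :
    ∃ y ∈ P.dom, ∀ w ∈ P.dom, t * P.hr y + (inner ℝ g (y - z) + a * ‖y - z‖ ^ 2)
      ≤ t * P.hr w + (inner ℝ g (w - z) + a * ‖w - z‖ ^ 2) := by
  obtain ⟨x, hx⟩ := hP.h_proper.2
  obtain ⟨K, hK0, hK⟩ := hP.hr_lower_bound hx
  set F : Vec n → ℝ := fun w => t * P.hr w + (inner ℝ g (w - z) + a * ‖w - z‖ ^ 2) with hF
  set B := t * K * (1 + ‖z - x‖) + (t * K + ‖g‖) with hB
  have hB0 : 0 ≤ B := by positivity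
  -- Beyond this radius `a r²` beats the linear loss `B r` by at least `|F x|`, so minimizing over a
  -- compact ball suffices.
  set R := 1 + (B + |F x|) / a + ‖x - z‖ with hR
  have hfar : ∀ w ∈ P.dom, R < ‖w - z‖ → F x ≤ F w := by
    intro w hw hRw
    set r := ‖w - z‖ with hr
    have h1 := hK w hw
    have h2 : ‖w - x‖ ≤ r + ‖z - x‖ := by
      rw [hr, ← sub_add_sub_cancel w z x]
      exact norm_add_le _ _
    have h3 : -(‖g‖ * r) ≤ inner ℝ g (w - z) :=
      (abs_le.1 (abs_real_inner_le_norm g (w - z))).1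
    have h4 : 0 ≤ (B + |F x|) / a := by positivity
    have hr1 : 1 ≤ r := by
      have := norm_nonneg (x - z)
      linarith
    have h5 : B + |F x| ≤ a * r := by
      have : (B + |F x|) / a ≤ r := by
        have := norm_nonneg (x - z)
        linarith
      rw [div_le_iff₀ ha] at this
      linarith
    have h6 : t * (-K - K * (r + ‖z - x‖)) ≤ t * P.hr w := by
      apply mul_le_mul_of_nonneg_left _ ht.le
      nlinarith
    have h7 : - (B * r) ≤ t * P.hr w + inner ℝ g (w - z) := by
      have : t * K * (1 + ‖z - x‖) ≤ t * K * (1 + ‖z - x‖) * r :=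
        le_mul_of_one_le_right (by positivity) hr1
      nlinarith
    have h8 : |F x| * 1 ≤ (a * r - B) * r := by
      apply mul_le_mul _ hr1 zero_le_one
      · linarith [abs_nonneg (F x)]
      · linarith
    have h9 := le_abs_self (F x)
    have : F w = t * P.hr w + (inner ℝ g (w - z) + a * r ^ 2) := rfl
    rw [this]
    nlinarith
  -- Dividing by `t` leaves `h` with coefficient one, so its semicontinuity in `EReal` applies
  -- without scaling extended reals.
  set G : Vec n → ℝ := fun w => (inner ℝ g (w - z) + a * ‖w - z‖ ^ 2) / t with hG
  have hGc : Continuous G := by fun_prop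
  have hlsc : LowerSemicontinuous (fun w => P.h w + ((G w : ℝ) : EReal)) := by
    refine hP.h_lsc.add' (continuous_coe_real_ereal.comp hGc).lowerSemicontinuous ?_
    intro w
    exact EReal.continuousAt_add (Or.inr (EReal.coe_ne_bot _)) (Or.inr (EReal.coe_ne_top _))
  have hR0 : ‖x - z‖ ≤ R := by
    have : 0 ≤ (B + |F x|) / a := by positivity
    linarith
  obtain ⟨y, -, hymin⟩ := LowerSemicontinuousOn.exists_isMinOn (s := Metric.closedBall z R)
    ⟨x, by simpa [dist_eq_norm] using hR0⟩ (isCompact_closedBall z R)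
    (hlsc.lowerSemicontinuousOn _)
  have hcmp : ∀ w ∈ P.dom, ‖w - z‖ ≤ R → y ∈ P.dom ∧ F y ≤ F w := by
    intro w hw hwR
    have h1 : P.h y + ((G y : ℝ) : EReal) ≤ P.h w + ((G w : ℝ) : EReal) :=
      hymin (by simpa [dist_eq_norm] using hwR)
    have hyd : y ∈ P.dom := by
      by_contra hnot
      have : P.h y = ⊤ := by
        simpa [dom] using hnot
      rw [this, ← hP.coe_hr hw, EReal.top_add_coe, ← EReal.coe_add] at h1
      exact absurd h1 (not_le.2 (EReal.coe_lt_top _))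
    refine ⟨hyd, ?_⟩
    rw [← hP.coe_hr hw, ← hP.coe_hr hyd, ← EReal.coe_add, ← EReal.coe_add,
      EReal.coe_le_coe_iff] at h1
    have h2 := mul_le_mul_of_nonneg_left h1 ht.le
    have e : ∀ u, t * (P.hr u + G u) = F u := by
      intro u
      simp only [hF, hG]
      field_simp
    rwa [e, e] at h2
  have hx' := hcmp x hx hR0
  refine ⟨y, hx'.1, fun w hw => ?_⟩
  rcases le_or_gt ‖w - z‖ R with h | h
  · exact (hcmp w hw h).2
  · exact hx'.2.trans (hfar w hw h)

/-- The quadratic upper bound for `f` on the convex set `dom h`. -/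
theorem Standing.upper_curvature (hP : P.Standing) {z w : Vec n} (hz : z ∈ P.dom)
    (hw : w ∈ P.dom) :
    P.f w - (P.f z + inner ℝ (gradient P.f z) (w - z)) ≤ P.L / 2 * ‖w - z‖ ^ 2 := by
  set d := w - z with hd
  have hseg : ∀ t ∈ Set.Icc (0 : ℝ) 1, z + t • d ∈ P.dom := by
    intro t ht
    have := hP.convex_dom hw hz ht.1 (sub_nonneg.2 ht.2) (by ring)
    have e : t • w + (1 - t) • z = z + t • d := by rw [hd]; module
    rwa [e] at this
  -- The claim compares the endpoint values of this function along the segment; the Lipschitz bound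
  -- makes its derivative nonpositive.
  have hderiv : ∀ t ∈ Set.Icc (0 : ℝ) 1,
      HasDerivAt (fun t : ℝ => P.f (z + t • d) - t * inner ℝ (gradient P.f z) d
        - P.L / 2 * t ^ 2 * ‖d‖ ^ 2)
        (inner ℝ (gradient P.f (z + t • d)) d - inner ℝ (gradient P.f z) d
          - P.L * t * ‖d‖ ^ 2) t := by
    intro t ht
    have h1 := (hP.f_diff _ (hseg t ht)).hasGradientAt.hasFDerivAt
    have h2 : HasDerivAt (fun t : ℝ => z + t • d) d t := by
      simpa using ((hasDerivAt_id t).smul_const d).const_add z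
    have h3 := h1.comp_hasDerivAt t h2
    have h4 : HasDerivAt (fun t : ℝ => t * inner ℝ (gradient P.f z) d)
        (inner ℝ (gradient P.f z) d) t := by
      simpa using (hasDerivAt_id t).mul_const (inner ℝ (gradient P.f z) d)
    have h5 : HasDerivAt (fun t : ℝ => P.L / 2 * t ^ 2 * ‖d‖ ^ 2) (P.L * t * ‖d‖ ^ 2) t := by
      have := (((hasDerivAt_pow 2 t).const_mul (P.L / 2)).mul_const (‖d‖ ^ 2))
      refine this.congr_deriv ?_
      simp only [Nat.cast_ofNat]
      ring
    have h6 := (h3.sub h4).sub h5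
    rw [InnerProductSpace.toDual_apply_apply] at h6
    exact h6
  have hanti := antitoneOn_of_deriv_nonpos (convex_Icc (0 : ℝ) 1)
    (fun t ht => (hderiv t ht).continuousAt.continuousWithinAt)
    (fun t ht => ((hderiv t (interior_subset ht)).differentiableAt).differentiableWithinAt)
    (fun t ht => by
      have ht' := interior_subset ht
      rw [(hderiv t ht').deriv, ← inner_sub_left]
      have h1 := real_inner_le_norm (gradient P.f (z + t • d) - gradient P.f z) d
      have h2 := hP.grad_lipschitz z hz _ (hseg t ht')
      rw [add_sub_cancel_left, norm_smul, Real.norm_of_nonneg ht'.1] at h2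
      have h3 := mul_le_mul_of_nonneg_right h2 (norm_nonneg d)
      nlinarith)
  have h := hanti (Set.left_mem_Icc.2 zero_le_one) (Set.right_mem_Icc.2 zero_le_one) zero_le_one
  simp only [one_smul, zero_smul, add_zero, hd, add_sub_cancel] at h
  simp only [hd]
  linarith

end Problem

end IPAAL

namespace IPAAL

/-! ### Analysis of the ACG method -/

section ACG

variable {n : ℕ} {s : Set (Vec n)} {ψs ψn : Vec n → ℝ} {M μ : ℝ} {x0 : Vec n}

theorem argminOn_spec {F : Vec n → ℝ} (h : ∃ y ∈ s, ∀ w ∈ s, F y ≤ F w) :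
    argminOn s F ∈ s ∧ ∀ w ∈ s, F (argminOn s F) ≤ F w :=
  Classical.epsilon_spec (p := fun y => y ∈ s ∧ ∀ w ∈ s, F y ≤ F w) h

/-- The hypotheses under which the ACG method is analysed. -/
structure ACGData (s : Set (Vec n)) (ψs ψn : Vec n → ℝ) (M μ : ℝ) (x0 : Vec n) : Prop where
  x0_mem : x0 ∈ s
  M_pos : 0 < M
  μ_nonneg : 0 ≤ μ
  strong : StrongConvexOn s μ ψn
  lower : ∀ z ∈ s, ∀ w ∈ s, linearization ψs z w ≤ ψs w
  upper : ∀ z ∈ s, ∀ w ∈ s, ψs w ≤ linearization ψs z w + M / 2 * ‖w - z‖ ^ 2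
  exists_min : ∀ (g : Vec n) (k a : ℝ), 0 < a → ∃ y ∈ s, ∀ w ∈ s,
    inner ℝ g y + k + ψn y + 1 / (2 * a) * ‖y - x0‖ ^ 2
      ≤ inner ℝ g w + k + ψn w + 1 / (2 * a) * ‖w - x0‖ ^ 2

/-- The estimate function whose minimizer is the iterate `y`. -/
noncomputable def acgEstimate (ψn : Vec n → ℝ) (x0 : Vec n) (q : ACGState n) (w : Vec n) : ℝ :=
  q.a * (q.Γ w + ψn w) + 1 / 2 * ‖w - x0‖ ^ 2

/-- The invariants of the ACG method. -/
structure ACGInv (s : Set (Vec n)) (ψs ψn : Vec n → ℝ) (x0 : Vec n) (q : ACGState n) :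
    Prop where
  a_nonneg : 0 ≤ q.a
  x_mem : q.x ∈ s
  y_mem : q.y ∈ s
  affine : ∃ (g : Vec n) (k : ℝ), ∀ w, q.Γ w = inner ℝ g w + k
  Γ_le : ∀ w ∈ s, q.a * q.Γ w ≤ q.a * ψs w
  y_min : ∀ w ∈ s, acgEstimate ψn x0 q q.y ≤ acgEstimate ψn x0 q w
  estimate : q.a * (ψs q.x + ψn q.x) ≤ acgEstimate ψn x0 q q.y

theorem acgInit_inv (hD : ACGData s ψs ψn M μ x0) : ACGInv s ψs ψn x0 (acgInit x0) where
  a_nonneg := le_rfl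
  x_mem := hD.x0_mem
  y_mem := hD.x0_mem
  affine := ⟨0, 0, fun w => by simp [acgInit]⟩
  Γ_le := fun w _ => by simp [acgInit]
  y_min := fun w _ => by simp [acgInit, acgEstimate]
  estimate := by simp [acgInit, acgEstimate]

theorem acgEstimate_strongConvexOn (hD : ACGData s ψs ψn M μ x0) {q : ACGState n}
    (hq : ACGInv s ψs ψn x0 q) :
    StrongConvexOn s (μ * q.a + 1) (acgEstimate ψn x0 q) := by
  obtain ⟨g, k, hΓ⟩ := hq.affine
  refine ⟨hD.strong.1, fun x hx y hy a b ha hb hab => ?_⟩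
  have h1 := mul_le_mul_of_nonneg_left (hD.strong.2 hx hy ha hb hab) hq.a_nonneg
  simp only [smul_eq_mul, acgEstimate, hΓ, norm_combo_sq x y x0 hab, inner_add_right,
    real_inner_smul_right] at h1 ⊢
  obtain rfl : b = 1 - a := by linarith
  nlinarith

/-- The size of the step in the ACG method. -/
theorem acgStep_a (hM : 0 < M) (hμ : 0 ≤ μ) (q : ACGState n) (hq : 0 ≤ q.a) :
    q.a < (acgStep s ψs ψn M μ x0 q).a ∧
    M * ((acgStep s ψs ψn M μ x0 q).a - q.a) ^ 2
      = (μ * q.a + 1) * (acgStep s ψs ψn M μ x0 q).a := by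
  set t := μ * q.a + 1 with ht
  have ht0 : 0 < t := by positivity
  set r := √(t ^ 2 + 4 * M * t * q.a) with hr
  have hr2 : r ^ 2 = t ^ 2 + 4 * M * t * q.a := Real.sq_sqrt (by positivity)
  have hr0 : 0 ≤ r := Real.sqrt_nonneg _
  have e : (acgStep s ψs ψn M μ x0 q).a = q.a + (t + r) / (2 * M) := rfl
  rw [e]
  refine ⟨lt_add_of_pos_right _ (by positivity), ?_⟩
  have hM' := hM.ne'
  field_simp
  linear_combination hr2

/-- Both bounds come from `M a² = (μ A + 1) A'` with `a = A' - A`: dropping `μ A` and using `A' ≥ a`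
gives `M a ≥ 1`; dropping `1` and using `A' ≥ A` gives `a ≥ A √(μ/M)`. -/
theorem acgStep_growth (hM : 0 < M) (hμ : 0 ≤ μ) (q : ACGState n) (hq : 0 ≤ q.a) :
    1 / M ≤ (acgStep s ψs ψn M μ x0 q).a ∧
    q.a * (1 + √(μ / M)) ≤ (acgStep s ψs ψn M μ x0 q).a := by
  obtain ⟨h1, h2⟩ := acgStep_a (s := s) (ψs := ψs) (ψn := ψn) (x0 := x0) hM hμ q hq
  set A' := (acgStep s ψs ψn M μ x0 q).a
  set a := A' - q.a with ha
  have ha0 : 0 < a := by linarith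
  have hA' : A' = q.a + a := by ring
  constructor
  · rw [div_le_iff₀ hM]
    have h3 : a * 1 ≤ a * (M * a) := by
      have : 0 ≤ μ * q.a * A' := by
        have : 0 ≤ A' := by linarith
        positivity
      nlinarith
    have h4 := le_of_mul_le_mul_left h3 ha0
    nlinarith
  · have h3 : q.a * √(μ / M) ≤ a := by
      apply le_of_sq_le_sq _ ha0.le
      rw [mul_pow, Real.sq_sqrt (by positivity), mul_div_assoc', div_le_iff₀ hM]
      nlinarith [mul_nonneg hμ hq, mul_nonneg (mul_nonneg hμ hq) ha0.le]
    linarith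

/-- The invariant `estimate` survives because the step size balances two terms: the smoothness error
at the new `x` equals the quadratic growth of the old estimate function between its minimizer and
the new `y`. -/
theorem acgStep_inv (hD : ACGData s ψs ψn M μ x0) {q : ACGState n}
    (hq : ACGInv s ψs ψn x0 q) :
    ACGInv s ψs ψn x0 (acgStep s ψs ψn M μ x0 q) := by
  obtain ⟨hlt, heq⟩ :=
    acgStep_a (s := s) (ψs := ψs) (ψn := ψn) (x0 := x0) hD.M_pos hD.μ_nonneg q hq.a_nonneg
  obtain ⟨g, k, hΓ⟩ := hq.affine
  set q' := acgStep s ψs ψn M μ x0 q with hq'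
  set A := q.a with hA
  set A' := q'.a with hA'
  have hA0 : 0 ≤ A := hq.a_nonneg
  have hA'0 : 0 < A' := by linarith
  set xt := (A / A') • q.x + ((A' - A) / A') • q.y with hxt
  have hw1 : 0 ≤ A / A' := by positivity
  have hw2 : 0 ≤ (A' - A) / A' := div_nonneg (by linarith) hA'0.le
  have hw : A / A' + (A' - A) / A' = 1 := by field_simp; ring
  have hxts : xt ∈ s := hD.strong.1 hq.x_mem hq.y_mem hw1 hw2 hw
  have hΓ' : ∀ w, q'.Γ w = A / A' * q.Γ w + (A' - A) / A' * linearization ψs xt w :=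
    fun w => rfl
  have hAΓ' : ∀ w, A' * q'.Γ w = A * q.Γ w + (A' - A) * linearization ψs xt w := by
    intro w
    rw [hΓ']
    field_simp
  have haff : ∃ (g : Vec n) (k : ℝ), ∀ w, q'.Γ w = inner ℝ g w + k := by
    refine ⟨(A / A') • g + ((A' - A) / A') • gradient ψs xt,
      A / A' * k + (A' - A) / A' * (ψs xt - inner ℝ (gradient ψs xt) xt), fun w => ?_⟩
    rw [hΓ', hΓ, linearization, inner_sub_right, inner_add_left, real_inner_smul_left,
      real_inner_smul_left]
    ring
  have hy : q'.y ∈ s ∧ ∀ w ∈ s, q'.Γ q'.y + ψn q'.y + 1 / (2 * A') * ‖q'.y - x0‖ ^ 2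
      ≤ q'.Γ w + ψn w + 1 / (2 * A') * ‖w - x0‖ ^ 2 := by
    refine argminOn_spec
      (F := fun y => q'.Γ y + ψn y + 1 / (2 * A') * ‖y - x0‖ ^ 2) ?_
    obtain ⟨g', k', h'⟩ := haff
    obtain ⟨y, hys, hym⟩ := hD.exists_min g' k' A' hA'0
    exact ⟨y, hys, fun w hw => by simpa only [h'] using hym w hw⟩
  have hx' : q'.x = (A / A') • q.x + ((A' - A) / A') • q'.y := rfl
  have hxs : q'.x ∈ s := by
    rw [hx']
    exact hD.strong.1 hq.x_mem hy.1 hw1 hw2 hw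
  refine ⟨hA'0.le, hxs, hy.1, haff, ?_, ?_, ?_⟩
  · intro w hws
    rw [hAΓ']
    have h1 := hq.Γ_le w hws
    have h2 := mul_le_mul_of_nonneg_left (hD.lower xt hxts w hws) (by linarith : 0 ≤ A' - A)
    linarith
  · intro w hws
    have h1 := mul_le_mul_of_nonneg_left (hy.2 w hws) hA'0.le
    have e : ∀ u, A' * (q'.Γ u + ψn u + 1 / (2 * A') * ‖u - x0‖ ^ 2)
        = acgEstimate ψn x0 q' u := by
      intro u
      rw [acgEstimate, ← hA']
      field_simp
    rwa [e, e] at h1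
  · have hgrow := strongConvexOn_growth (acgEstimate_strongConvexOn hD hq) hq.y_mem hq.y_min hy.1
    have hlow := mul_le_mul_of_nonneg_left (hD.lower xt hxts q.x hq.x_mem) hA0
    have hup := mul_le_mul_of_nonneg_left (hD.upper xt hxts q'.x hxs) hA'0.le
    have hcx := mul_le_mul_of_nonneg_left
      (hD.strong.convexOn (fun r => by have := hD.μ_nonneg; positivity)
        |>.2 hq.x_mem hy.1 hw1 hw2 hw) hA'0.le
    rw [← hx'] at hcx
    have e1 : A' * linearization ψs xt q'.x
        = A * linearization ψs xt q.x + (A' - A) * linearization ψs xt q'.y := by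
      have : q'.x - xt = (A / A') • (q.x - xt) + ((A' - A) / A') • (q'.y - xt) := by
        have : xt = (A / A' + (A' - A) / A') • xt := by rw [hw, one_smul]
        nth_rewrite 1 [this]
        rw [hx']
        module
      simp only [linearization, this, inner_add_right, real_inner_smul_right]
      field_simp
      ring
    have e2 : A' * (M / 2 * ‖q'.x - xt‖ ^ 2) = (μ * A + 1) / 2 * ‖q'.y - q.y‖ ^ 2 := by
      have : q'.x - xt = ((A' - A) / A') • (q'.y - q.y) := by
        rw [hx', hxt]
        module
      rw [this, norm_smul, mul_pow, Real.norm_of_nonneg hw2]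
      have : A' * (M / 2 * (((A' - A) / A') ^ 2 * ‖q'.y - q.y‖ ^ 2))
          = M * (A' - A) ^ 2 / A' / 2 * ‖q'.y - q.y‖ ^ 2 := by
        field_simp
      rw [this, heq]
      field_simp
    have e3 : A' * ((A / A') • ψn q.x + ((A' - A) / A') • ψn q'.y)
        = A * ψn q.x + (A' - A) * ψn q'.y := by
      simp only [smul_eq_mul]
      field_simp
    have h6 := hq.estimate
    have h7 := hAΓ' q'.y
    rw [e3] at hcx
    rw [mul_add, e1, e2] at hup
    simp only [acgEstimate, ← hA, ← hA'] at hgrow h6 ⊢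
    linarith

/-- The guarantees of the ACG method after at least one iteration. -/
structure ACGOutput (s : Set (Vec n)) (ψs ψn : Vec n → ℝ) (x0 : Vec n) (q : ACGState n) :
    Prop where
  x_mem : q.x ∈ s
  eps_nonneg : 0 ≤ acgEps ψs ψn x0 q
  subgrad : ∀ w ∈ s, ψs q.x + ψn q.x + inner ℝ (acgU x0 q) (w - q.x) - acgEps ψs ψn x0 q
    ≤ ψs w + ψn w
  residual : 2 * q.a * acgEps ψs ψn x0 q + ‖q.a • acgU x0 q + q.x - x0‖ ^ 2 ≤ ‖q.x - x0‖ ^ 2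

/-- `acgU` is a subgradient of `Γ + ψ_n` at `y`, and `Γ` minorizes `ψ_s`; moving the base point from
`y` to `x` costs exactly `acgEps`. The residual bound is the invariant `estimate` rewritten with `a
u = x₀ - y`. -/
theorem ACGInv.output (hD : ACGData s ψs ψn M μ x0) {q : ACGState n}
    (hq : ACGInv s ψs ψn x0 q) (ha : 0 < q.a) : ACGOutput s ψs ψn x0 q := by
  obtain ⟨g, k, hΓ⟩ := hq.affine
  have hU : q.a • acgU x0 q = x0 - q.y := by
    rw [acgU, smul_smul, mul_one_div_cancel ha.ne', one_smul]
  have hsub : ∀ w ∈ s, q.Γ q.y + ψn q.y + inner ℝ (acgU x0 q) (w - q.y) ≤ q.Γ w + ψn w := by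
    intro w hw
    have hconv : ConvexOn ℝ s (fun x => q.a * (q.Γ x + ψn x)) := by
      refine ⟨hD.strong.1, fun x hx y hy a b p r hab => ?_⟩
      have h0 := mul_le_mul_of_nonneg_left (hD.strong.convexOn (fun r => by
        have := hD.μ_nonneg; positivity) |>.2 hx hy p r hab) ha.le
      simp only [smul_eq_mul, hΓ, inner_add_right, real_inner_smul_right] at h0 ⊢
      obtain rfl : b = 1 - a := by linarith
      linarith
    have h1 := convexOn_subgradient_of_prox hconv (a := 1) (z := x0) hq.y_mem hq.y_min hw
    rw [one_smul, ← hU, real_inner_smul_left] at h1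
    apply le_of_mul_le_mul_left _ ha
    linarith
  have heps : acgEps ψs ψn x0 q = ψs q.x + ψn q.x - q.Γ q.y - ψn q.y
    - inner ℝ (acgU x0 q) (q.x - q.y) := rfl
  have hmain : ∀ w ∈ s, ψs q.x + ψn q.x + inner ℝ (acgU x0 q) (w - q.x)
      - acgEps ψs ψn x0 q ≤ ψs w + ψn w := by
    intro w hw
    have h1 := hsub w hw
    have h2 := le_of_mul_le_mul_left (hq.Γ_le w hw) ha
    have e : w - q.x = (w - q.y) - (q.x - q.y) := by abel
    rw [heps, e, inner_sub_right]
    linarith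
  refine ⟨hq.x_mem, ?_, hmain, ?_⟩
  · have := hmain q.x hq.x_mem
    rw [sub_self, inner_zero_right] at this
    linarith
  · have h1 := hq.estimate
    rw [acgEstimate] at h1
    have h2 : q.a * inner ℝ (acgU x0 q) (q.x - q.y) = inner ℝ (x0 - q.y) (q.x - q.y) := by
      rw [← hU, real_inner_smul_left]
    have h3 : q.a • acgU x0 q + q.x - x0 = q.x - q.y := by
      rw [hU]
      abel
    have h4 : ‖q.x - x0‖ ^ 2 = ‖q.x - q.y‖ ^ 2 + ‖q.y - x0‖ ^ 2
        - 2 * inner ℝ (x0 - q.y) (q.x - q.y) := by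
      have : q.x - x0 = (q.x - q.y) - (x0 - q.y) := by abel
      rw [this, norm_sub_sq_real, norm_sub_rev x0 q.y, real_inner_comm]
      ring
    rw [h3, h4, heps]
    have : 2 * q.a * (ψs q.x + ψn q.x - q.Γ q.y - ψn q.y - inner ℝ (acgU x0 q) (q.x - q.y))
        = 2 * (q.a * (ψs q.x + ψn q.x) - q.a * (q.Γ q.y + ψn q.y)
          - q.a * inner ℝ (acgU x0 q) (q.x - q.y)) := by ring
    rw [this, h2]
    linarith

theorem acg_iterate_spec (hD : ACGData s ψs ψn M μ x0) (j : ℕ) :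
    ACGInv s ψs ψn x0 ((acgStep s ψs ψn M μ x0)^[j] (acgInit x0)) := by
  induction j with
  | zero => exact acgInit_inv hD
  | succ j ih =>
    rw [Function.iterate_succ_apply']
    exact acgStep_inv hD ih

theorem acg_iterate_a (hD : ACGData s ψs ψn M μ x0) (j : ℕ) :
    1 / M * (1 + √(μ / M)) ^ j ≤ ((acgStep s ψs ψn M μ x0)^[j + 1] (acgInit x0)).a := by
  induction j with
  | zero =>
    rw [Function.iterate_succ_apply', pow_zero, mul_one]
    exact (acgStep_growth hD.M_pos hD.μ_nonneg _ (acg_iterate_spec hD 0).a_nonneg).1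
  | succ j ih =>
    rw [Function.iterate_succ_apply', pow_succ, ← mul_assoc]
    refine le_trans ?_
      (acgStep_growth hD.M_pos hD.μ_nonneg _ (acg_iterate_spec hD (j + 1)).a_nonneg).2
    gcongr

theorem acg_output (hD : ACGData s ψs ψn M μ x0) (j : ℕ) :
    ACGOutput s ψs ψn x0 ((acgStep s ψs ψn M μ x0)^[j + 1] (acgInit x0)) := by
  refine (acg_iterate_spec hD (j + 1)).output hD (lt_of_lt_of_le ?_ (acg_iterate_a hD j))
  have := hD.M_pos
  positivity

/-- The relative stopping test of the ACG method passes once `a ≥ 8 / σ ^ 2`. -/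
theorem ACGOutput.test {q : ACGState n} (hq : ACGOutput s ψs ψn x0 q) {σ : ℝ} (h0 : 0 < σ)
    (h1 : σ ≤ 1) (ha : 8 / σ ^ 2 ≤ q.a) :
    ‖acgU x0 q‖ ^ 2 + 2 * acgEps ψs ψn x0 q ≤ σ ^ 2 * ‖acgU x0 q + x0 - q.x‖ ^ 2 := by
  have hs2 : 0 < σ ^ 2 := by positivity
  rw [div_le_iff₀ hs2] at ha
  have ha8 : 8 ≤ q.a := by
    have : σ ^ 2 ≤ 1 := pow_le_one₀ h0.le h1
    have hq0 : 0 ≤ q.a := by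
      by_contra! hneg
      nlinarith
    nlinarith
  have hr := hq.residual
  set X := ‖q.x - x0‖ with hX
  set U := ‖acgU x0 q‖ with hU
  have hX0 : 0 ≤ X := norm_nonneg _
  have hU0 : 0 ≤ U := norm_nonneg _
  have he := hq.eps_nonneg
  set ε := acgEps ψs ψn x0 q
  have haε : 0 ≤ 2 * q.a * ε := by positivity
  have h2 : ‖q.a • acgU x0 q + q.x - x0‖ ≤ X := by
    apply le_of_sq_le_sq _ hX0
    linarith
  -- With `a ≥ 8` this yields `U ≤ X/4`, so the right side of the test is at least `σ² (3X/4)²`. On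
  -- the left, `a (U² + 2ε) ≤ 3X²/2`, while `a σ² (3X/4)² ≥ 9X²/2`.
  have h3 : q.a * U ≤ 2 * X := by
    have e : q.a • acgU x0 q = (q.a • acgU x0 q + q.x - x0) - (q.x - x0) := by abel
    have h4 : ‖q.a • acgU x0 q‖ ≤ X + X := by
      rw [e]
      exact (norm_sub_le _ _).trans (by linarith)
    rw [norm_smul, Real.norm_of_nonneg (by linarith)] at h4
    linarith
  have h5 : 2 * q.a * ε ≤ X ^ 2 := by
    have := sq_nonneg ‖q.a • acgU x0 q + q.x - x0‖
    linarith
  have h6 : 3 / 4 * X ≤ ‖acgU x0 q + x0 - q.x‖ := by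
    have e : q.x - x0 = acgU x0 q - (acgU x0 q + x0 - q.x) := by abel
    have h7 : X ≤ U + ‖acgU x0 q + x0 - q.x‖ := by
      rw [hX, e]
      exact norm_sub_le _ _
    nlinarith
  have h8 : (3 / 4 * X) ^ 2 ≤ ‖acgU x0 q + x0 - q.x‖ ^ 2 := by gcongr
  have h9 : q.a * U * U ≤ 2 * X * U := by gcongr
  have h10 : U ≤ X / 4 := by nlinarith
  have h11 : q.a * (U ^ 2 + 2 * ε) ≤ q.a * (σ ^ 2 * (3 / 4 * X) ^ 2) := by
    have : 8 * (3 / 4 * X) ^ 2 ≤ q.a * σ ^ 2 * (3 / 4 * X) ^ 2 := by gcongr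
    have : 2 * X * U ≤ 2 * X * (X / 4) := by gcongr
    nlinarith
  have h12 := le_of_mul_le_mul_left h11 (by linarith)
  have h13 : σ ^ 2 * (3 / 4 * X) ^ 2 ≤ σ ^ 2 * ‖acgU x0 q + x0 - q.x‖ ^ 2 := by gcongr
  linarith

end ACG

end IPAAL

namespace IPAAL

/-! ### The parameters `τ_θ` and `σ_θ` -/

theorem tau_le_half {θ : ℝ} : tau θ ≤ 1 / 2 := by
  unfold tau
  split_ifs with h
  · rw [div_le_iff₀ (by linarith)]
    linarith
  · exact le_rfl

theorem quadA_pos {θ : ℝ} (h0 : 0 < θ) (h1 : θ ≤ 1) : 3 / 4 ≤ quadA θ := by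
  have ht := tau_pos h0
  have h2 : 0 ≤ 1 - θ := by linarith
  unfold quadA
  have : 0 ≤ 2 * (1 - θ) * (3 * tau θ + 1) / (θ * tau θ) := by positivity
  linarith

theorem sigmaTheta_pos {θ : ℝ} (h0 : 0 < θ) (h1 : θ ≤ 1) : 0 < sigmaTheta θ :=
  ((sigmaTheta_spec h0 h1 _).2 rfl).1

/-- The linear term alone suffices: its coefficient is at least `1/2` and its value at the root at
most `1/8`. -/
theorem sigmaTheta_le {θ : ℝ} (h0 : 0 < θ) (h1 : θ ≤ 1) : sigmaTheta θ ≤ 1 / 4 := by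
  obtain ⟨hp, he⟩ := (sigmaTheta_spec h0 h1 _).2 rfl
  have hA := quadA_pos h0 h1
  have hB : 1 / 2 ≤ quadB θ := by
    unfold quadB
    rw [le_div_iff₀ (by linarith)]
    linarith
  nlinarith [sq_nonneg (sigmaTheta θ)]

theorem sigmaTheta_sq_le {θ : ℝ} (h0 : 0 < θ) (h1 : θ ≤ 1) :
    2 * (1 - θ) * (3 * tau θ + 1) / (θ * tau θ) * sigmaTheta θ ^ 2 ≤ 1 / 8 := by
  obtain ⟨hp, he⟩ := (sigmaTheta_spec h0 h1 _).2 rfl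
  have hB : 0 ≤ quadB θ := by
    unfold quadB
    apply div_nonneg <;> linarith
  have : 0 ≤ quadB θ * sigmaTheta θ := by positivity
  unfold quadA at he
  nlinarith [sq_nonneg (sigmaTheta θ)]

/-! ### Gradients of the smooth building blocks -/

section Gradient

variable {n l : ℕ}

theorem hasGradientAt_norm_sq_sub (z0 z : Vec n) :
    HasGradientAt (fun w => ‖w - z0‖ ^ 2) ((2 : ℝ) • (z - z0)) z := by
  rw [hasGradientAt_iff_hasFDerivAt]
  have h := ((hasFDerivAt_id z).sub_const z0).norm_sq
  refine h.congr_fderiv ?_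
  ext d
  simp

theorem hasGradientAt_inner_left (v z : Vec n) : HasGradientAt (fun w => inner ℝ v w) v z := by
  rw [hasGradientAt_iff_hasFDerivAt]
  exact (InnerProductSpace.toDual ℝ (Vec n) v).hasFDerivAt

theorem hasGradientAt_const_mul {f : Vec n → ℝ} {g z : Vec n} (h : HasGradientAt f g z) (a : ℝ) :
    HasGradientAt (fun w => a * f w) (a • g) z := by
  rw [hasGradientAt_iff_hasFDerivAt] at h ⊢
  refine (h.const_mul a).congr_fderiv ?_
  ext d
  simp

theorem hasGradientAt_add {f f' : Vec n → ℝ} {g g' z : Vec n} (h : HasGradientAt f g z)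
    (h' : HasGradientAt f' g' z) : HasGradientAt (fun w => f w + f' w) (g + g') z := by
  rw [hasGradientAt_iff_hasFDerivAt] at h h' ⊢
  refine (h.add h').congr_fderiv ?_
  ext d
  simp

theorem hasGradientAt_inner_affine (A : Vec n →L[ℝ] Vec l) (b p : Vec l) (z : Vec n) :
    HasGradientAt (fun w => inner ℝ p (A w - b)) (ContinuousLinearMap.adjoint A p) z := by
  rw [hasGradientAt_iff_hasFDerivAt]
  have h := ((innerSL ℝ p).hasFDerivAt (x := A z - b)).comp z
    ((A.hasFDerivAt (x := z)).sub_const b)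
  refine h.congr_fderiv ?_
  ext d
  simp [ContinuousLinearMap.adjoint_inner_left]

theorem hasGradientAt_norm_sq_affine (A : Vec n →L[ℝ] Vec l) (b : Vec l) (z : Vec n) :
    HasGradientAt (fun w => ‖A w - b‖ ^ 2)
      ((2 : ℝ) • ContinuousLinearMap.adjoint A (A z - b)) z := by
  rw [hasGradientAt_iff_hasFDerivAt]
  have h := ((A.hasFDerivAt (x := z)).sub_const b).norm_sq
  refine h.congr_fderiv ?_
  ext d
  simp only [smul_apply, ContinuousLinearMap.comp_apply,
    innerSL_apply_apply, InnerProductSpace.toDual_apply_apply, real_inner_smul_left,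
    ContinuousLinearMap.adjoint_inner_left, nsmul_eq_mul, Nat.cast_ofNat]

end Gradient

namespace Problem

variable {n l : ℕ} {P : Problem n l}

theorem Standing.lam_pos (hP : P.Standing) {θ : ℝ} (h0 : 0 < θ) : 0 < P.lam θ :=
  div_pos (tau_pos h0) hP.m_pos

theorem Standing.lam_mul_m (hP : P.Standing) (θ : ℝ) : P.lam θ * P.m = tau θ :=
  div_mul_cancel₀ _ hP.m_pos.ne'

theorem Standing.L_pos (hP : P.Standing) : 0 < P.L := hP.m_pos.trans_le hP.m_le_L

theorem Standing.Lc_pos (hP : P.Standing) {c : ℝ} (hc : 0 < c) : 0 < P.Lc c := by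
  have := hP.L_pos
  unfold Lc
  positivity

theorem Standing.norm_A_pos (hP : P.Standing) : 0 < ‖P.A‖ := norm_pos_iff.2 hP.A_ne_zero

theorem Standing.one_le (hP : P.Standing) {θ c : ℝ} (h0 : 0 < θ) (hc : 0 < c) :
    1 ≤ P.lam θ * P.Lc c + 1 := by
  have h1 := hP.lam_pos h0
  have h2 := hP.Lc_pos hc
  have : 0 < P.lam θ * P.Lc c := by positivity
  linarith

theorem Standing.sig_pos (hP : P.Standing) {θ c : ℝ} (h0 : 0 < θ) (h1 : θ ≤ 1) (hc : 0 < c) :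
    0 < P.sig θ c := by
  have := hP.one_le h0 hc
  refine lt_min ?_ (sigmaTheta_pos h0 h1)
  have : 0 < √(P.lam θ * P.Lc c + 1) := Real.sqrt_pos.2 (by linarith)
  positivity

theorem sig_le_sigmaTheta (P : Problem n l) (θ c : ℝ) : P.sig θ c ≤ sigmaTheta θ :=
  min_le_right _ _

theorem Standing.sig_sq_mul_le (hP : P.Standing) {θ c : ℝ} (h0 : 0 < θ) (h1 : θ ≤ 1)
    (hc : 0 < c) : P.sig θ c ^ 2 * (P.lam θ * P.Lc c + 1) ≤ 1 := by
  have h2 := hP.one_le h0 hc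
  have h3 : P.sig θ c ≤ 1 / √(P.lam θ * P.Lc c + 1) := min_le_left _ _
  have h4 := hP.sig_pos h0 h1 hc
  have h5 : P.sig θ c ^ 2 ≤ (1 / √(P.lam θ * P.Lc c + 1)) ^ 2 := by gcongr
  rw [div_pow, one_pow, Real.sq_sqrt (by linarith), le_div_iff₀ (by linarith)] at h5
  exact h5

/-- Both entries of the minimum defining `σ` are at least `σ_θ / √(λ L_c + 1)`, because `σ_θ ≤ 1 ≤
√(λ L_c + 1)`. -/
theorem Standing.inv_sig_sq_le (hP : P.Standing) {θ c : ℝ} (h0 : 0 < θ) (h1 : θ ≤ 1)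
    (hc : 0 < c) : 1 / P.sig θ c ^ 2 ≤ (P.lam θ * P.Lc c + 1) / sigmaTheta θ ^ 2 := by
  have h2 := hP.one_le h0 hc
  have h3 := sigmaTheta_pos h0 h1
  have h4 := sigmaTheta_le h0 h1
  have h5 : 1 ≤ √(P.lam θ * P.Lc c + 1) := by
    exact Real.one_le_sqrt.2 h2
  have h6 : sigmaTheta θ / √(P.lam θ * P.Lc c + 1) ≤ P.sig θ c := by
    refine le_min ?_ ?_
    · gcongr
      linarith
    · exact div_le_self h3.le h5
  have h7 := hP.sig_pos h0 h1 hc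
  have h8 : (sigmaTheta θ / √(P.lam θ * P.Lc c + 1)) ^ 2 ≤ P.sig θ c ^ 2 := by gcongr
  rw [div_pow, Real.sq_sqrt (by linarith)] at h8
  rw [div_le_iff₀ (by positivity)] at h8
  rw [div_le_div_iff₀ (by positivity) (by positivity)]
  linarith

/-! ### The prox subproblems -/

variable {θ c : ℝ} {z0 : Vec n} {p : Vec l}

theorem Standing.hasGradientAt_g (hP : P.Standing) (θ c : ℝ) (p : Vec l) {z : Vec n}
    (hz : z ∈ P.dom) :
    HasGradientAt (P.g θ c p) (gradient P.f z
      + ContinuousLinearMap.adjoint P.A ((1 - θ) • p + c • (P.A z - P.b))) z := by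
  have h1 := (hP.f_diff z hz).hasGradientAt
  have h2 := hasGradientAt_const_mul (hasGradientAt_inner_affine P.A P.b p z) (1 - θ)
  have h3 := hasGradientAt_const_mul (hasGradientAt_norm_sq_affine P.A P.b z) (c / 2)
  have h := hasGradientAt_add (hasGradientAt_add h1 h2) h3
  have e : gradient P.f z + ContinuousLinearMap.adjoint P.A ((1 - θ) • p + c • (P.A z - P.b))
      = gradient P.f z + (1 - θ) • ContinuousLinearMap.adjoint P.A p
        + (c / 2) • (2 : ℝ) • ContinuousLinearMap.adjoint P.A (P.A z - P.b) := by
    rw [map_add, map_smul, map_smul]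
    module
  rw [e]
  exact h

theorem Standing.gradient_g (hP : P.Standing) (θ c : ℝ) (p : Vec l) {z : Vec n}
    (hz : z ∈ P.dom) : gradient (P.g θ c p) z = gradient P.f z
      + ContinuousLinearMap.adjoint P.A ((1 - θ) • p + c • (P.A z - P.b)) :=
  (hP.hasGradientAt_g θ c p hz).gradient

/-- The exact expansion of the quadratic part of `g`. -/
theorem Standing.g_expand (hP : P.Standing) (θ c : ℝ) (p : Vec l) {z : Vec n}
    (hz : z ∈ P.dom) (w : Vec n) :
    P.g θ c p w - (P.g θ c p z + inner ℝ (gradient (P.g θ c p) z) (w - z))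
      = P.f w - (P.f z + inner ℝ (gradient P.f z) (w - z)) + c / 2 * ‖P.A (w - z)‖ ^ 2 := by
  rw [hP.gradient_g θ c p hz, inner_add_left, ContinuousLinearMap.adjoint_inner_left]
  have e : P.A w - P.b = (P.A z - P.b) + P.A (w - z) := by
    rw [map_sub]
    abel
  simp only [g]
  rw [e, norm_add_sq_real, inner_add_left, inner_add_right, real_inner_smul_left,
    real_inner_smul_left]
  ring

theorem norm_A_sq_le (P : Problem n l) (u : Vec n) : ‖P.A u‖ ^ 2 ≤ ‖P.A‖ ^ 2 * ‖u‖ ^ 2 := by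
  rw [← mul_pow]
  gcongr
  exact P.A.le_opNorm u

theorem Standing.g_upper (hP : P.Standing) (θ : ℝ) {c : ℝ} (hc : 0 < c) (p : Vec l)
    {z w : Vec n} (hz : z ∈ P.dom) (hw : w ∈ P.dom) :
    P.g θ c p w - (P.g θ c p z + inner ℝ (gradient (P.g θ c p) z) (w - z))
      ≤ P.Lc c / 2 * ‖w - z‖ ^ 2 := by
  rw [hP.g_expand θ c p hz]
  have h1 := hP.upper_curvature hz hw
  have h2 := mul_le_mul_of_nonneg_left (P.norm_A_sq_le (w - z)) (by positivity : 0 ≤ c / 2)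
  unfold Lc
  linarith

theorem Standing.g_lower (hP : P.Standing) (θ : ℝ) {c : ℝ} (hc : 0 < c) (p : Vec l)
    {z w : Vec n} (hz : z ∈ P.dom) (hw : w ∈ P.dom) :
    - (P.m / 2) * ‖w - z‖ ^ 2
      ≤ P.g θ c p w - (P.g θ c p z + inner ℝ (gradient (P.g θ c p) z) (w - z)) := by
  rw [hP.g_expand θ c p hz]
  have h1 := hP.lower_curvature z hz w hw
  have : 0 ≤ c / 2 * ‖P.A (w - z)‖ ^ 2 := by positivity
  linarith

theorem Standing.gradient_g_lipschitz (hP : P.Standing) (θ : ℝ) {c : ℝ} (hc : 0 < c) (p : Vec l)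
    {z w : Vec n} (hz : z ∈ P.dom) (hw : w ∈ P.dom) :
    ‖gradient (P.g θ c p) w - gradient (P.g θ c p) z‖ ≤ P.Lc c * ‖w - z‖ := by
  rw [hP.gradient_g θ c p hz, hP.gradient_g θ c p hw]
  have e : gradient P.f w + ContinuousLinearMap.adjoint P.A ((1 - θ) • p + c • (P.A w - P.b))
      - (gradient P.f z + ContinuousLinearMap.adjoint P.A ((1 - θ) • p + c • (P.A z - P.b)))
      = (gradient P.f w - gradient P.f z)
        + c • ContinuousLinearMap.adjoint P.A (P.A (w - z)) := by
    simp only [map_add, map_smul, map_sub]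
    module
  rw [e]
  have h1 := hP.grad_lipschitz z hz w hw
  have h2 : ‖c • ContinuousLinearMap.adjoint P.A (P.A (w - z))‖ ≤ c * (‖P.A‖ * (‖P.A‖ * ‖w - z‖)) := by
    rw [norm_smul, Real.norm_of_nonneg hc.le]
    gcongr
    refine (ContinuousLinearMap.le_opNorm _ _).trans ?_
    rw [LinearIsometryEquiv.norm_map]
    gcongr
    exact P.A.le_opNorm _
  refine (norm_add_le _ _).trans ?_
  unfold Lc
  linarith

/-- The objective of the prox subproblem. -/
noncomputable def Phi (P : Problem n l) (θ c : ℝ) (z0 : Vec n) (p : Vec l) (z : Vec n) : ℝ :=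
  P.lam θ * (P.g θ c p z + P.hr z) + 1 / 2 * ‖z - z0‖ ^ 2

theorem psiS_add_psiN (P : Problem n l) (θ c : ℝ) (z0 : Vec n) (p : Vec l) (z : Vec n) :
    P.psiS θ c z0 p z + P.psiN θ z0 z = P.Phi θ c z0 p z := by
  unfold psiS psiN Phi
  ring

theorem Standing.linearization_psiS (hP : P.Standing) (θ c : ℝ) (z0 : Vec n) (p : Vec l)
    {z : Vec n} (hz : z ∈ P.dom) (w : Vec n) :
    P.psiS θ c z0 p w - linearization (P.psiS θ c z0 p) z w
      = P.lam θ * (P.g θ c p w - (P.g θ c p z + inner ℝ (gradient (P.g θ c p) z) (w - z)))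
        + tau θ / 2 * ‖w - z‖ ^ 2 := by
  have h1 := (hP.hasGradientAt_g θ c p hz).differentiableAt.hasGradientAt
  have h2 := hasGradientAt_add (hasGradientAt_const_mul h1 (P.lam θ))
    (hasGradientAt_const_mul (hasGradientAt_norm_sq_sub z0 z) (tau θ / 2))
  have h3 : gradient (P.psiS θ c z0 p) z = _ := h2.gradient
  rw [linearization, h3]
  have e : w - z0 = (z - z0) + (w - z) := by abel
  simp only [psiS]
  rw [e, norm_add_sq_real, inner_add_left, real_inner_smul_left, real_inner_smul_left,
    real_inner_smul_left]
  ring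

/-- By `λ m = τ_θ`, the term `τ_θ/2 ‖· - z0‖²` placed in `ψ_s` exactly compensates the negative
curvature of `λ f`; the modulus `1 - τ_θ` is left for `ψ_n`. -/
theorem Standing.acgData (hP : P.Standing) (h0 : 0 < θ) (hc : 0 < c)
    (hz0 : z0 ∈ P.dom) (p : Vec l) :
    ACGData P.dom (P.psiS θ c z0 p) (P.psiN θ z0) (P.lam θ * P.Lc c + tau θ) (1 - tau θ) z0 := by
  have hτ := tau_pos h0
  have hτ2 := tau_le_half (θ := θ)
  have hl := hP.lam_pos h0
  have hLc := hP.Lc_pos hc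
  have hm := hP.lam_mul_m θ
  refine ⟨hz0, by positivity, by linarith, ?_, ?_, ?_, ?_⟩
  · have h1 : ConvexOn ℝ P.dom (fun z => P.lam θ * P.hr z) := hP.convexOn_hr.smul hl.le
    have := (strongConvexOn_zero.2 h1).add (strongConvexOn_sq_dist hP.convex_dom (1 - tau θ) z0)
    refine ⟨hP.convex_dom, fun x hx y hy a b ha hb hab => ?_⟩
    have h2 := this.2 hx hy ha hb hab
    simpa [psiN] using h2
  · intro z hz w hw
    have h1 := hP.linearization_psiS θ c z0 p hz w
    have h2 := mul_le_mul_of_nonneg_left (hP.g_lower θ hc p hz hw) hl.le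
    have h3 : P.lam θ * (-(P.m / 2) * ‖w - z‖ ^ 2) = - (tau θ / 2 * ‖w - z‖ ^ 2) := by
      rw [← hm]
      ring
    linarith
  · intro z hz w hw
    have h1 := hP.linearization_psiS θ c z0 p hz w
    have h2 := mul_le_mul_of_nonneg_left (hP.g_upper θ hc p hz hw) hl.le
    linarith
  · intro g k a ha
    obtain ⟨y, hy, hmin⟩ := hP.exists_argmin (t := P.lam θ)
      (a := (1 - tau θ) / 2 + 1 / (2 * a)) hl
      (add_pos (by linarith) (by positivity)) g z0
    refine ⟨y, hy, fun w hw => ?_⟩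
    have h1 := hmin w hw
    simp only [inner_sub_right] at h1
    simp only [psiN]
    linarith

/-- An inexact solution `(z, v, ε)` of the prox subproblem with center `z0` and multiplier `p`. -/
structure InexactProx (P : Problem n l) (θ c : ℝ) (z0 : Vec n) (p : Vec l) (z v : Vec n)
    (ε : ℝ) : Prop where
  center_mem : z0 ∈ P.dom
  mem : z ∈ P.dom
  eps_nonneg : 0 ≤ ε
  subgrad : ∀ u ∈ P.dom, P.Phi θ c z0 p z + inner ℝ v (u - z) - ε ≤ P.Phi θ c z0 p u
  test : ‖v‖ ^ 2 + 2 * ε ≤ P.sig θ c ^ 2 * ‖v + z0 - z‖ ^ 2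

open Classical in
/-- The configuration after the ACG method has returned `(z, v)`. -/
noncomputable def accept (P : Problem n l) (θ : ℝ) (z0 : Vec n) (ρ η c : ℝ) (zPrev : Vec n)
    (pPrev : Vec l) (z v : Vec n) : Config n l :=
  if ‖P.refineV θ c zPrev pPrev z v‖ ≤ ρ then
    if ‖P.A (P.refineZ θ c zPrev pPrev z v) - P.b‖ ≤ η then
      Config.halted (P.refineZ θ c zPrev pPrev z v) (P.refineV θ c zPrev pPrev z v)
        ((1 - θ) • pPrev + c • (P.A (P.refineZ θ c zPrev pPrev z v) - P.b))
    else Config.running (2 * c) z0 0 (acgInit z0)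
  else Config.running c z ((1 - θ) • pPrev + c • (P.A z - P.b)) (acgInit z)

/-- The constant in the bound for the number of iterations of a call of the ACG method. -/
noncomputable def innerConst (θ : ℝ) : ℝ := 2 + 3 * (Real.log (8 / sigmaTheta θ ^ 2) + 2)

theorem innerConst_pos (h0 : 0 < θ) (h1 : θ ≤ 1) : 0 < innerConst θ := by
  have h2 := sigmaTheta_pos h0 h1
  have h3 := sigmaTheta_le h0 h1
  have : 0 ≤ Real.log (8 / sigmaTheta θ ^ 2) := by
    apply Real.log_nonneg
    rw [le_div_iff₀ (by positivity)]
    nlinarith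
  unfold innerConst
  linarith

/-- It suffices that `(1 + x)^j ≥ 8M/σ²` with `x = √((1 - τ)/M)`. Here `1/log (1 + x) ≤ 1 + 1/x ≤
3√Λ`, and `8M/σ² ≤ (8/σ_θ²) Λ²` makes the logarithm of the target a `θ`-dependent multiple of
`logOne Λ`. -/
theorem Standing.exists_acg_large (hP : P.Standing) (h0 : 0 < θ) (h1 : θ ≤ 1) (hc : 0 < c)
    (hz0 : z0 ∈ P.dom) (p : Vec l) :
    ∃ j : ℕ, ((j + 1 : ℕ) : ℝ) ≤ innerConst θ * (√(P.lam θ * P.Lc c + 1)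
        * logOne (P.lam θ * P.Lc c + 1)) ∧
      8 / P.sig θ c ^ 2 ≤ ((acgStep P.dom (P.psiS θ c z0 p) (P.psiN θ z0)
        (P.lam θ * P.Lc c + tau θ) (1 - tau θ) z0)^[j + 1] (acgInit z0)).a := by
  have hτ := tau_pos h0
  have hτ2 := tau_le_half (θ := θ)
  have hl := hP.lam_pos h0
  have hLc := hP.Lc_pos hc
  have hone := hP.one_le h0 hc
  have hsig := hP.sig_pos h0 h1 hc
  have hinv := hP.inv_sig_sq_le h0 h1 hc
  have hσ := sigmaTheta_pos h0 h1
  have hσ4 := sigmaTheta_le h0 h1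
  have hD := hP.acgData h0 hc hz0 p
  set M := P.lam θ * P.Lc c + tau θ with hM
  set Λ := P.lam θ * P.Lc c + 1 with hΛ
  have hMΛ : M ≤ Λ := by linarith
  have hM0 : 0 < M := hD.M_pos
  set x := √((1 - tau θ) / M) with hx
  have hx0 : 0 < x := Real.sqrt_pos.2 (div_pos (by linarith) hM0)
  set B := Real.log (8 * M / P.sig θ c ^ 2) with hB
  have hlog : x / (1 + x) ≤ Real.log (1 + x) := by
    have := Real.one_sub_inv_le_log_of_pos (by linarith : 0 < 1 + x)
    have e : 1 - (1 + x)⁻¹ = x / (1 + x) := by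
      field_simp
      ring
    rwa [e] at this
  have hlog0 : 0 < Real.log (1 + x) := lt_of_lt_of_le (by positivity) hlog
  have hsΛ : 1 ≤ √Λ := by
    exact Real.one_le_sqrt.2 hone
  have hxinv : 1 / x ≤ 2 * √Λ := by
    rw [div_le_iff₀ hx0, mul_assoc, ← Real.sqrt_mul (by linarith)]
    have h2 : (1 / 2) ^ 2 ≤ Λ * ((1 - tau θ) / M) := by
      rw [mul_div_assoc', le_div_iff₀ hM0]
      nlinarith
    have := Real.le_sqrt_of_sq_le h2
    linarith
  have hloginv : 1 / Real.log (1 + x) ≤ 3 * √Λ := by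
    have h2 : 1 / Real.log (1 + x) ≤ 1 / (x / (1 + x)) := by gcongr
    have h3 : 1 / (x / (1 + x)) = 1 + 1 / x := by
      field_simp
      ring
    linarith
  set K := Real.log (8 / sigmaTheta θ ^ 2) with hK
  have hK0 : 0 ≤ K := by
    apply Real.log_nonneg
    rw [le_div_iff₀ (by positivity)]
    nlinarith
  have hone' := one_le_logOne Λ
  have hBle : B ≤ (K + 2) * logOne Λ := by
    have h2 : 8 * M / P.sig θ c ^ 2 ≤ 8 / sigmaTheta θ ^ 2 * (Λ * Λ) := by
      have : 8 * M / P.sig θ c ^ 2 = 8 * M * (1 / P.sig θ c ^ 2) := by ring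
      rw [this]
      calc 8 * M * (1 / P.sig θ c ^ 2) ≤ 8 * Λ * (Λ / sigmaTheta θ ^ 2) := by gcongr
        _ = _ := by ring
    have h3 : B ≤ Real.log (8 / sigmaTheta θ ^ 2 * (Λ * Λ)) :=
      Real.log_le_log (by positivity) h2
    rw [Real.log_mul (by positivity) (by positivity),
      Real.log_mul (by positivity) (by positivity)] at h3
    have h4 := log_le_logOne Λ
    nlinarith
  refine ⟨⌈B / Real.log (1 + x)⌉₊, ?_, ?_⟩
  · have h2 : B / Real.log (1 + x) ≤ (K + 2) * logOne Λ * (3 * √Λ) := by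
      rw [div_eq_mul_one_div]
      have : 0 ≤ (K + 2) * logOne Λ := by positivity
      gcongr
    have h3 : (⌈B / Real.log (1 + x)⌉₊ : ℝ) ≤ (K + 2) * logOne Λ * (3 * √Λ) + 1 := by
      have h5 : 0 ≤ (K + 2) * logOne Λ * (3 * √Λ) := by positivity
      refine le_trans ?_ (Nat.ceil_lt_add_one h5).le
      exact_mod_cast Nat.ceil_mono h2
    have h4 : 1 ≤ √Λ * logOne Λ := one_le_mul_of_one_le_of_one_le hsΛ hone'
    push_cast
    unfold innerConst
    rw [← hK]
    nlinarith
  · refine le_trans ?_ (acg_iterate_a hD _)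
    have h2 : B ≤ ⌈B / Real.log (1 + x)⌉₊ * Real.log (1 + x) := by
      rw [← div_le_iff₀ hlog0]
      exact Nat.le_ceil _
    rw [← Real.log_pow] at h2
    have h3 := (Real.log_le_log_iff (by positivity) (by positivity)).1 h2
    rw [← hx, one_div_mul_eq_div, le_div_iff₀ hM0]
    calc 8 / P.sig θ c ^ 2 * M = 8 * M / P.sig θ c ^ 2 := by ring
      _ ≤ _ := h3

/-- One call of the ACG method: it returns an inexact solution of the prox subproblem. -/
theorem Standing.exists_inner (hP : P.Standing) (h0 : 0 < θ) (h1 : θ ≤ 1) (hc : 0 < c)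
    (hz0 : z0 ∈ P.dom) (p : Vec l) :
    ∃ (z v : Vec n) (ε : ℝ) (N : ℕ), P.InexactProx θ c z0 p z v ε ∧
      (N : ℝ) ≤ innerConst θ * (√(P.lam θ * P.Lc c + 1) * logOne (P.lam θ * P.Lc c + 1)) ∧
      ∀ (zs : Vec n) (ρ η : ℝ), (P.step θ zs ρ η)^[N] (Config.running c z0 p (acgInit z0))
        = P.accept θ zs ρ η c z0 p z v := by
  classical
  have hD := hP.acgData h0 hc hz0 p
  set S := acgStep P.dom (P.psiS θ c z0 p) (P.psiN θ z0)
        (P.lam θ * P.Lc c + tau θ) (1 - tau θ) z0 with hS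
  obtain ⟨j, hj, hja⟩ := hP.exists_acg_large h0 h1 hc hz0 p
  have hsig := hP.sig_pos h0 h1 hc
  have hsig1 : P.sig θ c ≤ 1 := by
    have := sigmaTheta_le h0 h1
    have := P.sig_le_sigmaTheta θ c
    linarith
  let T : ACGState n → Prop := fun q => ‖acgU z0 q‖ ^ 2
    + 2 * acgEps (P.psiS θ c z0 p) (P.psiN θ z0) z0 q
      ≤ P.sig θ c ^ 2 * ‖acgU z0 q + z0 - q.x‖ ^ 2
  -- The index is shifted because the residuals are tested only after an ACG iteration, hence for `j
  -- ≥ 1`.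
  have hex : ∃ j, T (S^[j + 1] (acgInit z0)) := ⟨j, (acg_output hD j).test hsig hsig1 hja⟩
  set N := Nat.find hex with hN
  have hNT : T (S^[N + 1] (acgInit z0)) := Nat.find_spec hex
  have hNj : N ≤ j := Nat.find_min' hex ((acg_output hD j).test hsig hsig1 hja)
  have hout := acg_output hD N
  refine ⟨(S^[N + 1] (acgInit z0)).x, acgU z0 (S^[N + 1] (acgInit z0)),
    acgEps (P.psiS θ c z0 p) (P.psiN θ z0) z0 (S^[N + 1] (acgInit z0)), N + 1,
    ⟨hz0, hout.x_mem, hout.eps_nonneg, ?_, hNT⟩, ?_, ?_⟩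
  · intro u hu
    have h := hout.subgrad u hu
    rwa [psiS_add_psiN, psiS_add_psiN] at h
  · refine le_trans ?_ hj
    exact_mod_cast Nat.succ_le_succ hNj
  · intro zs ρ η
    have hrun : ∀ i ≤ N, (P.step θ zs ρ η)^[i] (Config.running c z0 p (acgInit z0))
        = Config.running c z0 p (S^[i] (acgInit z0)) := by
      intro i hi
      induction i with
      | zero => rfl
      | succ i ih =>
        rw [Function.iterate_succ_apply', ih (by omega), Function.iterate_succ_apply']
        have hnot : ¬ T (S (S^[i] (acgInit z0))) := by
          rw [← Function.iterate_succ_apply' S]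
          exact Nat.find_min hex hi
        exact if_neg hnot
    rw [Function.iterate_succ_apply', hrun N le_rfl]
    have hyes : T (S (S^[N] (acgInit z0))) := by
      rw [← Function.iterate_succ_apply' S]
      exact hNT
    rw [Function.iterate_succ_apply' S]
    exact if_pos hyes

/-! ### The refinement procedure -/

theorem Standing.mem_subdiff (hP : P.Standing) {z u : Vec n} (hz : z ∈ P.dom)
    (h : ∀ w ∈ P.dom, P.hr z + inner ℝ u (w - z) ≤ P.hr w) : u ∈ P.subdiff z := by
  intro w
  by_cases hw : w ∈ P.dom
  · rw [← hP.coe_hr hz, ← hP.coe_hr hw, ← EReal.coe_add, EReal.coe_le_coe_iff]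
    exact h w hw
  · have : P.h w = ⊤ := by simpa [dom] using hw
    rw [this]
    exact le_top

/-- The properties of the refined pair. -/
structure Refined (P : Problem n l) (θ c : ℝ) (z0 : Vec n) (p : Vec l) (z v zHat vHat : Vec n) :
    Prop where
  mem : zHat ∈ P.dom
  descent : P.Phi θ c z0 p zHat + (P.lam θ * P.Lc c + 1) / 2 * ‖z - zHat‖ ^ 2
    ≤ P.Phi θ c z0 p z + inner ℝ v (zHat - z)
  dist_le : (P.lam θ * P.Lc c + 1) * ‖z - zHat‖ ≤ ‖v + z0 - z‖
  norm_le : P.lam θ * ‖vHat‖ ≤ 3 * ‖v + z0 - z‖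
  subdiff : vHat - gradient P.f zHat - ContinuousLinearMap.adjoint P.A
    ((1 - θ) • p + c • (P.A zHat - P.b)) ∈ P.subdiff zHat

/-- The refined point minimizes a quadratic majorant of the prox objective tilted by `v`, which
gives descent and an exact subgradient of `h`. Descent against the `ε`-subgradient inequality yields
`Λ ‖z - ẑ‖² ≤ 2ε ≤ σ² ‖r‖²`, and `σ² Λ ≤ 1` upgrades this to `Λ ‖z - ẑ‖ ≤ ‖r‖`. Each of the three
parts of `λ v̂` is then at most `‖r‖`. -/
theorem Standing.refined (hP : P.Standing) (h0 : 0 < θ) (h1 : θ ≤ 1) (hc : 0 < c)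
    {z v : Vec n} {ε : ℝ} (hI : P.InexactProx θ c z0 p z v ε) :
    P.Refined θ c z0 p z v (P.refineZ θ c z0 p z v) (P.refineV θ c z0 p z v) := by
  have hl := hP.lam_pos h0
  have hone := hP.one_le h0 hc
  have hsq := hP.sig_sq_mul_le h0 h1 hc
  have hv : P.refineV θ c z0 p z v = (1 / P.lam θ) • ((v + z0 - z)
    + (P.lam θ * P.Lc c + 1) • (z - P.refineZ θ c z0 p z v))
    + gradient (P.g θ c p) (P.refineZ θ c z0 p z v) - gradient (P.g θ c p) z := rfl
  have hgrad : gradient (P.gLam θ c z0 p v) z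
      = P.lam θ • gradient (P.g θ c p) z + (z - z0) - v := by
    have h2 := (hP.hasGradientAt_g θ c p hI.mem).differentiableAt.hasGradientAt
    have h3 := hasGradientAt_add (hasGradientAt_add (hasGradientAt_const_mul h2 (P.lam θ))
      (hasGradientAt_const_mul (hasGradientAt_norm_sq_sub z0 z) (1 / 2)))
      (hasGradientAt_const_mul (hasGradientAt_inner_left v z) (-1))
    have h4 : P.gLam θ c z0 p v = fun w => P.lam θ * P.g θ c p w + 1 / 2 * ‖w - z0‖ ^ 2
        + -1 * inner ℝ v w := by
      funext w
      simp only [gLam]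
      ring
    rw [h4, h3.gradient]
    module
  set Λ := P.lam θ * P.Lc c + 1 with hΛ
  set G := gradient (P.gLam θ c z0 p v) z with hG
  have hspec : P.refineZ θ c z0 p z v ∈ P.dom ∧ ∀ w ∈ P.dom,
      inner ℝ G (P.refineZ θ c z0 p z v - z) + Λ / 2 * ‖P.refineZ θ c z0 p z v - z‖ ^ 2
        + P.lam θ * P.hr (P.refineZ θ c z0 p z v)
      ≤ inner ℝ G (w - z) + Λ / 2 * ‖w - z‖ ^ 2 + P.lam θ * P.hr w := by
    refine argminOn_spec (F := fun u => inner ℝ G (u - z) + Λ / 2 * ‖u - z‖ ^ 2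
      + P.lam θ * P.hr u) ?_
    obtain ⟨y, hy, hmin⟩ := hP.exists_argmin (t := P.lam θ) (a := Λ / 2) hl (by linarith) G z
    refine ⟨y, hy, fun w hw => ?_⟩
    have := hmin w hw
    linarith
  set zh := P.refineZ θ c z0 p z v with hzh
  obtain ⟨hzd, hmin⟩ := hspec
  have hopt : ∀ w ∈ P.dom, inner ℝ G (zh - z) + P.lam θ * P.hr zh
      + inner ℝ (Λ • (z - zh)) (w - zh) ≤ inner ℝ G (w - z) + P.lam θ * P.hr w := by
    intro w hw
    have hconv : ConvexOn ℝ P.dom (fun u => inner ℝ G (u - z) + P.lam θ * P.hr u) := by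
      refine ⟨hP.convex_dom, fun x hx y hy a b p r hab => ?_⟩
      have h5 := mul_le_mul_of_nonneg_left (hP.convexOn_hr.2 hx hy p r hab) hl.le
      simp only [smul_eq_mul, inner_sub_right, inner_add_right, real_inner_smul_right] at h5 ⊢
      obtain rfl : b = 1 - a := by linarith
      linarith
    refine convexOn_subgradient_of_prox hconv (a := Λ) (z := z) hzd ?_ hw
    intro w hw
    have := hmin w hw
    linarith
  have hdescent : P.Phi θ c z0 p zh + Λ / 2 * ‖z - zh‖ ^ 2
      ≤ P.Phi θ c z0 p z + inner ℝ v (zh - z) := by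
    have h2 := hopt z hI.mem
    have h3 := mul_le_mul_of_nonneg_left (hP.g_upper θ hc p hI.mem hzd) hl.le
    rw [sub_self, inner_zero_right, real_inner_smul_left, real_inner_self_eq_norm_sq,
      hgrad, inner_sub_left, inner_add_left, real_inner_smul_left] at h2
    have e : zh - z0 = (zh - z) + (z - z0) := by abel
    simp only [Phi]
    rw [e, norm_add_sq_real]
    rw [norm_sub_rev zh z, real_inner_comm (z - z0)] at *
    nlinarith
  have hdist : Λ * ‖z - zh‖ ≤ ‖v + z0 - z‖ := by
    have h2 := hI.subgrad zh hzd
    have h3 : Λ * ‖z - zh‖ ^ 2 ≤ P.sig θ c ^ 2 * ‖v + z0 - z‖ ^ 2 := by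
      have := hI.test
      have := sq_nonneg ‖v‖
      linarith
    apply le_of_sq_le_sq _ (norm_nonneg _)
    calc (Λ * ‖z - zh‖) ^ 2 = Λ * (Λ * ‖z - zh‖ ^ 2) := by ring
      _ ≤ Λ * (P.sig θ c ^ 2 * ‖v + z0 - z‖ ^ 2) := by gcongr
      _ = P.sig θ c ^ 2 * Λ * ‖v + z0 - z‖ ^ 2 := by ring
      _ ≤ 1 * ‖v + z0 - z‖ ^ 2 := by gcongr
      _ = _ := one_mul _
  refine ⟨hzd, hdescent, hdist, ?_, ?_⟩
  · have e : P.lam θ • P.refineV θ c z0 p z v = (v + z0 - z) + Λ • (z - zh)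
        + P.lam θ • (gradient (P.g θ c p) zh - gradient (P.g θ c p) z) := by
      rw [hv, add_sub_assoc, smul_add, smul_smul, mul_one_div_cancel hl.ne', one_smul]
    have h2 : P.lam θ * ‖P.refineV θ c z0 p z v‖ = ‖P.lam θ • P.refineV θ c z0 p z v‖ := by
      rw [norm_smul, Real.norm_of_nonneg hl.le]
    rw [h2, e]
    have h3 := hP.gradient_g_lipschitz θ hc p hI.mem hzd
    rw [norm_sub_rev zh z] at h3
    have h4 : ‖P.lam θ • (gradient (P.g θ c p) zh - gradient (P.g θ c p) z)‖
        ≤ P.lam θ * (P.Lc c * ‖z - zh‖) := by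
      rw [norm_smul, Real.norm_of_nonneg hl.le]
      gcongr
    have h5 : ‖Λ • (z - zh)‖ = Λ * ‖z - zh‖ := by
      rw [norm_smul, Real.norm_of_nonneg (by linarith)]
    refine (norm_add_le _ _).trans ?_
    have h6 := norm_add_le (v + z0 - z) (Λ • (z - zh))
    have h7 := norm_nonneg (z - zh)
    rw [hΛ] at h5 hdist h6
    rw [hΛ]
    nlinarith
  · refine hP.mem_subdiff hzd fun w hw => ?_
    have e : P.refineV θ c z0 p z v - gradient P.f zh - ContinuousLinearMap.adjoint P.A
        ((1 - θ) • p + c • (P.A zh - P.b)) = (1 / P.lam θ) • (Λ • (z - zh) - G) := by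
      rw [hv, hP.gradient_g θ c p hzd, hgrad]
      have e2 : gradient (P.g θ c p) z
          = (1 / P.lam θ) • (P.lam θ • gradient (P.g θ c p) z) := by
        rw [smul_smul, one_div_mul_cancel hl.ne', one_smul]
      nth_rewrite 1 [e2]
      module
    rw [e, real_inner_smul_left, inner_sub_left]
    have h2 := hopt w hw
    have h3 : inner ℝ G (w - zh) = inner ℝ G (w - z) - inner ℝ G (zh - z) := by
      rw [← inner_sub_right]
      congr 1
      abel
    rw [h3]
    have h4 : P.lam θ * (P.hr zh + 1 / P.lam θ * (inner ℝ (Λ • (z - zh)) (w - zh)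
        - (inner ℝ G (w - z) - inner ℝ G (zh - z)))) ≤ P.lam θ * P.hr w := by
      rw [mul_add, ← mul_assoc, mul_one_div_cancel hl.ne', one_mul]
      linarith
    exact le_of_mul_le_mul_left h4 hl

end Problem

end IPAAL

namespace IPAAL

/-! ### Scalar estimates -/

/-- The weight of the dual increments in the potential function. -/
noncomputable def omega (θ : ℝ) : ℝ := (1 - θ) * (2 - θ) / (2 * (1 - tau θ) * θ)

theorem omega_nonneg {θ : ℝ} (h0 : 0 < θ) (h1 : θ ≤ 1) : 0 ≤ omega θ := by
  have := tau_le_half (θ := θ)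
  refine div_nonneg (mul_nonneg ?_ ?_) (mul_nonneg ?_ ?_) <;> linarith

/-- The right side is the coefficient of the dual increments in `InexactProx.merit_le`, the second
factor on the left the one in `InexactProx.dual_increment`; `omega` is their quotient, so the two
cancel. -/
theorem omega_mul {θ : ℝ} (h0 : 0 < θ) :
    omega θ * ((1 - tau θ) * θ) = (1 - θ) * (2 - θ) / 2 := by
  have h : 1 - tau θ ≠ 0 := by
    have := tau_le_half (θ := θ)
    linarith
  unfold omega
  field_simp

theorem omega_le {θ : ℝ} (h0 : 0 < θ) (h1 : θ ≤ 1) : omega θ ≤ 2 * (1 - θ) / θ := by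
  have h2 := omega_mul h0
  have h3 := omega_nonneg h0 h1
  have ht := tau_le_half (θ := θ)
  have h4 : omega θ * (1 / 2 * θ) ≤ omega θ * ((1 - tau θ) * θ) := by
    gcongr
    linarith
  rw [le_div_iff₀ h0]
  nlinarith

/-- `omega` grows like `1/θ` as `θ → 0`, so `τ_θ` has to shrink like `θ`; with `τ_θ ≈ θ/16` the
product tends to `1/8`. Clearing denominators leaves a polynomial inequality on `(0, 16/19]`. -/
theorem omega_mul_tau_le {θ : ℝ} (h0 : 0 < θ) (h1 : θ ≤ 1) :
    omega θ * (2 * tau θ - tau θ ^ 2) ≤ 1 / 5 := by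
  have ht2 := tau_le_half (θ := θ)
  have hpos : 0 < 2 * (1 - tau θ) * θ := mul_pos (by linarith) h0
  unfold omega
  rw [div_mul_eq_mul_div, div_le_iff₀ hpos]
  by_cases h : θ ≤ 16 / 19
  · have hD : 0 < 16 - 17 * θ := by linarith
    have ht : tau θ = θ / (16 - 17 * θ) := by simp [tau, h]
    rw [ht]
    have key : 5 * ((1 - θ) * (2 - θ) * (32 - 35 * θ)) ≤ 2 * (16 - 18 * θ) * (16 - 17 * θ) := by
      have hs : 0 ≤ 16 / 19 - θ := by linarith
      nlinarith [mul_nonneg (mul_nonneg hs hs) h0.le, mul_nonneg hs h0.le, mul_nonneg hs hs]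
    have e1 : (1 - θ) * (2 - θ) * (2 * (θ / (16 - 17 * θ)) - (θ / (16 - 17 * θ)) ^ 2)
        = θ / (16 - 17 * θ) ^ 2 * ((1 - θ) * (2 - θ) * (32 - 35 * θ)) := by
      field_simp
      ring
    have e2 : 1 / 5 * (2 * (1 - θ / (16 - 17 * θ)) * θ)
        = θ / (16 - 17 * θ) ^ 2 * (1 / 5 * (2 * (16 - 18 * θ) * (16 - 17 * θ))) := by
      have e3 : 1 - θ / (16 - 17 * θ) = (16 - 18 * θ) / (16 - 17 * θ) := by
        rw [eq_div_iff hD.ne', sub_mul, div_mul_cancel₀ _ hD.ne']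
        ring
      rw [e3]
      field_simp
    rw [e1, e2]
    exact mul_le_mul_of_nonneg_left (by linarith) (by positivity)
  · have ht : tau θ = 1 / 2 := by simp [tau, h]
    rw [ht]
    push Not at h
    nlinarith

theorem omega_mul_sq_le {θ σ : ℝ} (h0 : 0 < θ) (h1 : θ ≤ 1) (hσ0 : 0 ≤ σ)
    (hσ : σ ≤ sigmaTheta θ) : omega θ * (σ ^ 2 / tau θ) ≤ 1 / 16 := by
  have ht := tau_pos h0
  have ht2 := tau_le_half (θ := θ)
  have h2 := sigmaTheta_sq_le h0 h1
  have h3 : σ ^ 2 ≤ sigmaTheta θ ^ 2 := by gcongr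
  have hq : 0 ≤ 1 - θ := by linarith
  set Z := (1 - θ) * σ ^ 2 / (θ * tau θ) with hZ
  have hZ0 : 0 ≤ Z := by positivity
  have hZ1 : (3 * tau θ + 1) * Z ≤ 1 / 16 := by
    have : (3 * tau θ + 1) * Z
        = 1 / 2 * (2 * (1 - θ) * (3 * tau θ + 1) / (θ * tau θ) * σ ^ 2) := by
      rw [hZ]
      ring
    rw [this]
    have : 2 * (1 - θ) * (3 * tau θ + 1) / (θ * tau θ) * σ ^ 2
        ≤ 2 * (1 - θ) * (3 * tau θ + 1) / (θ * tau θ) * sigmaTheta θ ^ 2 := by gcongr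
    linarith
  have h1τ : 0 < 1 - tau θ := by linarith
  have e : omega θ * (σ ^ 2 / tau θ) = (2 - θ) * Z / (2 * (1 - tau θ)) := by
    rw [hZ, omega]
    field_simp
  rw [e, div_le_iff₀ (by linarith)]
  -- This is the role of the factor `3 τ_θ + 1` in the quadratic for `σ_θ`: it absorbs the factor `1
  -- / (1 - τ_θ)` of `omega`.
  have h5 : 1 ≤ (1 - tau θ) * (3 * tau θ + 1) := by nlinarith
  have h6 : Z ≤ (1 - tau θ) * ((3 * tau θ + 1) * Z) := by nlinarith
  nlinarith

/-- The coefficient in the decrease of the potential function. -/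
theorem potential_coeff {θ σ : ℝ} (h0 : 0 < θ) (h1 : θ ≤ 1) (hσ0 : 0 ≤ σ)
    (hσ : σ ≤ sigmaTheta θ) :
    omega θ * (σ ^ 2 / 2 + (2 * tau θ - tau θ ^ 2) * (1 + σ) ^ 2 + σ ^ 2 / tau θ)
      ≤ (1 - σ ^ 2) / 2 - 1 / 16 := by
  have ht := tau_pos h0
  have ht2 := tau_le_half (θ := θ)
  have hσ4 := sigmaTheta_le h0 h1
  have h2 := omega_mul_tau_le h0 h1
  have h3 := omega_mul_sq_le h0 h1 hσ0 hσ
  have h4 := omega_nonneg h0 h1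
  have h5 : omega θ * (σ ^ 2 / 2) ≤ 1 / 64 := by
    have : σ ^ 2 / 2 = (σ ^ 2 / tau θ) * (tau θ / 2) := by field_simp
    rw [this, ← mul_assoc]
    have : omega θ * (σ ^ 2 / tau θ) * (tau θ / 2) ≤ 1 / 16 * (1 / 4) :=
      mul_le_mul h3 (by linarith) (by positivity) (by norm_num)
    linarith
  have h6 : (1 + σ) ^ 2 ≤ 25 / 16 := by nlinarith
  have h7 : omega θ * (2 * tau θ - tau θ ^ 2) * (1 + σ) ^ 2 ≤ 1 / 5 * (25 / 16) := by
    have : 0 ≤ omega θ * (2 * tau θ - tau θ ^ 2) := by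
      apply mul_nonneg h4
      nlinarith
    gcongr
  -- The three terms add up to at most `1/64 + 5/16 + 1/16 = 25/64`, and for `σ ≤ 1/4` the right
  -- side is at least `26/64`.
  have h8 : σ ^ 2 ≤ 1 / 16 := by nlinarith
  nlinarith

theorem one_le_kappa {θ : ℝ} (h0 : 0 < θ) (h1 : θ ≤ 1) : 1 ≤ kappa θ := by
  have := tau_pos h0
  have h2 : 0 ≤ 1 - θ := by linarith
  unfold kappa
  have : 0 ≤ 16 * (1 - θ) / (θ * tau θ) := by positivity
  linarith

/-- The estimate that leads to the constant `κ_θ`. -/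
theorem add_le_kappa_mul {θ R W a : ℝ} (h0 : 0 < θ) (h1 : θ ≤ 1) (hR : 0 ≤ R)
    (hW : W ≤ (1 + 4 * (1 - θ) / θ) * R) (ha1 : (1 - θ) * a ≤ 2 * W / θ)
    (ha2 : a ≤ 4 * W / θ ^ 2) : W + (1 - θ) * a ≤ kappa θ * R := by
  have hq : 0 ≤ 1 - θ := by linarith
  have ht := tau_pos h0
  have ht2 := tau_le_half (θ := θ)
  -- Near `θ = 1`, where `κ_θ → 1`, only `ha2` times `1 - θ` is small enough; for small `θ`, `ha1`
  -- saves a power of `1/θ`. The first case needs `7θ² + 3θ - 4 ≥ 0`, that is `θ ≥ 4/7`.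
  by_cases h : 3 / 5 ≤ θ
  · have hk : 1 + 32 * (1 - θ) / θ ≤ kappa θ := by
      unfold kappa
      have : 32 * (1 - θ) / θ ≤ 16 * (1 - θ) / (θ * tau θ) := by
        rw [div_le_div_iff₀ h0 (by positivity)]
        have : 0 ≤ (1 - θ) * θ := by positivity
        nlinarith
      linarith
    have h3 : (1 - θ) * a ≤ (1 - θ) * (4 * W / θ ^ 2) := by gcongr
    have h4 : W + (1 - θ) * (4 * W / θ ^ 2) = W * (1 + 4 * (1 - θ) / θ ^ 2) := by ring
    have h5 : W * (1 + 4 * (1 - θ) / θ ^ 2)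
        ≤ (1 + 4 * (1 - θ) / θ) * R * (1 + 4 * (1 - θ) / θ ^ 2) := by gcongr
    have h6 : (1 + 4 * (1 - θ) / θ) * (1 + 4 * (1 - θ) / θ ^ 2) ≤ 1 + 32 * (1 - θ) / θ := by
      have e : 1 + 32 * (1 - θ) / θ - (1 + 4 * (1 - θ) / θ) * (1 + 4 * (1 - θ) / θ ^ 2)
          = 4 * (1 - θ) / θ ^ 3 * (7 * θ ^ 2 + 3 * θ - 4) := by
        field_simp
        ring
      have : 0 ≤ 4 * (1 - θ) / θ ^ 3 * (7 * θ ^ 2 + 3 * θ - 4) := by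
        apply mul_nonneg (by positivity)
        nlinarith
      linarith
    have h7 : (1 + 4 * (1 - θ) / θ) * (1 + 4 * (1 - θ) / θ ^ 2) * R ≤ kappa θ * R := by
      gcongr
      exact h6.trans hk
    nlinarith
  · push Not at h
    have htau : tau θ = θ / (16 - 17 * θ) := by
      simp [tau, show θ ≤ 16 / 19 by linarith]
    have hD : 0 < 16 - 17 * θ := by linarith
    have h4 : W + 2 * W / θ = W * (1 + 2 / θ) := by ring
    have h5 : W * (1 + 2 / θ) ≤ (1 + 4 * (1 - θ) / θ) * R * (1 + 2 / θ) := by gcongr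
    have h6 : (1 + 4 * (1 - θ) / θ) * (1 + 2 / θ) ≤ kappa θ := by
      have e : kappa θ - (1 + 4 * (1 - θ) / θ) * (1 + 2 / θ)
          = (16 * (1 - θ) * (16 - 17 * θ) + θ ^ 2 - (4 - 3 * θ) * (θ + 2)) / θ ^ 2 := by
        rw [kappa, htau]
        field_simp
        ring
      have : 0 ≤ (16 * (1 - θ) * (16 - 17 * θ) + θ ^ 2 - (4 - 3 * θ) * (θ + 2)) / θ ^ 2 := by
        apply div_nonneg _ (by positivity)
        nlinarith
      linarith
    have h7 : (1 + 4 * (1 - θ) / θ) * (1 + 2 / θ) * R ≤ kappa θ * R := by gcongr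
    nlinarith

/-- A nonincreasing sequence with nonnegative partial sums is nonnegative. -/
theorem nonneg_of_antitone_of_sum_nonneg {V : ℕ → ℝ} (hV : Antitone V)
    (hsum : ∀ K, 0 ≤ ∑ j ∈ Finset.range K, V j) (k : ℕ) : 0 ≤ V k := by
  by_contra! hneg
  obtain ⟨N, hN⟩ := exists_nat_gt ((∑ j ∈ Finset.range k, V j) / (- V k))
  rw [div_lt_iff₀ (by linarith)] at hN
  have h1 := hsum (k + N)
  rw [Finset.sum_range_add] at h1
  have h2 : ∑ j ∈ Finset.range N, V (k + j) ≤ ∑ _j ∈ Finset.range N, V k :=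
    Finset.sum_le_sum fun j _ => hV (Nat.le_add_right k j)
  simp only [Finset.sum_const, Finset.card_range, nsmul_eq_mul] at h2
  linarith

namespace Problem

variable {n l : ℕ} {P : Problem n l} {θ c : ℝ}

/-! ### The augmented Lagrangian -/

/-- The augmented Lagrangian function. -/
noncomputable def lagr (P : Problem n l) (θ c : ℝ) (p : Vec l) (z : Vec n) : ℝ :=
  P.g θ c p z + P.hr z

theorem lagr_eq (P : Problem n l) (θ c d : ℝ) (p : Vec l) (z : Vec n) :
    P.lagr θ c p z = P.phiPen d z + (1 - θ) * inner ℝ p (P.A z - P.b)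
      + (c - d) / 2 * ‖P.A z - P.b‖ ^ 2 := by
  unfold lagr g phiPen phi
  ring

theorem lagr_of_feasible (P : Problem n l) (θ c : ℝ) (p : Vec l) {z : Vec n}
    (hz : z ∈ P.feasible) : P.lagr θ c p z = P.phi z := by
  rw [P.lagr_eq θ c 0, hz.2]
  simp [phiPen]

theorem phi_eq_lagr (P : Problem n l) (θ c : ℝ) (z0 : Vec n) (p : Vec l) (z : Vec n) :
    P.Phi θ c z0 p z = P.lam θ * P.lagr θ c p z + 1 / 2 * ‖z - z0‖ ^ 2 := rfl

theorem Standing.phiStar_le (hP : P.Standing) {z : Vec n} (hz : z ∈ P.dom) :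
    P.phiStar ≤ P.phiPen P.cbar z :=
  csInf_le hP.penalty_bddBelow ⟨z, hz, rfl⟩

theorem Standing.le_R0 (hP : P.Standing) {z0 : Vec n} {x : ℝ}
    (h : ∀ u ∈ P.feasible, x ≤ P.lam θ * (P.phi u - P.phiStar) + ‖u - z0‖ ^ 2) :
    x ≤ P.R0 θ z0 := by
  apply le_csInf (hP.feasible_nonempty.image _)
  rintro _ ⟨u, hu, rfl⟩
  exact h u hu

theorem Standing.R0_nonneg (hP : P.Standing) (h0 : 0 < θ) (z0 : Vec n) : 0 ≤ P.R0 θ z0 := by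
  refine hP.le_R0 fun u hu => ?_
  have h1 := hP.phiStar_le hu.1
  have h2 : P.phiPen P.cbar u = P.phi u := by
    simp [phiPen, hu.2]
  have h3 := hP.lam_pos h0
  have : 0 ≤ P.lam θ * (P.phi u - P.phiStar) := mul_nonneg h3.le (by linarith)
  positivity

/-- By `λ m = τ_θ` the negative curvature of `λ f` uses up `τ_θ` of the unit modulus of the prox
term. The penalty adds strong convexity in the seminorm `‖A ·‖`, kept because it controls the dual
increments. -/
theorem Standing.Phi_combo (hP : P.Standing) (h0 : 0 < θ) (z0 : Vec n) (p : Vec l) {z u : Vec n}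
    (hz : z ∈ P.dom) (hu : u ∈ P.dom) {t : ℝ} (ht0 : 0 ≤ t) (ht1 : t ≤ 1) :
    P.Phi θ c z0 p (t • u + (1 - t) • z) ≤ t * P.Phi θ c z0 p u + (1 - t) * P.Phi θ c z0 p z
      - t * (1 - t) / 2 * ((1 - tau θ) * ‖u - z‖ ^ 2 + P.lam θ * c * ‖P.A (u - z)‖ ^ 2) := by
  have hab : t + (1 - t) = 1 := by ring
  have ht1' : 0 ≤ 1 - t := by linarith
  have hl := hP.lam_pos h0
  have hw := hP.convex_dom hu hz ht0 ht1' hab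
  have hh := mul_le_mul_of_nonneg_left (hP.convexOn_hr.2 hu hz ht0 ht1' hab) hl.le
  have h1 := mul_le_mul_of_nonneg_left (hP.lower_curvature _ hw u hu) (mul_nonneg hl.le ht0)
  have h2 := mul_le_mul_of_nonneg_left (hP.lower_curvature _ hw z hz) (mul_nonneg hl.le ht1')
  have hq1 := norm_combo_sq u z z0 hab
  have hq2 := norm_combo_sq (P.A u) (P.A z) P.b hab
  rw [← map_smul, ← map_smul, ← map_add, ← map_sub] at hq2
  have hm := hP.lam_mul_m θ
  set w := t • u + (1 - t) • z with hwdef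
  have e1 : u - w = (1 - t) • (u - z) := by rw [hwdef]; module
  have e2 : z - w = -(t • (u - z)) := by rw [hwdef]; module
  rw [e1, norm_smul, Real.norm_of_nonneg ht1', real_inner_smul_right, mul_pow] at h1
  rw [e2, norm_neg, norm_smul, Real.norm_of_nonneg ht0, inner_neg_right, real_inner_smul_right,
    mul_pow] at h2
  have e3 : inner ℝ p (P.A w - P.b) = t * inner ℝ p (P.A u - P.b)
      + (1 - t) * inner ℝ p (P.A z - P.b) := by
    rw [hwdef, map_add, map_smul, map_smul]
    simp only [inner_sub_right, inner_add_right, real_inner_smul_right]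
    ring
  have e4 : tau θ * (t * (1 - t)) * ‖u - z‖ ^ 2
      = P.lam θ * t * (P.m * ((1 - t) ^ 2 * ‖u - z‖ ^ 2))
        + P.lam θ * (1 - t) * (P.m * (t ^ 2 * ‖u - z‖ ^ 2)) := by
    rw [← hm]
    ring
  simp only [smul_eq_mul] at hh
  unfold Phi g
  rw [e3, hq1, hq2]
  linarith

/-- Testing the `ε`-subgradient inequality at `s u + (1 - s) z` and dividing by `s` trades accuracy
for growth: the error becomes `ε/s`, and a fraction `1 - s` of the modulus is gained. -/
theorem InexactProx.strong (hP : P.Standing) (h0 : 0 < θ) {z0 z v : Vec n} {p : Vec l} {ε : ℝ}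
    (hI : P.InexactProx θ c z0 p z v ε) {u : Vec n} (hu : u ∈ P.dom) {s : ℝ} (hs0 : 0 < s)
    (hs1 : s ≤ 1) :
    P.Phi θ c z0 p z + inner ℝ v (u - z) - ε / s
      + (1 - s) / 2 * ((1 - tau θ) * ‖u - z‖ ^ 2 + P.lam θ * c * ‖P.A (u - z)‖ ^ 2)
      ≤ P.Phi θ c z0 p u := by
  have h1 := hP.Phi_combo (c := c) h0 z0 p hI.mem hu hs0.le hs1
  have h2 := hI.subgrad _ (hP.convex_dom hu hI.mem hs0.le (sub_nonneg.2 hs1) (by ring))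
  have e : s • u + (1 - s) • z - z = s • (u - z) := by module
  rw [e, real_inner_smul_right] at h2
  have h3 : s * (ε / s) = ε := mul_div_cancel₀ _ hs0.ne'
  apply le_of_mul_le_mul_left _ hs0
  linarith

/-! ### Estimates for one and for two consecutive outer iterations -/

section Step

variable {z0 z1 z2 v1 v2 : Vec n} {p0 p1 p2 : Vec l} {ε1 ε2 : ℝ}

/-- The energy identity behind the descent estimates. -/
theorem lagr_energy {y u v : Vec n} {p : Vec l} {e : ℝ}
    (h : P.Phi θ c z0 p y + inner ℝ v (u - y) - e ≤ P.Phi θ c z0 p u) :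
    P.lam θ * P.lagr θ c p y + 1 / 2 * ‖v + z0 - y‖ ^ 2 - 1 / 2 * ‖v‖ ^ 2 - e
        + inner ℝ v (u - z0)
      ≤ P.lam θ * P.lagr θ c p u + 1 / 2 * ‖u - z0‖ ^ 2 := by
  rw [phi_eq_lagr, phi_eq_lagr] at h
  have e1 : v + z0 - y = v + (z0 - y) := by abel
  have e2 : u - y = (u - z0) + (z0 - y) := by abel
  rw [e1, norm_add_sq_real, norm_sub_rev z0 y]
  rw [e2, inner_add_right] at h
  linarith

theorem neg_le_inner (v d : Vec n) : - (1 / 2 * ‖v‖ ^ 2 + 1 / 2 * ‖d‖ ^ 2) ≤ inner ℝ v d := by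
  have := norm_add_sq_real v d
  have := sq_nonneg ‖v + d‖
  linarith

theorem Standing.sig_sq_le (hP : P.Standing) (h0 : 0 < θ) (h1 : θ ≤ 1) (hc : 0 < c) :
    P.sig θ c ^ 2 ≤ 1 / 16 := by
  have h2 := hP.sig_pos h0 h1 hc
  have h3 := (P.sig_le_sigmaTheta θ c).trans (sigmaTheta_le h0 h1)
  nlinarith

theorem InexactProx.lagr_le_center (hI : P.InexactProx θ c z0 p0 z1 v1 ε1) :
    P.lam θ * P.lagr θ c p0 z1 + (1 - P.sig θ c ^ 2) / 2 * ‖v1 + z0 - z1‖ ^ 2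
      ≤ P.lam θ * P.lagr θ c p0 z0 := by
  have h := lagr_energy (hI.subgrad z0 hI.center_mem)
  have h2 := hI.test
  rw [sub_self, inner_zero_right, norm_zero] at h
  linarith

/-- Young's inequality for `⟨v, u - z0⟩` doubles the distance term; together with the prox errors it
costs at most `σ² ‖r‖² ≤ ‖r‖²/16`, which leaves `7/16` of the `1/2`. At feasible `u` the right side
is the quantity minimized in `R₀`. -/
theorem InexactProx.lagr_le (hP : P.Standing) (h0 : 0 < θ) (h1 : θ ≤ 1) (hc : 0 < c)
    (hI : P.InexactProx θ c z0 p0 z1 v1 ε1) {u : Vec n} (hu : u ∈ P.dom) :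
    P.lam θ * P.lagr θ c p0 z1 + 7 / 16 * ‖v1 + z0 - z1‖ ^ 2
      ≤ P.lam θ * P.lagr θ c p0 u + ‖u - z0‖ ^ 2 := by
  have h := lagr_energy (hI.subgrad u hu)
  have h2 := hI.test
  have h3 := neg_le_inner v1 (u - z0)
  have h4 := mul_le_mul_of_nonneg_right (hP.sig_sq_le h0 h1 hc) (sq_nonneg ‖v1 + z0 - z1‖)
  have h5 := hI.eps_nonneg
  linarith

/-- By descent, the refined point satisfies the subgradient inequality with error `ε - ‖z - ẑ‖²/2`.
This gain pays for measuring the residual at `ẑ` instead of `z`. -/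
theorem Refined.lagr_le (hP : P.Standing) (h0 : 0 < θ) (h1 : θ ≤ 1) (hc : 0 < c)
    (hI : P.InexactProx θ c z0 p0 z1 v1 ε1) {zh vh : Vec n}
    (hR : P.Refined θ c z0 p0 z1 v1 zh vh) {u : Vec n} (hu : u ∈ P.dom) :
    P.lam θ * P.lagr θ c p0 zh ≤ P.lam θ * P.lagr θ c p0 u + ‖u - z0‖ ^ 2 := by
  have h := hI.subgrad u hu
  have hd := hR.descent
  have hone := hP.one_le h0 hc
  have hz : P.Phi θ c z0 p0 zh + inner ℝ v1 (u - zh) - (ε1 - 1 / 2 * ‖z1 - zh‖ ^ 2)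
      ≤ P.Phi θ c z0 p0 u := by
    have e : u - zh = (u - z1) - (zh - z1) := by abel
    rw [e, inner_sub_right]
    have := mul_le_mul_of_nonneg_right hone (sq_nonneg ‖z1 - zh‖)
    linarith
  have h3 := lagr_energy hz
  have h4 := neg_le_inner v1 (u - z0)
  have h5 := hI.test
  have h6 := mul_le_mul_of_nonneg_right (hP.sig_sq_le h0 h1 hc) (sq_nonneg ‖v1 + z0 - z1‖)
  have h7 := hI.eps_nonneg
  have h8 : ‖v1 + z0 - z1‖ ^ 2 ≤ 2 * ‖v1 + z0 - zh‖ ^ 2 + 2 * ‖z1 - zh‖ ^ 2 := by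
    have e : v1 + z0 - z1 = (v1 + z0 - zh) - (z1 - zh) := by abel
    rw [e]
    have := parallelogram_law_with_norm ℝ (v1 + z0 - zh) (z1 - zh)
    nlinarith [sq_nonneg ‖(v1 + z0 - zh) + (z1 - zh)‖]
  have h9 := sq_nonneg ‖v1 + z0 - z1‖
  linarith

/-- The reduced augmented Lagrangian `L(z; p) - (1 - θ) θ / (2 c) ‖p‖ ^ 2`, shifted and scaled. -/
noncomputable def merit (P : Problem n l) (θ c : ℝ) (p : Vec l) (z : Vec n) : ℝ :=
  P.lam θ * (P.lagr θ c p z - P.phiStar) - (1 - θ) * θ / 2 * (P.lam θ / c * ‖p‖ ^ 2)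

/-- Substitute `A z1 - b = (p1 - (1 - θ) p0)/c` and polarize. The last term is kept apart because it
is the one that `merit` subtracts. -/
theorem lagr_multiplier_update (hc : 0 < c) (hp : p1 = (1 - θ) • p0 + c • (P.A z1 - P.b)) :
    P.lam θ * (1 - θ) * inner ℝ p1 (P.A z1 - P.b) = (1 - θ) / 2 * (P.lam θ / c * ‖p1‖ ^ 2
      - (1 - θ) * (P.lam θ / c * ‖p0‖ ^ 2) + (1 - θ) * (P.lam θ / c * ‖p1 - p0‖ ^ 2))
      + (1 - θ) * θ / 2 * (P.lam θ / c * ‖p1‖ ^ 2) := by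
  have h1 : c * inner ℝ p1 (P.A z1 - P.b) = ‖p1‖ ^ 2 - (1 - θ) * inner ℝ p1 p0 := by
    have : c • (P.A z1 - P.b) = p1 - (1 - θ) • p0 := by
      rw [hp]
      abel
    rw [← real_inner_smul_right, this, inner_sub_right, real_inner_smul_right,
      real_inner_self_eq_norm_sq]
  have h2 : inner ℝ p1 (P.A z1 - P.b) = (‖p1‖ ^ 2 - (1 - θ) * inner ℝ p1 p0) / c := by
    rw [← h1]
    field_simp
  rw [h2, norm_sub_sq_real]
  field_simp
  ring

theorem merit_eq (hc : 0 < c) (hp : p1 = (1 - θ) • p0 + c • (P.A z1 - P.b)) :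
    P.merit θ c p1 z1 = P.lam θ * (P.phiPen c z1 - P.phiStar)
      + (1 - θ) / 2 * (P.lam θ / c * ‖p1‖ ^ 2 - (1 - θ) * (P.lam θ / c * ‖p0‖ ^ 2)
        + (1 - θ) * (P.lam θ / c * ‖p1 - p0‖ ^ 2)) := by
  have h := lagr_multiplier_update (P := P) hc hp
  rw [merit, P.lagr_eq θ c c]
  linarith

/-- The change of the merit function in one outer iteration. -/
theorem InexactProx.merit_le (hc : 0 < c) (hI : P.InexactProx θ c z0 p0 z1 v1 ε1)
    (hp : p1 = (1 - θ) • p0 + c • (P.A z1 - P.b)) :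
    P.merit θ c p1 z1 + (1 - P.sig θ c ^ 2) / 2 * ‖v1 + z0 - z1‖ ^ 2
      ≤ P.merit θ c p0 z0 + (1 - θ) * (2 - θ) / 2 * (P.lam θ / c * ‖p1 - p0‖ ^ 2) := by
  have h := lagr_multiplier_update (P := P) hc hp
  have h2 := hI.lagr_le_center
  have h3 : P.lam θ * (1 - θ) * inner ℝ p0 (P.A z1 - P.b)
      = (1 - θ) * (P.lam θ / c * inner ℝ p0 p1) - (1 - θ) ^ 2 * (P.lam θ / c * ‖p0‖ ^ 2) := by
    have h1 : c * inner ℝ p0 (P.A z1 - P.b) = inner ℝ p0 p1 - (1 - θ) * ‖p0‖ ^ 2 := by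
      have : c • (P.A z1 - P.b) = p1 - (1 - θ) • p0 := by
        rw [hp]
        abel
      rw [← real_inner_smul_right, this, inner_sub_right, real_inner_smul_right,
        real_inner_self_eq_norm_sq]
    have h2 : inner ℝ p0 (P.A z1 - P.b) = (inner ℝ p0 p1 - (1 - θ) * ‖p0‖ ^ 2) / c := by
      rw [← h1]
      field_simp
    rw [h2]
    field_simp
  have h4 : P.lam θ / c * ‖p1 - p0‖ ^ 2 = P.lam θ / c * ‖p1‖ ^ 2
      - 2 * (P.lam θ / c * inner ℝ p0 p1) + P.lam θ / c * ‖p0‖ ^ 2 := by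
    rw [norm_sub_sq_real, real_inner_comm]
    ring
  rw [merit, merit]
  rw [P.lagr_eq θ c c p0 z1] at h2
  rw [P.lagr_eq θ c c p1 z1]
  rw [h4] at h ⊢
  linarith

/-- The monotonicity inequality that links two consecutive outer iterations. -/
theorem InexactProx.monotone_pair (hP : P.Standing) (h0 : 0 < θ)
    (hI1 : P.InexactProx θ c z0 p0 z1 v1 ε1) (hI2 : P.InexactProx θ c z1 p1 z2 v2 ε2) :
    P.lam θ * (1 - θ) * inner ℝ (p1 - p0) (P.A (z2 - z1))
      + (1 - tau θ) * (P.lam θ * c * ‖P.A (z2 - z1)‖ ^ 2)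
      ≤ inner ℝ (v2 - (v1 + z0 - z1)) (z2 - z1) - (1 - tau θ) ^ 2 * ‖z2 - z1‖ ^ 2
        + (ε1 + ε2) / tau θ := by
  have hτ := tau_pos h0
  have hτ2 := tau_le_half (θ := θ)
  -- Each inexact solution is tested at the other one. The choice `s = τ` gives the modulus `(1 -
  -- τ)²` and the errors `ε/τ`.
  have H2 := hI2.strong hP h0 hI1.mem hτ (by linarith)
  have H1 := hI1.strong hP h0 hI2.mem hτ (by linarith)
  simp only [phi_eq_lagr] at H1 H2
  rw [P.lagr_eq θ c 0, P.lagr_eq θ c 0 p0 z2] at H1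
  rw [P.lagr_eq θ c 0, P.lagr_eq θ c 0 p1 z1] at H2
  have eD : z1 - z2 = - (z2 - z1) := by abel
  have eA : P.A z2 - P.b = (P.A z1 - P.b) + P.A (z2 - z1) := by
    rw [map_sub]
    abel
  have e20 : ‖z2 - z0‖ ^ 2
      = ‖z1 - z0‖ ^ 2 + 2 * inner ℝ (z1 - z0) (z2 - z1) + ‖z2 - z1‖ ^ 2 := by
    have : z2 - z0 = (z1 - z0) + (z2 - z1) := by abel
    rw [this, norm_add_sq_real]
  have ev : v2 - (v1 + z0 - z1) = v2 - v1 + (z1 - z0) := by abel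
  rw [eD, map_neg, norm_neg, norm_neg, inner_neg_right, sub_self, norm_zero, eA,
    inner_add_right] at H2
  rw [e20, eA, inner_add_right] at H1
  rw [ev, inner_add_left, inner_sub_left, inner_sub_left, add_div]
  linarith

/-- The estimate of the dual increments. -/
theorem InexactProx.dual_increment (hP : P.Standing) (h0 : 0 < θ) (h1 : θ ≤ 1) (hc : 0 < c)
    (hI1 : P.InexactProx θ c z0 p0 z1 v1 ε1) (hp1 : p1 = (1 - θ) • p0 + c • (P.A z1 - P.b))
    (hI2 : P.InexactProx θ c z1 p1 z2 v2 ε2) (hp2 : p2 = (1 - θ) • p1 + c • (P.A z2 - P.b)) :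
    (1 - tau θ) * θ * (P.lam θ / c * ‖p2 - p1‖ ^ 2)
      + (1 - θ) / 2 * (P.lam θ / c * ‖p2 - p1‖ ^ 2 - P.lam θ / c * ‖p1 - p0‖ ^ 2)
      ≤ 1 / 2 * (‖v1 + z0 - z1‖ ^ 2 - ‖v2 + z1 - z2‖ ^ 2)
        + (P.sig θ c ^ 2 / 2 + (2 * tau θ - tau θ ^ 2) * (1 + P.sig θ c) ^ 2
          + P.sig θ c ^ 2 / tau θ / 2) * ‖v2 + z1 - z2‖ ^ 2
        + P.sig θ c ^ 2 / tau θ / 2 * ‖v1 + z0 - z1‖ ^ 2 := by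
  have hτ := tau_pos h0
  have hτ2 := tau_le_half (θ := θ)
  have hl := hP.lam_pos h0
  have hq : 0 ≤ 1 - θ := by linarith
  have hσ := hP.sig_pos h0 h1 hc
  have S := hI1.monotone_pair hP h0 hI2
  have ht1 := hI1.test
  have ht2 := hI2.test
  have hε1 := hI1.eps_nonneg
  have hε2 := hI2.eps_nonneg
  have hd : c • P.A (z2 - z1) = (p2 - p1) - (1 - θ) • (p1 - p0) := by
    have h2 : c • P.A (z2 - z1) = c • (P.A z2 - P.b) - c • (P.A z1 - P.b) := by
      rw [map_sub]
      module
    have h3 : c • (P.A z2 - P.b) = p2 - (1 - θ) • p1 := by rw [hp2]; abel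
    have h4 : c • (P.A z1 - P.b) = p1 - (1 - θ) • p0 := by rw [hp1]; abel
    rw [h2, h3, h4]
    module
  have eDr : z2 - z1 = v2 - (v2 + z1 - z2) := by abel
  clear hI1 hI2 hp1 hp2
  generalize P.sig θ c = σ at *
  generalize tau θ = τ at *
  generalize P.lam θ = lam at *
  generalize v1 + z0 - z1 = r1 at *
  generalize v2 + z1 - z2 = r2 at *
  generalize z2 - z1 = D at *
  generalize p1 - p0 = d1 at *
  generalize p2 - p1 = d2 at *
  have hAD : P.A D = (1 / c) • (d2 - (1 - θ) • d1) := by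
    rw [← hd, smul_smul, one_div_mul_cancel hc.ne', one_smul]
  have hN : lam * c * ‖P.A D‖ ^ 2 = lam / c * (‖d2‖ ^ 2 - 2 * (1 - θ) * inner ℝ d1 d2
      + (1 - θ) ^ 2 * ‖d1‖ ^ 2) := by
    rw [hAD, norm_smul, mul_pow, norm_sub_sq_real, norm_smul, real_inner_smul_right,
      Real.norm_of_nonneg (by positivity), Real.norm_of_nonneg hq, real_inner_comm]
    field_simp
  have hIn : lam * (1 - θ) * inner ℝ d1 (P.A D)
      = (1 - θ) * (lam / c) * (inner ℝ d1 d2 - (1 - θ) * ‖d1‖ ^ 2) := by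
    rw [hAD, real_inner_smul_right, inner_sub_right,
      real_inner_smul_right, real_inner_self_eq_norm_sq]
    field_simp
  rw [hN, hIn] at S
  have hlc : 0 ≤ lam / c := by positivity
  -- The right side minus the left is `λ/c` times `(1 - θ)(1/2 - τ) ‖d2 - d1‖² + (1 - θ) τ θ ‖d1‖²`,
  -- which is nonnegative because `τ ≤ 1/2`.
  have hLow : (1 - τ) * θ * (lam / c * ‖d2‖ ^ 2)
      + (1 - θ) / 2 * (lam / c * ‖d2‖ ^ 2 - lam / c * ‖d1‖ ^ 2)
      ≤ (1 - θ) * (lam / c) * (inner ℝ d1 d2 - (1 - θ) * ‖d1‖ ^ 2)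
        + (1 - τ) * (lam / c * (‖d2‖ ^ 2 - 2 * (1 - θ) * inner ℝ d1 d2
        + (1 - θ) ^ 2 * ‖d1‖ ^ 2)) := by
    have h3 : 0 ≤ ‖d2‖ ^ 2 - 2 * inner ℝ d1 d2 + ‖d1‖ ^ 2 := by
      have := norm_sub_sq_real d2 d1
      rw [real_inner_comm] at this
      rw [← this]
      positivity
    have h4 : 0 ≤ (1 - θ) * (1 / 2 - τ) * (‖d2‖ ^ 2 - 2 * inner ℝ d1 d2 + ‖d1‖ ^ 2)
        + (1 - θ) * τ * θ * ‖d1‖ ^ 2 := by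
      have : 0 ≤ 1 / 2 - τ := by linarith
      positivity
    have h5 := mul_nonneg hlc h4
    linarith
  have hv2 : ‖v2‖ ≤ σ * ‖r2‖ := by
    apply le_of_sq_le_sq _ (by positivity)
    rw [mul_pow]
    linarith
  have hDn : ‖D‖ ^ 2 ≤ (1 + σ) ^ 2 * ‖r2‖ ^ 2 := by
    rw [← mul_pow]
    gcongr
    rw [eDr]
    have := norm_sub_le v2 r2
    linarith
  -- Writing `v2 - r1 = (r2 - r1) + D` with `D = v2 - r2` produces the telescoping difference. The
  -- extra `‖D‖²` meets `-(1 - τ)² ‖D‖²` in `S` and leaves `(2τ - τ²) ‖D‖²`.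
  have hinner : inner ℝ (v2 - r1) D ≤ 1 / 2 * (‖r1‖ ^ 2 - ‖r2‖ ^ 2) + ‖D‖ ^ 2
      + σ ^ 2 / 2 * ‖r2‖ ^ 2 := by
    have e : v2 - r1 = (r2 - r1) + D := by rw [eDr]; abel
    have h3 := neg_le_inner (r2 - r1) (-v2)
    have h4 : ‖r1‖ ^ 2 = ‖r2‖ ^ 2 - 2 * inner ℝ (r2 - r1) r2 + ‖r2 - r1‖ ^ 2 := by
      have : r1 = r2 - (r2 - r1) := by abel
      nth_rewrite 1 [this]
      rw [norm_sub_sq_real, real_inner_comm]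
    rw [e, inner_add_left, real_inner_self_eq_norm_sq]
    nth_rewrite 1 [eDr]
    rw [inner_neg_right, norm_neg] at h3
    rw [inner_sub_right]
    linarith
  have hε : (ε1 + ε2) / τ ≤ σ ^ 2 / τ / 2 * ‖r1‖ ^ 2 + σ ^ 2 / τ / 2 * ‖r2‖ ^ 2 := by
    have e : σ ^ 2 / τ / 2 * ‖r1‖ ^ 2 + σ ^ 2 / τ / 2 * ‖r2‖ ^ 2
        = (σ ^ 2 * ‖r1‖ ^ 2 / 2 + σ ^ 2 * ‖r2‖ ^ 2 / 2) / τ := by ring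
    rw [e]
    have := sq_nonneg ‖v1‖
    have := sq_nonneg ‖v2‖
    exact div_le_div_of_nonneg_right (by linarith) hτ.le
  have hDτ : (2 * τ - τ ^ 2) * ‖D‖ ^ 2 ≤ (2 * τ - τ ^ 2) * ((1 + σ) ^ 2 * ‖r2‖ ^ 2) :=
    mul_le_mul_of_nonneg_left hDn (by nlinarith)
  linarith

end Step

end Problem

end IPAAL

namespace IPAAL

namespace Problem

variable {n l : ℕ} {P : Problem n l} {θ c : ℝ}

/-! ### The sequence of outer iterations -/

/-- The outer iterations of the static method (continued beyond its termination). -/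
structure OuterSeq (P : Problem n l) (θ c : ℝ) (z0 : Vec n) (z : ℕ → Vec n) (p : ℕ → Vec l)
    (v : ℕ → Vec n) (ε : ℕ → ℝ) : Prop where
  z_zero : z 0 = z0
  p_zero : p 0 = 0
  prox : ∀ k, P.InexactProx θ c (z k) (p k) (z (k + 1)) (v k) (ε k)
  p_succ : ∀ k, p (k + 1) = (1 - θ) • p k + c • (P.A (z (k + 1)) - P.b)

/-- Here `c > 2 c̄` enters: beyond the part needed for `φ_c̄ ≥ φ*`, a penalty coefficient `(c -
c̄)/2 ≥ c/4` remains. -/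
theorem Standing.penalty_gap (hP : P.Standing) (h0 : 0 < θ) (hc : 2 * P.cbar < c) {z : Vec n}
    (hz : z ∈ P.dom) : P.lam θ * c * ‖P.A z - P.b‖ ^ 2 / 4
      ≤ P.lam θ * (P.phiPen c z - P.phiStar) := by
  have h1 := hP.phiStar_le hz
  have h2 : P.phiPen c z = P.phiPen P.cbar z + (c - P.cbar) / 2 * ‖P.A z - P.b‖ ^ 2 := by
    unfold phiPen
    ring
  have h3 : c / 4 * ‖P.A z - P.b‖ ^ 2 ≤ (c - P.cbar) / 2 * ‖P.A z - P.b‖ ^ 2 :=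
    mul_le_mul_of_nonneg_right (by linarith) (sq_nonneg _)
  have h4 := hP.lam_pos h0
  have : c / 4 * ‖P.A z - P.b‖ ^ 2 ≤ P.phiPen c z - P.phiStar := by linarith
  have := mul_le_mul_of_nonneg_left this h4.le
  linarith

namespace OuterSeq

variable {z0 : Vec n} {z : ℕ → Vec n} {p : ℕ → Vec l} {v : ℕ → Vec n} {ε : ℕ → ℝ}

/-- The potential function of the outer iterations. -/
noncomputable def potential (P : Problem n l) (θ c : ℝ) (z : ℕ → Vec n) (p : ℕ → Vec l)
    (v : ℕ → Vec n) (k : ℕ) : ℝ :=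
  P.merit θ c (p (k + 1)) (z (k + 1)) + omega θ * ((1 / 2 + P.sig θ c ^ 2 / tau θ / 2)
    * ‖v k + z k - z (k + 1)‖ ^ 2 + (1 - θ) / 2 * (P.lam θ / c * ‖p (k + 1) - p k‖ ^ 2))

/-- `merit_le` plus `omega` times `dual_increment`: by `omega_mul` the new dual increment cancels,
and `potential_coeff` leaves `1/16` of the squared residual. -/
theorem potential_succ (hP : P.Standing) (h0 : 0 < θ) (h1 : θ ≤ 1) (hc : 0 < c)
    (hS : P.OuterSeq θ c z0 z p v ε) (k : ℕ) :
    potential P θ c z p v (k + 1) + 1 / 16 * ‖v (k + 1) + z (k + 1) - z (k + 2)‖ ^ 2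
      ≤ potential P θ c z p v k := by
  have h2 := (hS.prox (k + 1)).merit_le hc (hS.p_succ (k + 1))
  have h3 := mul_le_mul_of_nonneg_left ((hS.prox k).dual_increment hP h0 h1 hc (hS.p_succ k)
    (hS.prox (k + 1)) (hS.p_succ (k + 1))) (omega_nonneg h0 h1)
  have h4 := congrArg (fun x => x * (P.lam θ / c * ‖p (k + 2) - p (k + 1)‖ ^ 2)) (omega_mul h0)
  have h5 := mul_le_mul_of_nonneg_right (potential_coeff h0 h1 (hP.sig_pos h0 h1 hc).le
    (P.sig_le_sigmaTheta θ c)) (sq_nonneg ‖v (k + 1) + z (k + 1) - z (k + 2)‖)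
  simp only [potential, show k + 1 + 1 = k + 2 from rfl] at h2 h3 h4 h5 ⊢
  linarith

/-- As `p 0 = 0`, the first Lagrangian is the plain penalty function, and comparison with feasible
points brings in `R₀`. The first multiplier is `c (A z₁ - b)`, so `penalty_gap` controls it by the
same quantity. -/
theorem potential_zero (hP : P.Standing) (h0 : 0 < θ) (h1 : θ ≤ 1) (hc0 : 0 < c)
    (hc : 2 * P.cbar < c) (hS : P.OuterSeq θ c z0 z p v ε) :
    potential P θ c z p v 0 ≤ (1 + 4 * (1 - θ) / θ) * P.R0 θ z0 ∧
      7 / 16 * ‖v 0 + z 0 - z 1‖ ^ 2 ≤ P.R0 θ z0 := by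
  have hq : 0 ≤ 1 - θ := by linarith
  have hI := hS.prox 0
  have hp := hS.p_succ 0
  rw [hS.p_zero] at hI hp
  have hl := hP.lam_pos h0
  have hgap := hP.penalty_gap h0 hc hI.mem
  have hY : P.lam θ * (P.phiPen c (z 1) - P.phiStar) + 7 / 16 * ‖v 0 + z 0 - z 1‖ ^ 2
      ≤ P.R0 θ z0 := by
    refine hP.le_R0 fun u hu => ?_
    have h2 := hI.lagr_le hP h0 h1 hc0 hu.1
    rw [P.lagr_of_feasible θ c 0 hu, P.lagr_eq θ c c, inner_zero_left, hS.z_zero] at h2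
    rw [hS.z_zero]
    simp only [zero_add] at h2
    linarith
  have hm := merit_eq (P := P) hc0 hp
  have ha : P.lam θ / c * ‖p (0 + 1)‖ ^ 2 = P.lam θ * c * ‖P.A (z 1) - P.b‖ ^ 2 := by
    rw [hp, smul_zero, zero_add, norm_smul, Real.norm_of_nonneg hc0.le, mul_pow]
    field_simp
  rw [sub_zero, ha, norm_zero] at hm
  have hω := omega_le h0 h1
  have hω0 := omega_nonneg h0 h1
  have hωσ := omega_mul_sq_le h0 h1 (hP.sig_pos h0 h1 hc0).le (P.sig_le_sigmaTheta θ c)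
  unfold potential
  rw [hm, hS.p_zero, sub_zero, ha]
  simp only [zero_add] at hgap ⊢
  set Y := P.lam θ * (P.phiPen c (z 1) - P.phiStar)
  set a := P.lam θ * c * ‖P.A (z 1) - P.b‖ ^ 2
  set R := ‖v 0 + z 0 - z 1‖ ^ 2
  have ha0 : 0 ≤ a := by positivity
  have hR0 : 0 ≤ R := by positivity
  have haY : a ≤ 4 * Y := by linarith
  constructor
  · have e1 : Y + (1 - θ) / 2 * (a - (1 - θ) * (P.lam θ / c * 0 ^ 2) + (1 - θ) * a)
        + omega θ * ((1 / 2 + P.sig θ c ^ 2 / tau θ / 2) * R + (1 - θ) / 2 * a)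
        = Y + ((1 - θ) * (2 - θ) / 2 + omega θ * (1 - θ) / 2) * a
          + (omega θ / 2 + omega θ * (P.sig θ c ^ 2 / tau θ) / 2) * R := by ring
    rw [e1]
    have h2 : ((1 - θ) * (2 - θ) / 2 + omega θ * (1 - θ) / 2) * a ≤ 4 * (1 - θ) / θ * Y := by
      have h3 : (1 - θ) * (2 - θ) / 2 + omega θ * (1 - θ) / 2 ≤ (1 - θ) / θ := by
        have h4 : omega θ * (1 - θ) ≤ 2 * (1 - θ) / θ * (1 - θ) := by gcongr
        have h5 : (1 - θ) / θ - ((1 - θ) * (2 - θ) / 2 + 2 * (1 - θ) / θ * (1 - θ) / 2)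
            = (1 - θ) * θ / 2 := by
          field_simp
          ring
        have h6 : 0 ≤ (1 - θ) * θ / 2 := by positivity
        linarith
      have h7 : 0 ≤ (1 - θ) / θ := by positivity
      calc _ ≤ (1 - θ) / θ * a := by gcongr
        _ ≤ (1 - θ) / θ * (4 * Y) := by gcongr
        _ = _ := by ring
    have h3 : (omega θ / 2 + omega θ * (P.sig θ c ^ 2 / tau θ) / 2) * R
        ≤ (1 + 4 * (1 - θ) / θ) * (7 / 16 * R) := by
      have h4 : omega θ / 2 + omega θ * (P.sig θ c ^ 2 / tau θ) / 2
          ≤ (1 + 4 * (1 - θ) / θ) * (7 / 16) := by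
        have h5 : 0 ≤ (1 - θ) / θ := by positivity
        have h6 : 2 * (1 - θ) / θ = 2 * ((1 - θ) / θ) := by ring
        have h7 : 4 * (1 - θ) / θ = 4 * ((1 - θ) / θ) := by ring
        rw [h6] at hω
        rw [h7]
        linarith
      calc _ ≤ (1 + 4 * (1 - θ) / θ) * (7 / 16) * R := by gcongr
        _ = _ := by ring
    have h4 : (1 + 4 * (1 - θ) / θ) * (Y + 7 / 16 * R)
        ≤ (1 + 4 * (1 - θ) / θ) * P.R0 θ z0 := by
      have : 0 ≤ 4 * (1 - θ) / θ := by positivity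
      gcongr
    linarith
  · linarith

/-- The scaled squared norms of the multipliers. -/
noncomputable def mult (P : Problem n l) (θ c : ℝ) (p : ℕ → Vec l) (k : ℕ) : ℝ :=
  P.lam θ / c * ‖p k‖ ^ 2

theorem mult_zero (hS : P.OuterSeq θ c z0 z p v ε) : mult P θ c p 0 = 0 := by
  simp [mult, hS.p_zero]

theorem mult_nonneg (hP : P.Standing) (h0 : 0 < θ) (hc : 0 < c) (k : ℕ) :
    0 ≤ mult P θ c p k := by
  have := hP.lam_pos h0
  unfold mult
  positivity

theorem merit_ge (hP : P.Standing) (h0 : 0 < θ) (h1 : θ ≤ 1) (hc0 : 0 < c)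
    (hc : 2 * P.cbar < c) (hS : P.OuterSeq θ c z0 z p v ε) (k : ℕ) :
    P.lam θ * c * ‖P.A (z (k + 1)) - P.b‖ ^ 2 / 4
      + (1 - θ) / 2 * (mult P θ c p (k + 1) - (1 - θ) * mult P θ c p k)
      ≤ P.merit θ c (p (k + 1)) (z (k + 1)) := by
  rw [merit_eq hc0 (hS.p_succ k)]
  have h2 := hP.penalty_gap h0 hc (hS.prox k).mem
  have hq : 0 ≤ 1 - θ := by linarith
  have hl := hP.lam_pos h0
  have h3 : 0 ≤ (1 - θ) / 2 * ((1 - θ) * (P.lam θ / c * ‖p (k + 1) - p k‖ ^ 2)) := by positivity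
  unfold mult
  linarith

theorem merit_le_potential (hP : P.Standing) (h0 : 0 < θ) (h1 : θ ≤ 1) (hc0 : 0 < c) (k : ℕ) :
    P.merit θ c (p (k + 1)) (z (k + 1)) ≤ potential P θ c z p v k := by
  have hq : 0 ≤ 1 - θ := by linarith
  have hl := hP.lam_pos h0
  have hτ := tau_pos h0
  have hω := omega_nonneg h0 h1
  unfold potential
  have : 0 ≤ omega θ * ((1 / 2 + P.sig θ c ^ 2 / tau θ / 2)
    * ‖v k + z k - z (k + 1)‖ ^ 2 + (1 - θ) / 2 * (P.lam θ / c * ‖p (k + 1) - p k‖ ^ 2)) := by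
    positivity
  linarith

theorem potential_antitone (hP : P.Standing) (h0 : 0 < θ) (h1 : θ ≤ 1) (hc : 0 < c)
    (hS : P.OuterSeq θ c z0 z p v ε) : Antitone (potential P θ c z p v) :=
  antitone_nat_of_succ_le fun k => by
    have h2 := potential_succ hP h0 h1 hc hS k
    have := sq_nonneg ‖v (k + 1) + z (k + 1) - z (k + 2)‖
    linarith

/-- The lower bound in `merit_ge` has no sign at a single index, but its sum over `K` indices is at
least `(1 - θ)²/2 · mult K ≥ 0`. -/
theorem potential_nonneg (hP : P.Standing) (h0 : 0 < θ) (h1 : θ ≤ 1) (hc0 : 0 < c)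
    (hc : 2 * P.cbar < c) (hS : P.OuterSeq θ c z0 z p v ε) (k : ℕ) :
    0 ≤ potential P θ c z p v k := by
  refine nonneg_of_antitone_of_sum_nonneg (potential_antitone hP h0 h1 hc0 hS) (fun K => ?_) k
  have hl := hP.lam_pos h0
  have hq : 0 ≤ 1 - θ := by linarith
  have key : (1 - θ) ^ 2 / 2 * mult P θ c p K
      ≤ ∑ j ∈ Finset.range K, potential P θ c z p v j := by
    induction K with
    | zero => simp [mult_zero hS]
    | succ K ih =>
      rw [Finset.sum_range_succ]
      have h2 := merit_ge hP h0 h1 hc0 hc hS K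
      have h3 := merit_le_potential (z := z) (p := p) (v := v) hP h0 h1 hc0 K
      have h4 : 0 ≤ P.lam θ * c * ‖P.A (z (K + 1)) - P.b‖ ^ 2 / 4 := by positivity
      have h5 : 0 ≤ (1 - θ) * θ / 2 * mult P θ c p (K + 1) :=
        mul_nonneg (by positivity) (mult_nonneg hP h0 hc0 _)
      linarith
  refine le_trans ?_ key
  have := mult_nonneg (p := p) hP h0 hc0 K
  positivity

/-- The residuals are square summable. -/
theorem sum_residual_le (hP : P.Standing) (h0 : 0 < θ) (h1 : θ ≤ 1) (hc0 : 0 < c)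
    (hc : 2 * P.cbar < c) (hS : P.OuterSeq θ c z0 z p v ε) (K : ℕ) :
    ∑ k ∈ Finset.range K, ‖v k + z k - z (k + 1)‖ ^ 2 ≤ 64 / θ * P.R0 θ z0 := by
  obtain ⟨h2, h3⟩ := potential_zero hP h0 h1 hc0 hc hS
  have hR := hP.R0_nonneg h0 z0
  have key : ∀ K, ∑ k ∈ Finset.range (K + 1), ‖v k + z k - z (k + 1)‖ ^ 2
      ≤ ‖v 0 + z 0 - z 1‖ ^ 2
        + 16 * (potential P θ c z p v 0 - potential P θ c z p v K) := by
    intro K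
    induction K with
    | zero => simp
    | succ K ih =>
      rw [Finset.sum_range_succ]
      have := potential_succ hP h0 h1 hc0 hS K
      linarith
  have h4 : ∑ k ∈ Finset.range K, ‖v k + z k - z (k + 1)‖ ^ 2
      ≤ ∑ k ∈ Finset.range (K + 1), ‖v k + z k - z (k + 1)‖ ^ 2 := by
    rw [Finset.sum_range_succ]
    linarith [sq_nonneg ‖v K + z K - z (K + 1)‖]
  have h5 := key K
  have h6 := potential_nonneg hP h0 h1 hc0 hc hS K
  -- The first residual costs `16/7 ≤ 3` times `R₀`, the others `16` times the initial potential;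
  -- together this is `(64/θ - 45) R₀`.
  have h7 : (3 + 16 * (1 + 4 * (1 - θ) / θ)) * P.R0 θ z0 ≤ 64 / θ * P.R0 θ z0 := by
    gcongr
    have e : 64 / θ - (3 + 16 * (1 + 4 * (1 - θ) / θ)) = 45 := by
      field_simp
      ring
    linarith
  linarith

/-- The update is a convex combination of `p k` and `(c/θ)(A z - b)` with weights `1 - θ` and `θ`;
convexity of the squared norm avoids a cross term. -/
theorem mult_succ_le (hP : P.Standing) (h0 : 0 < θ) (h1 : θ ≤ 1) (hc0 : 0 < c)
    (hS : P.OuterSeq θ c z0 z p v ε) (k : ℕ) :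
    mult P θ c p (k + 1) ≤ (1 - θ) * mult P θ c p k
      + P.lam θ * c * ‖P.A (z (k + 1)) - P.b‖ ^ 2 / θ := by
  have hl := hP.lam_pos h0
  have hq : 0 ≤ 1 - θ := by linarith
  have e : p (k + 1) = (1 - θ) • p k + θ • ((c / θ) • (P.A (z (k + 1)) - P.b)) - 0 := by
    rw [hS.p_succ k, smul_smul, mul_div_cancel₀ _ h0.ne', sub_zero]
  have h2 := norm_combo_sq (p k) ((c / θ) • (P.A (z (k + 1)) - P.b)) 0
    (by ring : (1 - θ) + θ = 1)
  rw [← e, sub_zero, sub_zero, norm_smul, mul_pow, Real.norm_of_nonneg (by positivity)] at h2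
  have h3 : ‖p (k + 1)‖ ^ 2 ≤ (1 - θ) * ‖p k‖ ^ 2
      + θ * ((c / θ) ^ 2 * ‖P.A (z (k + 1)) - P.b‖ ^ 2) := by
    have : 0 ≤ (1 - θ) * θ * ‖p k - (c / θ) • (P.A (z (k + 1)) - P.b)‖ ^ 2 := by positivity
    linarith
  have h4 := mul_le_mul_of_nonneg_left h3 (by positivity : 0 ≤ P.lam θ / c)
  unfold mult
  refine h4.trans (le_of_eq ?_)
  field_simp

/-- Bounds for the multipliers. -/
theorem mult_le (hP : P.Standing) (h0 : 0 < θ) (h1 : θ ≤ 1) (hc0 : 0 < c)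
    (hc : 2 * P.cbar < c) (hS : P.OuterSeq θ c z0 z p v ε) (k : ℕ) :
    (1 - θ) * mult P θ c p k ≤ 2 * potential P θ c z p v 0 / θ ∧
      mult P θ c p k ≤ 4 * potential P θ c z p v 0 / θ ^ 2 := by
  have hW := potential_nonneg hP h0 h1 hc0 hc hS 0
  have hq : 0 ≤ 1 - θ := by linarith
  have hl := hP.lam_pos h0
  induction k with
  | zero =>
    rw [mult_zero hS]
    constructor
    · rw [mul_zero]
      positivity
    · positivity
  | succ k ih =>
    have h2 := merit_ge hP h0 h1 hc0 hc hS k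
    have h3 := (merit_le_potential (z := z) (p := p) (v := v) hP h0 h1 hc0 k).trans
      (potential_antitone hP h0 h1 hc0 hS (Nat.zero_le k))
    have h4 := mult_succ_le hP h0 h1 hc0 hS k
    set W := potential P θ c z p v 0
    set S := P.lam θ * c * ‖P.A (z (k + 1)) - P.b‖ ^ 2
    have hS0 : 0 ≤ S := by positivity
    set a := mult P θ c p k
    set a' := mult P θ c p (k + 1)
    -- Both bounds are fixed points of affine recursions with slope `1 - θ`.
    constructor
    · have h5 := mul_le_mul_of_nonneg_left ih.1 hq
      have e : (1 - θ) * (2 * W / θ) + 2 * W = 2 * W / θ := by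
        field_simp
        ring
      linarith
    · have h5 := mul_le_mul_of_nonneg_left ih.2 hq
      have h6 : a' ≤ (1 - θ) * a + 4 * W / θ := by
        -- If `a'` exceeds `(1 - θ) a`, the multiplier part of `merit_ge` is nonnegative and its
        -- feasibility part gives `S ≤ 4W`.
        by_cases h : a' ≤ (1 - θ) * a
        · have : 0 ≤ 4 * W / θ := by positivity
          linarith
        · push Not at h
          have h7 : 0 ≤ (1 - θ) / 2 * (a' - (1 - θ) * a) :=
            mul_nonneg (by positivity) (by linarith)
          have h8 : S / θ ≤ 4 * W / θ := by
            gcongr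
            linarith
          linarith
      have e : (1 - θ) * (4 * W / θ ^ 2) + 4 * W / θ = 4 * W / θ ^ 2 := by
        field_simp
        ring
      linarith

/-- Bounds for the augmented Lagrangian at the refined points. -/
theorem lagr_refined_le (hP : P.Standing) (h0 : 0 < θ) (h1 : θ ≤ 1) (hc0 : 0 < c)
    (hc : 2 * P.cbar < c) (hS : P.OuterSeq θ c z0 z p v ε) (k : ℕ) {zh vh : Vec n}
    (hR : P.Refined θ c (z k) (p k) (z (k + 1)) (v k) zh vh) :
    P.lam θ * (P.lagr θ c (p k) zh - P.phiStar) + (1 - θ) ^ 2 * mult P θ c p k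
        ≤ kappa θ * P.R0 θ z0 ∧
      P.lam θ * (P.lagr θ c (p k) zh - P.phiStar) + 2 * (1 - θ) ^ 2 * mult P θ c p k
        ≤ 20 / θ ^ 2 * P.R0 θ z0 := by
  have hR0 := hP.R0_nonneg h0 z0
  have hq : 0 ≤ 1 - θ := by linarith
  have hκ := one_le_kappa h0 h1
  -- For `k = 0` the refined point is compared with feasible points; afterwards with its own prox
  -- center, whose Lagrangian the potential controls.
  cases k with
  | zero =>
    have h2 : P.lam θ * (P.lagr θ c (p 0) zh - P.phiStar) ≤ P.R0 θ z0 := by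
      refine hP.le_R0 fun u hu => ?_
      have h3 := hR.lagr_le hP h0 h1 hc0 (hS.prox 0) hu.1
      rw [P.lagr_of_feasible θ c (p 0) hu, hS.z_zero] at h3
      linarith
    rw [mult_zero hS, mul_zero, mul_zero, add_zero]
    constructor
    · nlinarith
    · have : 1 ≤ 20 / θ ^ 2 := by
        rw [le_div_iff₀ (by positivity)]
        nlinarith
      nlinarith
  | succ k =>
    have h2 := hR.lagr_le hP h0 h1 hc0 (hS.prox (k + 1)) (hS.prox (k + 1)).center_mem
    rw [sub_self, norm_zero] at h2
    have h3 : P.lam θ * (P.lagr θ c (p (k + 1)) (z (k + 1)) - P.phiStar)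
        = P.merit θ c (p (k + 1)) (z (k + 1)) + (1 - θ) * θ / 2 * mult P θ c p (k + 1) := by
      unfold merit mult
      ring
    have h4 := (merit_le_potential (z := z) (p := p) (v := v) hP h0 h1 hc0 k).trans
      (potential_antitone hP h0 h1 hc0 hS (Nat.zero_le k))
    have hW := potential_nonneg hP h0 h1 hc0 hc hS 0
    obtain ⟨h5, h6⟩ := mult_le hP h0 h1 hc0 hc hS (k + 1)
    have h7 := (potential_zero hP h0 h1 hc0 hc hS).1
    have ha := mult_nonneg (p := p) hP h0 hc0 (k + 1)
    set W := potential P θ c z p v 0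
    set a := mult P θ c p (k + 1)
    have h8 := add_le_kappa_mul h0 h1 hR0 h7 h5 h6
    have hqa : 0 ≤ (1 - θ) * a := by positivity
    have hqθa : 0 ≤ (1 - θ) * a * θ := by positivity
    constructor
    · nlinarith
    · have h9 : W + 2 * (2 * W / θ) ≤ 20 / θ ^ 2 * P.R0 θ z0 := by
        have e1 : W + 2 * (2 * W / θ) = W * (1 + 4 / θ) := by ring
        have e2 : 20 / θ ^ 2 * P.R0 θ z0 = 4 / θ * P.R0 θ z0 * (5 / θ) := by ring
        rw [e1, e2]
        have e3 : 1 + 4 * (1 - θ) / θ ≤ 4 / θ := by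
          have : 4 / θ - (1 + 4 * (1 - θ) / θ) = 3 := by
            field_simp
            ring
          linarith
        have e4 : 1 + 4 / θ ≤ 5 / θ := by
          have : 5 / θ - (1 + 4 / θ) = (1 - θ) / θ := by
            field_simp
            ring
          have : 0 ≤ (1 - θ) / θ := by positivity
          linarith
        calc W * (1 + 4 / θ) ≤ ((1 + 4 * (1 - θ) / θ) * P.R0 θ z0) * (1 + 4 / θ) := by gcongr
          _ ≤ _ := by gcongr
      nlinarith

/-- The refined points lie in a fixed sublevel set. -/
theorem level_refined_le (hP : P.Standing) (h0 : 0 < θ) (h1 : θ ≤ 1) (hc0 : 0 < c)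
    (hc : 2 * P.cbar < c) (hS : P.OuterSeq θ c z0 z p v ε) (k : ℕ) {zh vh : Vec n}
    (hR : P.Refined θ c (z k) (p k) (z (k + 1)) (v k) zh vh) :
    P.lam θ * (P.phiPen P.cbar zh - P.phiStar) ≤ kappa θ * P.R0 θ z0 := by
  have h2 := (lagr_refined_le hP h0 h1 hc0 hc hS k hR).1
  have hl := hP.lam_pos h0
  have hq : 0 ≤ 1 - θ := by linarith
  -- This is `λ/c` times the square of `(1 - θ) p + (c/2)(A ẑ - b)`; it consumes the penalty `c/4`
  -- provided by `(c - c̄)/2`.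
  have h3 : 0 ≤ P.lam θ * (1 - θ) * inner ℝ (p k) (P.A zh - P.b)
      + P.lam θ * (c / 4) * ‖P.A zh - P.b‖ ^ 2 + (1 - θ) ^ 2 * mult P θ c p k := by
    have h4 := sq_nonneg ‖(1 - θ) • p k + (c / 2) • (P.A zh - P.b)‖
    rw [norm_add_sq_real, norm_smul, norm_smul, real_inner_smul_left, real_inner_smul_right,
      mul_pow, mul_pow, Real.norm_of_nonneg hq, Real.norm_of_nonneg (by positivity)] at h4
    have h5 := mul_nonneg (by positivity : 0 ≤ P.lam θ / c) h4
    unfold mult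
    refine h5.trans (le_of_eq ?_)
    field_simp
    ring
  rw [P.lagr_eq θ c P.cbar] at h2
  have h6 : P.lam θ * (c / 4) * ‖P.A zh - P.b‖ ^ 2
      ≤ P.lam θ * ((c - P.cbar) / 2) * ‖P.A zh - P.b‖ ^ 2 :=
    mul_le_mul_of_nonneg_right (mul_le_mul_of_nonneg_left (by linarith) hl.le) (sq_nonneg _)
  linarith

/-- The infeasibility of the refined points. -/
theorem infeasibility_refined_le (hP : P.Standing) (h0 : 0 < θ) (h1 : θ ≤ 1) (hc0 : 0 < c)
    (hc : 2 * P.cbar < c) (hS : P.OuterSeq θ c z0 z p v ε) (k : ℕ) {zh vh : Vec n}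
    (hR : P.Refined θ c (z k) (p k) (z (k + 1)) (v k) zh vh) :
    P.lam θ * c * ‖P.A zh - P.b‖ ^ 2 ≤ 160 / θ ^ 2 * P.R0 θ z0 := by
  have h2 := (lagr_refined_le hP h0 h1 hc0 hc hS k hR).2
  have hl := hP.lam_pos h0
  have hq : 0 ≤ 1 - θ := by linarith
  have hstar := mul_le_mul_of_nonneg_left (hP.phiStar_le hR.mem) hl.le
  -- Now only `c/8` of the available `c/4` goes into the square, at the price of twice the
  -- multiplier term. The other `c/8` bounds the infeasibility, whence `160 = 8 · 20`.
  have h3 : 0 ≤ P.lam θ * (1 - θ) * inner ℝ (p k) (P.A zh - P.b)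
      + P.lam θ * (c / 8) * ‖P.A zh - P.b‖ ^ 2 + 2 * (1 - θ) ^ 2 * mult P θ c p k := by
    have h4 := sq_nonneg ‖(1 - θ) • p k + (c / 4) • (P.A zh - P.b)‖
    rw [norm_add_sq_real, norm_smul, norm_smul, real_inner_smul_left, real_inner_smul_right,
      mul_pow, mul_pow, Real.norm_of_nonneg hq, Real.norm_of_nonneg (by positivity)] at h4
    have h5 := mul_nonneg (by positivity : 0 ≤ 2 * P.lam θ / c) h4
    unfold mult
    refine h5.trans (le_of_eq ?_)
    field_simp
    ring
  rw [P.lagr_eq θ c P.cbar] at h2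
  have h6 : P.lam θ * (c / 4) * ‖P.A zh - P.b‖ ^ 2
      ≤ P.lam θ * ((c - P.cbar) / 2) * ‖P.A zh - P.b‖ ^ 2 :=
    mul_le_mul_of_nonneg_right (mul_le_mul_of_nonneg_left (by linarith) hl.le) (sq_nonneg _)
  have e : 160 / θ ^ 2 * P.R0 θ z0 = 8 * (20 / θ ^ 2 * P.R0 θ z0) := by ring
  rw [e]
  linarith

end OuterSeq

end Problem

end IPAAL

namespace IPAAL

namespace Problem

variable {n l : ℕ} {P : Problem n l} {θ c : ℝ}

/-! ### The smallest positive singular value -/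

section SigmaPlus

/-- The set of positive singular values of `A`. -/
def singularValues (P : Problem n l) : Set ℝ := {s : ℝ | 0 < s ∧ Module.End.HasEigenvalue
    ((ContinuousLinearMap.adjoint P.A ∘L P.A : Vec n →L[ℝ] Vec n) : Vec n →ₗ[ℝ] Vec n) (s ^ 2)}

theorem finite_singularValues (P : Problem n l) : P.singularValues.Finite := by
  refine ((Module.End.finite_hasEigenvalue ((ContinuousLinearMap.adjoint P.A ∘L P.A :
    Vec n →L[ℝ] Vec n) : Vec n →ₗ[ℝ] Vec n)).image Real.sqrt).subset ?_
  rintro s ⟨hs0, hs⟩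
  exact ⟨s ^ 2, hs, Real.sqrt_sq hs0.le⟩

/-- An orthonormal basis of eigenvectors of `A^* A`. -/
theorem exists_eigenbasis (P : Problem n l) : ∃ (e : OrthonormalBasis (Fin n) ℝ (Vec n))
    (μ : Fin n → ℝ), (∀ i, ContinuousLinearMap.adjoint P.A (P.A (e i)) = μ i • e i) ∧
      (∀ i, μ i = ‖P.A (e i)‖ ^ 2) ∧
      ∀ i, μ i ≠ 0 → √(μ i) ∈ P.singularValues := by
  have hT : ((ContinuousLinearMap.adjoint P.A ∘L P.A : Vec n →L[ℝ] Vec n) :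
      Vec n →ₗ[ℝ] Vec n).IsSymmetric := by
    intro x y
    simp [ContinuousLinearMap.adjoint_inner_left, ContinuousLinearMap.adjoint_inner_right]
  have hn : Module.finrank ℝ (Vec n) = n := by simp
  have h1 : ∀ i, ContinuousLinearMap.adjoint P.A (P.A (hT.eigenvectorBasis hn i))
      = hT.eigenvalues hn i • hT.eigenvectorBasis hn i := by
    intro i
    exact hT.apply_eigenvectorBasis hn i
  have h2 : ∀ i, hT.eigenvalues hn i = ‖P.A (hT.eigenvectorBasis hn i)‖ ^ 2 := by
    intro i
    rw [← real_inner_self_eq_norm_sq, ← ContinuousLinearMap.adjoint_inner_left, h1,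
      real_inner_smul_left, real_inner_self_eq_norm_sq, OrthonormalBasis.norm_eq_one]
    simp
  refine ⟨hT.eigenvectorBasis hn, hT.eigenvalues hn, h1, h2, fun i hi => ?_⟩
  have h3 : 0 ≤ hT.eigenvalues hn i := by
    rw [h2]
    positivity
  refine ⟨Real.sqrt_pos.2 (lt_of_le_of_ne h3 (Ne.symm hi)), ?_⟩
  rw [Real.sq_sqrt h3]
  simpa using hT.hasEigenvalue_eigenvalues hn i

theorem Standing.nonempty_singularValues (hP : P.Standing) : P.singularValues.Nonempty := by
  obtain ⟨e, μ, -, h2, h3⟩ := P.exists_eigenbasis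
  by_contra hne
  apply hP.A_ne_zero
  have h4 : ∀ i, P.A (e i) = 0 := by
    intro i
    by_contra hi
    apply hne
    refine ⟨_, h3 i ?_⟩
    rw [h2]
    exact pow_ne_zero 2 (norm_ne_zero_iff.2 hi)
  ext1 u
  rw [← e.sum_repr u, map_sum]
  simp [h4]

theorem Standing.sigmaPlus_mem (hP : P.Standing) : P.sigmaPlus ∈ P.singularValues :=
  hP.nonempty_singularValues.csInf_mem P.finite_singularValues

theorem Standing.sigmaPlus_pos (hP : P.Standing) : 0 < P.sigmaPlus := hP.sigmaPlus_mem.1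

theorem Standing.sigmaPlus_le_norm (hP : P.Standing) : P.sigmaPlus ≤ ‖P.A‖ := by
  obtain ⟨h0, h⟩ := hP.sigmaPlus_mem
  obtain ⟨u, hu⟩ := h.exists_hasEigenvector
  have h1 : ContinuousLinearMap.adjoint P.A (P.A u) = P.sigmaPlus ^ 2 • u := by
    simpa using hu.apply_eq_smul
  have hu0 : 0 < ‖u‖ := norm_pos_iff.2 hu.2
  have h2 : P.sigmaPlus ^ 2 * ‖u‖ ≤ ‖P.A‖ ^ 2 * ‖u‖ := by
    calc P.sigmaPlus ^ 2 * ‖u‖ = ‖ContinuousLinearMap.adjoint P.A (P.A u)‖ := by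
          rw [h1, norm_smul, Real.norm_of_nonneg (by positivity)]
      _ ≤ ‖P.A‖ * (‖P.A‖ * ‖u‖) := by
          refine (ContinuousLinearMap.le_opNorm _ _).trans ?_
          rw [LinearIsometryEquiv.norm_map]
          gcongr
          exact P.A.le_opNorm u
      _ = _ := by ring
  exact le_of_sq_le_sq (le_of_mul_le_mul_right h2 hu0) (norm_nonneg _)

/-- On the range of `A`, the adjoint is bounded below by the smallest positive singular value. -/
theorem Standing.sigmaPlus_mul_le (hP : P.Standing) (u : Vec n) :
    P.sigmaPlus * ‖P.A u‖ ≤ ‖ContinuousLinearMap.adjoint P.A (P.A u)‖ := by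
  obtain ⟨e, μ, h1, h2, h3⟩ := P.exists_eigenbasis
  have hμ0 : ∀ i, 0 ≤ μ i := fun i => by rw [h2]; positivity
  -- In the eigenbasis the claim holds term by term: an eigenvalue is zero or at least `σ⁺²`.
  have hμ : ∀ i, P.sigmaPlus ^ 2 * μ i ≤ μ i ^ 2 := by
    intro i
    by_cases hi : μ i = 0
    · simp [hi]
    · have h4 : P.sigmaPlus ≤ √(μ i) :=
        csInf_le (P.finite_singularValues.bddBelow) (h3 i hi)
      have h5 : P.sigmaPlus ^ 2 ≤ μ i := by
        rw [← Real.sq_sqrt (hμ0 i)]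
        have := hP.sigmaPlus_pos
        gcongr
      have := hμ0 i
      nlinarith
  set T : Vec n → Vec n := fun u => ContinuousLinearMap.adjoint P.A (P.A u) with hT
  have hTi : ∀ i, inner ℝ (e i) (T u) = μ i * inner ℝ (e i) u := by
    intro i
    rw [hT]
    simp only
    rw [ContinuousLinearMap.adjoint_inner_right, ← ContinuousLinearMap.adjoint_inner_left, h1,
      real_inner_smul_left]
  have hA : ‖P.A u‖ ^ 2 = ∑ i, μ i * inner ℝ (e i) u ^ 2 := by
    rw [← real_inner_self_eq_norm_sq, ← ContinuousLinearMap.adjoint_inner_right,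
      ← e.sum_inner_mul_inner]
    refine Finset.sum_congr rfl fun i _ => ?_
    have := hTi i
    rw [hT] at this
    rw [this, real_inner_comm]
    ring
  have hTT : ‖T u‖ ^ 2 = ∑ i, μ i ^ 2 * inner ℝ (e i) u ^ 2 := by
    rw [← real_inner_self_eq_norm_sq, ← e.sum_inner_mul_inner]
    refine Finset.sum_congr rfl fun i _ => ?_
    rw [real_inner_comm, hTi]
    ring
  apply le_of_sq_le_sq _ (norm_nonneg _)
  change _ ≤ ‖T u‖ ^ 2
  rw [mul_pow, hA, hTT, Finset.mul_sum]
  refine Finset.sum_le_sum fun i _ => ?_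
  rw [← mul_assoc]
  exact mul_le_mul_of_nonneg_right (hμ i) (sq_nonneg _)

end SigmaPlus

/-! ### Normal vectors and Slater points -/

theorem divBoundaryDist_nonneg (P : Problem n l) {t : ℝ} (ht : 0 ≤ t) (zbar : Vec n) :
    0 ≤ P.divBoundaryDist t zbar := by
  unfold divBoundaryDist
  split_ifs
  · exact le_rfl
  · exact div_nonneg ht Metric.infDist_nonneg

theorem divBoundaryDist_mono (P : Problem n l) {s t : ℝ} (h : s ≤ t) (zbar : Vec n) :
    P.divBoundaryDist s zbar ≤ P.divBoundaryDist t zbar := by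
  unfold divBoundaryDist
  split_ifs
  · exact le_rfl
  · exact div_le_div_of_nonneg_right h Metric.infDist_nonneg

/-- The ball is connected, contains an interior point and misses the frontier. If the distance is
zero, which includes the default value for an empty frontier, the ball is empty. -/
theorem IsSlater.ball_subset {zbar : Vec n} (hz : P.IsSlater zbar) :
    Metric.ball zbar (Metric.infDist zbar (frontier P.dom)) ⊆ P.dom := by
  rcases (Metric.infDist_nonneg (x := zbar) (s := frontier P.dom)).eq_or_lt with h | h
  · rw [← h, Metric.ball_zero]
    exact Set.empty_subset _
  refine Set.Subset.trans ?_ (interior_subset (s := P.dom))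
  refine IsPreconnected.subset_left_of_subset_union isOpen_interior
    (isClosed_closure (s := P.dom)).isOpen_compl ?_ ?_ ⟨zbar, Metric.mem_ball_self h, hz.1⟩
    (convex_ball _ _).isPreconnected
  · exact Set.disjoint_compl_right_iff_subset.2 (interior_subset.trans subset_closure)
  · intro w hw
    by_contra hnot
    simp only [Set.mem_union, Set.mem_compl_iff, not_or, not_not] at hnot
    have hwf : w ∈ frontier P.dom := ⟨hnot.2, hnot.1⟩
    have := Metric.infDist_le_dist_of_mem (x := zbar) hwf
    rw [Metric.mem_ball, dist_comm] at hw
    linarith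

/-- A step of length `r` from the Slater point along `ν` that stays in the domain gives `r ‖ν‖ ≤ ⟨ν,
zh - zbar⟩`. If the domain is the whole space, `r` is arbitrary and `ν = 0`. -/
theorem IsSlater.norm_normal_le {zbar zh ν : Vec n} (hz : P.IsSlater zbar)
    (hν : ν ∈ P.normalCone zh) {G t : ℝ} (hin : inner ℝ ν (zh - zbar) ≤ G * t) :
    ‖ν‖ ≤ G * P.divBoundaryDist t zbar := by
  have hstep : ∀ r : ℝ, 0 ≤ r → zbar + (r / ‖ν‖) • ν ∈ P.dom → r * ‖ν‖ ≤ G * t := by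
    intro r hr hmem
    have h1 := hν _ hmem
    have e : zbar + (r / ‖ν‖) • ν - zh = (r / ‖ν‖) • ν - (zh - zbar) := by abel
    rw [e, inner_sub_right, real_inner_smul_right, real_inner_self_eq_norm_sq] at h1
    rcases (norm_nonneg ν).eq_or_lt with h | h
    · rw [← h] at h1 ⊢
      simp at h1 ⊢
      linarith
    · have e2 : r / ‖ν‖ * ‖ν‖ ^ 2 = r * ‖ν‖ := by field_simp
      rw [e2] at h1
      linarith
  unfold divBoundaryDist
  split_ifs with hf
  · have hdom : P.dom = Set.univ := by
      rcases frontier_eq_empty_iff.1 hf with h | h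
      · have := interior_subset hz.1
        rw [h] at this
        exact absurd this (Set.notMem_empty _)
      · exact h
    rw [mul_zero]
    by_contra! hpos
    have h1 := hstep ((|G * t| + 1) / ‖ν‖) (by positivity) (by rw [hdom]; trivial)
    rw [div_mul_cancel₀ _ hpos.ne'] at h1
    linarith [le_abs_self (G * t)]
  · have hd : 0 < Metric.infDist zbar (frontier P.dom) := by
      rw [← isClosed_frontier.notMem_iff_infDist_pos (Set.nonempty_iff_ne_empty.2 hf)]
      exact fun h => h.2 hz.1
    rw [mul_div_assoc', le_div_iff₀ hd, mul_comm]
    set d := Metric.infDist zbar (frontier P.dom)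
    apply le_of_forall_small_add (k := d * ‖ν‖)
    intro s hs0 hs1
    have h1 := hstep ((1 - s) * d) (mul_nonneg (by linarith) hd.le) (by
      apply hz.ball_subset
      rw [Metric.mem_ball, dist_eq_norm, add_sub_cancel_left, norm_smul, Real.norm_of_nonneg
        (div_nonneg (mul_nonneg (by linarith) hd.le) (norm_nonneg _))]
      rcases (norm_nonneg ν).eq_or_lt with h | h
      · rw [← h, mul_zero]
        exact hd
      · rw [div_mul_cancel₀ _ h.ne']
        nlinarith)
    linarith

/-! ### Boundedness of the multipliers -/

theorem S_nonneg (P : Problem n l) (α : ℝ) : 0 ≤ P.S α :=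
  Real.sInf_nonneg fun _ hs => hs.1

/-- If `‖ph‖ > (1 - θ) ‖p‖`, the update and Cauchy–Schwarz give `⟨ph, A zh - b⟩ ≥ 0`, so this term
may be dropped when the inclusion is tested with `zh - zbar`; that bounds the normal component. The
rest bounds `A^* ph`, which is inverted on the range of `A`, where `ph` lies because `b = A zbar`.
-/
theorem norm_refined_multiplier_le (hP : P.Standing) (h1 : θ ≤ 1) (hc : 0 < c)
    (hB2 : P.BoundedLevels) (hB3 : P.BoundedSubdiff) {zbar : Vec n} (hz : P.IsSlater zbar)
    {α : ℝ} (hzbar : zbar ∈ P.sublevel α) {zh vh : Vec n} (hzh : zh ∈ P.sublevel α) {p ph : Vec l}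
    (hph : ph = (1 - θ) • p + c • (P.A zh - P.b)) (hpr : ∃ u, p = P.A u)
    (hsub : vh - gradient P.f zh - ContinuousLinearMap.adjoint P.A ph ∈ P.subdiff zh) :
    P.sigmaPlus * ‖ph‖ ≤ max (P.sigmaPlus * ((1 - θ) * ‖p‖))
      ((‖vh‖ + ‖gradient P.f zh‖ + P.S α) * (1 + P.divBoundaryDist (P.D α) zbar)) := by
  have hσ := hP.sigmaPlus_pos
  have hq : 0 ≤ 1 - θ := by linarith
  by_cases hcase : ‖ph‖ ≤ (1 - θ) * ‖p‖
  · exact le_max_of_le_left (mul_le_mul_of_nonneg_left hcase hσ.le)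
  push Not at hcase
  apply le_max_of_le_right
  have hD0 : 0 ≤ P.D α := Metric.diam_nonneg
  have hdiv := P.divBoundaryDist_nonneg hD0 zbar
  have hdist : ‖zh - zbar‖ ≤ P.D α := by
    rw [← dist_eq_norm]
    exact Metric.dist_le_diam_of_mem (hB2 α) hzh hzbar
  have hb := hz.2
  obtain ⟨w, rfl⟩ := hpr
  have hrange : ph = P.A ((1 - θ) • w + c • (zh - zbar)) := by
    rw [hph, ← hb]
    simp only [map_add, map_smul, map_sub]
  have hlow : P.sigmaPlus * ‖ph‖ ≤ ‖ContinuousLinearMap.adjoint P.A ph‖ := by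
    rw [hrange]
    exact hP.sigmaPlus_mul_le _
  have hfeas : 0 ≤ inner ℝ ph (P.A zh - P.b) := by
    have h2 : c * inner ℝ ph (P.A zh - P.b) = ‖ph‖ ^ 2 - (1 - θ) * inner ℝ ph (P.A w) := by
      have h3 : c • (P.A zh - P.b) = ph - (1 - θ) • P.A w := by
        rw [hph]
        abel
      rw [← real_inner_smul_right, h3, inner_sub_right, real_inner_smul_right,
        real_inner_self_eq_norm_sq]
    have h4 := real_inner_le_norm ph (P.A w)
    have h5 := mul_le_mul_of_nonneg_left h4 hq
    have h6 := mul_le_mul_of_nonneg_left hcase.le (norm_nonneg ph)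
    have h7 : 0 ≤ c * inner ℝ ph (P.A zh - P.b) := by
      rw [h2]
      linarith
    exact nonneg_of_mul_nonneg_right h7 hc
  apply le_of_forall_small_add (k := 1 + P.divBoundaryDist (P.D α) zbar)
  intro δ hδ0 _
  -- The infimum `S α` need not be attained, so a radius below `S α + δ` is used and `δ → 0`.
  obtain ⟨s, hs, hsS⟩ := exists_lt_of_csInf_lt (hB3 α) (lt_add_of_pos_right (P.S α) hδ0)
  obtain ⟨x, hx, ν, hν, hxν⟩ := Set.mem_add.1 (hs.2 zh hzh hsub)
  have hxs : ‖x‖ ≤ s := by simpa using hx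
  set G := ‖vh‖ + ‖gradient P.f zh‖ + s with hG
  have hy : ‖vh - gradient P.f zh - x‖ ≤ G := by
    refine (norm_sub_le _ _).trans ?_
    have := norm_sub_le vh (gradient P.f zh)
    linarith
  have hin : inner ℝ ν (zh - zbar) ≤ G * P.D α := by
    have e : ν = (vh - gradient P.f zh - x) - ContinuousLinearMap.adjoint P.A ph := by
      have : ν = (x + ν) - x := by abel
      rw [this, hxν]
      abel
    rw [e, inner_sub_left, ContinuousLinearMap.adjoint_inner_left, map_sub, hb]
    have h2 := real_inner_le_norm (vh - gradient P.f zh - x) (zh - zbar)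
    have h3 : ‖vh - gradient P.f zh - x‖ * ‖zh - zbar‖ ≤ G * P.D α :=
      mul_le_mul hy hdist (norm_nonneg _) ((norm_nonneg _).trans hy)
    linarith
  have hνn := hz.norm_normal_le hν hin
  have hA : ‖ContinuousLinearMap.adjoint P.A ph‖ ≤ G + ‖ν‖ := by
    have e : ContinuousLinearMap.adjoint P.A ph = (vh - gradient P.f zh - x) - ν := by
      have : ν = (x + ν) - x := by abel
      rw [this, hxν]
      abel
    rw [e]
    exact (norm_sub_le _ _).trans (by linarith)
  have h8 : G * (1 + P.divBoundaryDist (P.D α) zbar)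
      ≤ (‖vh‖ + ‖gradient P.f zh‖ + P.S α + δ) * (1 + P.divBoundaryDist (P.D α) zbar) := by
    gcongr
    linarith
  linarith

theorem Standing.mem_sublevel_level (hP : P.Standing) (h0 : 0 < θ)
    {z0 zbar w : Vec n} (hz0 : z0 ∈ P.dom) (hw : w ∈ P.dom)
    (h : P.lam θ * (P.phiPen P.cbar w - P.phiStar) ≤ kappa θ * P.R0 θ z0) :
    w ∈ P.sublevel (P.level θ z0 zbar) := by
  refine ⟨hw, ?_⟩
  have hl := hP.lam_pos h0
  have h2 : P.phiPen P.cbar w - P.phiStar ≤ kappa θ * P.R0 θ z0 / P.lam θ := by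
    rw [le_div_iff₀ hl]
    linarith
  have h3 := hP.phiStar_le hz0
  have h4 := le_max_left (P.phiPen P.cbar z0) (P.phiPen P.cbar zbar)
  unfold level
  linarith

theorem Standing.N0_nonneg (hP : P.Standing) (h0 : 0 < θ) (z0 zbar : Vec n) :
    0 ≤ P.N0 θ z0 zbar := by
  have hl := hP.lam_pos h0
  have hL := hP.L_pos
  have hσ := hP.sigmaPlus_pos
  have hS := P.S_nonneg (P.level θ z0 zbar)
  have hD : 0 ≤ P.D (P.level θ z0 zbar) := Metric.diam_nonneg
  have hdiv := P.divBoundaryDist_nonneg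
    (le_max_of_le_right (b := √(3 * kappa θ * P.R0 θ z0)) hD) zbar
  unfold N0
  positivity

/-- Under the Slater condition, the infeasibility is at most of the order `N₀ / c`. -/
theorem OuterSeq.infeasibility_slater (hP : P.Standing) (h0 : 0 < θ) (h1 : θ ≤ 1) (hc0 : 0 < c)
    (hc : 2 * P.cbar < c) {z0 : Vec n} {z : ℕ → Vec n} {p : ℕ → Vec l} {v : ℕ → Vec n}
    {ε : ℕ → ℝ} (hS : P.OuterSeq θ c z0 z p v ε) (hB2 : P.BoundedLevels)
    (hB3 : P.BoundedSubdiff) {zbar : Vec n} (hz : P.IsSlater zbar) (k : ℕ) {zh vh : Vec n}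
    (hR : P.Refined θ c (z k) (p k) (z (k + 1)) (v k) zh vh) :
    c * ‖P.A zh - P.b‖ ≤ 6 / θ * P.N0 θ z0 zbar := by
  have hl := hP.lam_pos h0
  have hL := hP.L_pos
  have hσ := hP.sigmaPlus_pos
  have hq : 0 ≤ 1 - θ := by linarith
  have hκ := one_le_kappa h0 h1
  have hR0 := hP.R0_nonneg h0 z0
  have hz0 : z0 ∈ P.dom := hS.z_zero ▸ (hS.prox 0).center_mem
  set α := P.level θ z0 zbar with hα
  have hκR : 0 ≤ kappa θ * P.R0 θ z0 / P.lam θ := by positivity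
  have hz0α : z0 ∈ P.sublevel α := by
    refine ⟨hz0, ?_⟩
    have := le_max_left (P.phiPen P.cbar z0) (P.phiPen P.cbar zbar)
    rw [hα, level]
    linarith
  have hzbarα : zbar ∈ P.sublevel α := by
    refine ⟨interior_subset hz.1, ?_⟩
    have := le_max_right (P.phiPen P.cbar z0) (P.phiPen P.cbar zbar)
    rw [hα, level]
    linarith
  set D := P.D α with hD
  have hD0 : 0 ≤ D := Metric.diam_nonneg
  set S := P.S α with hSα
  have hS0 : 0 ≤ S := P.S_nonneg α
  set r := √(3 * kappa θ * P.R0 θ z0) with hr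
  have hr0 : 0 ≤ r := Real.sqrt_nonneg _
  set dv := P.divBoundaryDist (max r D) zbar with hdv
  have hdv0 : 0 ≤ dv := P.divBoundaryDist_nonneg (le_max_of_le_left hr0) zbar
  have hdvD : P.divBoundaryDist D zbar ≤ dv := P.divBoundaryDist_mono (le_max_right _ _) zbar
  set Br := ‖gradient P.f z0‖ + P.L * D + S + (P.L + 14 / (P.lam θ * √θ)) * r with hBr
  have hN : P.N0 θ z0 zbar = 1 / P.sigmaPlus * (1 + dv) * Br := rfl
  set N := P.N0 θ z0 zbar with hNdef
  have hN0 : 0 ≤ N := hP.N0_nonneg h0 z0 zbar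
  have hσN : P.sigmaPlus * N = (1 + dv) * Br := by
    rw [hN]
    field_simp
  have hsθ : 0 < √θ := Real.sqrt_pos.2 h0
  have hBr0 : 0 ≤ Br := by positivity
  -- the residuals
  have hres : ∀ j, ‖v j + z j - z (j + 1)‖ ≤ 8 * (r / √θ) := by
    intro j
    have h2 := OuterSeq.sum_residual_le hP h0 h1 hc0 hc hS (j + 1)
    have h3 : ‖v j + z j - z (j + 1)‖ ^ 2 ≤ 64 / θ * P.R0 θ z0 :=
      le_trans (Finset.single_le_sum (f := fun k => ‖v k + z k - z (k + 1)‖ ^ 2)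
        (fun i _ => sq_nonneg _) (Finset.self_mem_range_succ j)) h2
    apply le_of_sq_le_sq _ (by positivity)
    refine h3.trans ?_
    have h4 : (8 * (r / √θ)) ^ 2 = 64 / θ * (3 * kappa θ * P.R0 θ z0) := by
      rw [mul_pow, div_pow, hr, Real.sq_sqrt (by positivity), Real.sq_sqrt h0.le]
      ring
    rw [h4]
    gcongr
    nlinarith
  -- The `14` splits as `(14/8) · 8`, with `8 = √64` from the residual sum. Since `3 ≤ 2 · 14/8`,
  -- the bound `3 ‖r‖/λ` for `‖v̂‖` fits into `2 Br`.
  have hresBr : ∀ j, 14 / 8 * (‖v j + z j - z (j + 1)‖ / P.lam θ)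
      ≤ 14 / (P.lam θ * √θ) * r := by
    intro j
    have h2 : 14 / (P.lam θ * √θ) * r = 14 / 8 * (8 * (r / √θ) / P.lam θ) := by
      field_simp
    rw [h2]
    have h3 := div_le_div_of_nonneg_right (hres j) hl.le
    linarith
  -- one iteration
  have hhat : ∀ j, ∀ {zh vh : Vec n}, P.Refined θ c (z j) (p j) (z (j + 1)) (v j) zh vh →
      (∃ u, p j = P.A u) →
      ‖(1 - θ) • p j + c • (P.A zh - P.b)‖ ≤ max ((1 - θ) * ‖p j‖) (2 * N) := by
    intro j zh vh hR hpr
    have hzhα := hP.mem_sublevel_level (zbar := zbar) h0 hz0 hR.mem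
      (OuterSeq.level_refined_le hP h0 h1 hc0 hc hS j hR)
    have h2 := norm_refined_multiplier_le hP h1 hc0 hB2 hB3 hz hzbarα hzhα rfl hpr hR.subdiff
    have h3 : ‖gradient P.f zh‖ ≤ ‖gradient P.f z0‖ + P.L * D := by
      have h4 := hP.grad_lipschitz z0 hz0 zh hR.mem
      have h5 : ‖zh - z0‖ ≤ D := by
        rw [← dist_eq_norm]
        exact Metric.dist_le_diam_of_mem (hB2 α) hzhα hz0α
      have h6 : ‖gradient P.f zh‖ ≤ ‖gradient P.f z0‖ + ‖gradient P.f zh - gradient P.f z0‖ := by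
        have := norm_add_le (gradient P.f z0) (gradient P.f zh - gradient P.f z0)
        rwa [add_sub_cancel] at this
      have h7 : P.L * ‖zh - z0‖ ≤ P.L * D := by gcongr
      linarith
    have h4 : ‖vh‖ ≤ 3 * (‖v j + z j - z (j + 1)‖ / P.lam θ) := by
      rw [mul_div_assoc', le_div_iff₀ hl, mul_comm]
      exact hR.norm_le
    have h5 : ‖vh‖ + ‖gradient P.f zh‖ + S ≤ 2 * Br := by
      have := hresBr j
      have : 0 ≤ P.L * r := by positivity
      have : 0 ≤ P.L * D := by positivity
      have := norm_nonneg (gradient P.f z0)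
      have : 0 ≤ 14 / (P.lam θ * √θ) * r := by positivity
      linarith
    have h6 : (‖vh‖ + ‖gradient P.f zh‖ + S) * (1 + P.divBoundaryDist D zbar)
        ≤ P.sigmaPlus * (2 * N) := by
      have : 0 ≤ 1 + P.divBoundaryDist D zbar := by
        have := P.divBoundaryDist_nonneg hD0 zbar
        linarith
      calc _ ≤ 2 * Br * (1 + dv) := by gcongr
        _ = _ := by rw [mul_left_comm, hσN]; ring
    have h7 := h2.trans (max_le_max_left _ h6)
    rw [← mul_max_of_nonneg _ _ hσ.le] at h7
    exact le_of_mul_le_mul_left h7 hσ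
  have hrange : ∀ j, ∃ u, p j = P.A u := by
    intro j
    induction j with
    | zero => exact ⟨0, by rw [hS.p_zero, map_zero]⟩
    | succ j ih =>
      obtain ⟨u, hu⟩ := ih
      refine ⟨(1 - θ) • u + c • (z (j + 1) - zbar), ?_⟩
      rw [hS.p_succ, hu, ← hz.2]
      simp only [map_add, map_smul, map_sub]
  -- The bound `3N/θ` is preserved by `t ↦ max ((1 - θ) t) (2N) + N`.
  have hB : ∀ j, ‖p j‖ ≤ 3 / θ * N := by
    intro j
    induction j with
    | zero =>
      rw [hS.p_zero, norm_zero]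
      positivity
    | succ j ih =>
      have hRj := hP.refined h0 h1 hc0 (hS.prox j)
      set zj := P.refineZ θ c (z j) (p j) (z (j + 1)) (v j)
      have h2 := hhat j hRj (hrange j)
      -- The next multiplier uses `z (j + 1)`, not the refined point. As `Λ ≥ λ c ‖A‖²`, the
      -- distance estimate of the refinement makes this change independent of `c`.
      have h3 : ‖c • P.A (z (j + 1) - zj)‖ ≤ N := by
        have h4 := hRj.dist_le
        set R := ‖v j + z j - z (j + 1)‖ with hRdef
        have hA := hP.norm_A_pos
        have h5 : P.lam θ * c * ‖P.A‖ ^ 2 * ‖z (j + 1) - zj‖ ≤ R := by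
          refine le_trans ?_ h4
          gcongr
          unfold Lc
          have : 0 < P.lam θ * P.L := by positivity
          linarith
        have h6 : P.sigmaPlus * ‖c • P.A (z (j + 1) - zj)‖ ≤ R / P.lam θ := by
          rw [le_div_iff₀ hl, norm_smul, Real.norm_of_nonneg hc0.le]
          refine le_trans ?_ h5
          have h7 := P.A.le_opNorm (z (j + 1) - zj)
          have h8 := hP.sigmaPlus_le_norm
          calc P.sigmaPlus * (c * ‖P.A (z (j + 1) - zj)‖) * P.lam θ
              ≤ ‖P.A‖ * (c * (‖P.A‖ * ‖z (j + 1) - zj‖)) * P.lam θ := by gcongr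
            _ = _ := by ring
        have h9 : R / P.lam θ ≤ (1 + dv) * Br := by
          have h10 := hresBr j
          have h11 : R / P.lam θ ≤ Br := by
            have : 0 ≤ P.L * r := by positivity
            have : 0 ≤ P.L * D := by positivity
            have := norm_nonneg (gradient P.f z0)
            have : 0 ≤ R / P.lam θ := by positivity
            linarith
          have : 0 ≤ dv * Br := by positivity
          linarith
        rw [← hσN] at h9
        exact le_of_mul_le_mul_left (h6.trans h9) hσ
      have e : p (j + 1) = ((1 - θ) • p j + c • (P.A zj - P.b)) + c • P.A (z (j + 1) - zj) := by
        rw [hS.p_succ, map_sub]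
        module
      have h4 : ‖p (j + 1)‖ ≤ max ((1 - θ) * ‖p j‖) (2 * N) + N := by
        rw [e]
        exact (norm_add_le _ _).trans (add_le_add h2 h3)
      have h5 : max ((1 - θ) * ‖p j‖) (2 * N) ≤ 3 / θ * N - N := by
        have h6 := mul_le_mul_of_nonneg_left ih hq
        have h7 : (1 - θ) * (3 / θ * N) = 3 / θ * N - 3 * N := by
          field_simp
        have h8 : 3 * N ≤ 3 / θ * N := by
          gcongr
          rw [le_div_iff₀ h0]
          linarith
        refine max_le ?_ ?_ <;> linarith
      linarith
  have h2 := hhat k hR (hrange k)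
  have h3 := hB k
  have h4 : (1 - θ) * ‖p k‖ ≤ 3 / θ * N := by
    have := norm_nonneg (p k)
    nlinarith
  have h5 : 2 * N ≤ 3 / θ * N := by
    gcongr
    rw [le_div_iff₀ h0]
    linarith
  have h6 := h2.trans (max_le h4 h5)
  have e : c • (P.A zh - P.b) = ((1 - θ) • p k + c • (P.A zh - P.b)) - (1 - θ) • p k := by abel
  have h7 : ‖c • (P.A zh - P.b)‖ ≤ 3 / θ * N + (1 - θ) * ‖p k‖ := by
    rw [e]
    refine (norm_sub_le _ _).trans ?_
    rw [norm_smul (1 - θ), Real.norm_of_nonneg hq]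
    linarith
  rw [norm_smul, Real.norm_of_nonneg hc0.le] at h7
  have e2 : 6 / θ * N = 3 / θ * N + 3 / θ * N := by ring
  rw [e2]
  linarith

end Problem

end IPAAL

namespace IPAAL

namespace Problem

variable {n l : ℕ} {P : Problem n l} {θ c : ℝ}

/-! ### Counting iterations -/

/-- The bound for the number of iterations of a call of the ACG method. -/
noncomputable def innerBound (P : Problem n l) (θ c : ℝ) : ℝ :=
  innerConst θ * (√(P.lam θ * P.Lc c + 1) * logOne (P.lam θ * P.Lc c + 1))

/-- The bound for the number of outer iterations of a run of the static method. -/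
noncomputable def outerBound (P : Problem n l) (θ : ℝ) (z0 : Vec n) (ρ : ℝ) : ℕ :=
  ⌈577 / θ⌉₊ * max 1 ⌈P.R0 θ z0 / (P.lam θ ^ 2 * ρ ^ 2)⌉₊

theorem innerBound_nonneg (P : Problem n l) (h0 : 0 < θ) (h1 : θ ≤ 1) (c : ℝ) :
    0 ≤ P.innerBound θ c := by
  have h2 := innerConst_pos h0 h1
  have h3 := one_le_logOne (P.lam θ * P.Lc c + 1)
  unfold innerBound
  positivity

/-- A run of the static method with penalty parameter `c`: after `N` ACG iterations it ends with
the output `(zh, vh, ph)`. -/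
structure StaticRun (P : Problem n l) (θ : ℝ) (z0 : Vec n) (ρ η c : ℝ) (N : ℕ) (zh vh : Vec n)
    (ph : Vec l) : Prop where
  count : (N : ℝ) ≤ P.outerBound θ z0 ρ * P.innerBound θ c
  subdiff : vh ∈ {gradient P.f zh} + P.subdiff zh + {ContinuousLinearMap.adjoint P.A ph}
  norm_le : ‖vh‖ ≤ ρ
  halted : ‖P.A zh - P.b‖ ≤ η →
    (P.step θ z0 ρ η)^[N] (Config.running c z0 0 (acgInit z0)) = Config.halted zh vh ph
  restart : ¬ ‖P.A zh - P.b‖ ≤ η → (P.step θ z0 ρ η)^[N] (Config.running c z0 0 (acgInit z0))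
    = Config.running (2 * c) z0 0 (acgInit z0)

/-- The residual of the refined pair becomes small after the stated number of outer iterations. -/
theorem OuterSeq.exists_small (hP : P.Standing) (h0 : 0 < θ) (h1 : θ ≤ 1) (hc0 : 0 < c)
    (hc : 2 * P.cbar < c) {z0 : Vec n} {z : ℕ → Vec n} {p : ℕ → Vec l} {v : ℕ → Vec n}
    {ε : ℕ → ℝ} (hS : P.OuterSeq θ c z0 z p v ε) {ρ : ℝ} (hρ : 0 < ρ) :
    ∃ k < P.outerBound θ z0 ρ, ‖P.refineV θ c (z k) (p k) (z (k + 1)) (v k)‖ ≤ ρ := by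
  by_contra! hcon
  have hl := hP.lam_pos h0
  set K := P.outerBound θ z0 ρ with hK
  have hsum := OuterSeq.sum_residual_le hP h0 h1 hc0 hc hS K
  have hterm : ∀ k ∈ Finset.range K,
      P.lam θ ^ 2 * ρ ^ 2 / 9 ≤ ‖v k + z k - z (k + 1)‖ ^ 2 := by
    intro k hk
    have h2 := hcon k (Finset.mem_range.1 hk)
    have h3 := (hP.refined h0 h1 hc0 (hS.prox k)).norm_le
    have h4 : P.lam θ * ρ ≤ 3 * ‖v k + z k - z (k + 1)‖ :=
      le_trans (mul_le_mul_of_nonneg_left h2.le hl.le) h3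
    have h5 : (P.lam θ * ρ) ^ 2 ≤ (3 * ‖v k + z k - z (k + 1)‖) ^ 2 := by gcongr
    linarith
  have h2 := Finset.card_nsmul_le_sum _ _ _ hterm
  rw [Finset.card_range, nsmul_eq_mul] at h2
  set D := P.lam θ ^ 2 * ρ ^ 2 with hD
  have hD0 : 0 < D := by positivity
  -- The residual sum accounts for `576 = 9 · 64`; the surplus `1/θ` and the maximum with `D > 0`
  -- make the contradiction strict, even if `R₀ = 0`.
  have h3 : 577 / θ * max D (P.R0 θ z0) ≤ K * D := by
    have h4 : (577 / θ : ℝ) ≤ ⌈577 / θ⌉₊ := Nat.le_ceil _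
    have h5 : max 1 (P.R0 θ z0 / D) ≤ (max 1 ⌈P.R0 θ z0 / D⌉₊ : ℕ) := by
      push_cast
      exact max_le_max_left _ (Nat.le_ceil _)
    have h6 : max D (P.R0 θ z0) = max 1 (P.R0 θ z0 / D) * D := by
      rw [max_mul_of_nonneg _ _ hD0.le, one_mul, div_mul_cancel₀ _ hD0.ne']
    rw [h6, hK, outerBound]
    push_cast at h5 ⊢
    rw [← mul_assoc]
    gcongr
  have h7 := le_max_left D (P.R0 θ z0)
  have h8 := le_max_right D (P.R0 θ z0)
  have h9 : 576 / θ * P.R0 θ z0 ≤ 576 / θ * max D (P.R0 θ z0) := by gcongr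
  have e : 577 / θ * max D (P.R0 θ z0) = 576 / θ * max D (P.R0 θ z0)
      + 1 / θ * max D (P.R0 θ z0) := by ring
  have e2 : 576 / θ * P.R0 θ z0 = 9 * (64 / θ * P.R0 θ z0) := by ring
  have h10 : 0 < 1 / θ * max D (P.R0 θ z0) := by
    have : 0 < max D (P.R0 θ z0) := by linarith
    positivity
  linarith

theorem Standing.exists_staticRun (hP : P.Standing) (h0 : 0 < θ) (h1 : θ ≤ 1) (hc0 : 0 < c)
    (hc : 2 * P.cbar < c) {z0 : Vec n} (hz0 : z0 ∈ P.dom) {ρ : ℝ} (hρ : 0 < ρ) (η : ℝ) :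
    ∃ (N : ℕ) (zh vh : Vec n) (ph : Vec l), P.StaticRun θ z0 ρ η c N zh vh ph ∧
      ∃ (z : ℕ → Vec n) (p : ℕ → Vec l) (v : ℕ → Vec n) (ε : ℕ → ℝ) (k : ℕ),
        P.OuterSeq θ c z0 z p v ε ∧ P.Refined θ c (z k) (p k) (z (k + 1)) (v k) zh vh := by
  have hinner : ∀ (z : Vec n) (p : Vec l), z ∈ P.dom →
      ∃ (z' v : Vec n) (ε : ℝ) (N : ℕ), P.InexactProx θ c z p z' v ε ∧
      (N : ℝ) ≤ P.innerBound θ c ∧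
      ∀ (zs : Vec n) (ρ η : ℝ), (P.step θ zs ρ η)^[N] (Config.running c z p (acgInit z))
        = P.accept θ zs ρ η c z p z' v :=
    fun z p hz => hP.exists_inner h0 h1 hc0 hz p
  -- The sequence of inexact prox steps is continued past termination, so the summation estimate
  -- applies; the run follows it up to the first small refined residual.
  choose! Z V E M hZ using hinner
  let s : ℕ → Vec n × Vec l := fun k => Nat.rec (z0, 0)
    (fun _ s => (Z s.1 s.2, (1 - θ) • s.2 + c • (P.A (Z s.1 s.2) - P.b))) k
  have hdom : ∀ k, (s k).1 ∈ P.dom := by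
    intro k
    induction k with
    | zero => exact hz0
    | succ k ih => exact (hZ _ _ ih).1.mem
  have hS : P.OuterSeq θ c z0 (fun k => (s k).1) (fun k => (s k).2)
      (fun k => V (s k).1 (s k).2) (fun k => E (s k).1 (s k).2) :=
    ⟨rfl, rfl, fun k => (hZ _ _ (hdom k)).1, fun k => rfl⟩
  have hex := OuterSeq.exists_small hP h0 h1 hc0 hc hS hρ
  classical
  have hex' : ∃ k, ‖P.refineV θ c (s k).1 (s k).2 (s (k + 1)).1 (V (s k).1 (s k).2)‖ ≤ ρ :=
    ⟨_, hex.choose_spec.2⟩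
  set k := Nat.find hex' with hk
  have hkρ : ‖P.refineV θ c (s k).1 (s k).2 (s (k + 1)).1 (V (s k).1 (s k).2)‖ ≤ ρ :=
    Nat.find_spec hex'
  have hkK : k < P.outerBound θ z0 ρ :=
    lt_of_le_of_lt (Nat.find_min' hex' hex.choose_spec.2) hex.choose_spec.1
  have hrun : ∀ i ≤ k, ∃ N : ℕ, (N : ℝ) ≤ i * P.innerBound θ c ∧
      (P.step θ z0 ρ η)^[N] (Config.running c z0 0 (acgInit z0))
        = Config.running c (s i).1 (s i).2 (acgInit (s i).1) := by
    intro i hi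
    induction i with
    | zero => exact ⟨0, by simp, rfl⟩
    | succ i ih =>
      obtain ⟨N, hN, hNeq⟩ := ih (by omega)
      refine ⟨M (s i).1 (s i).2 + N, ?_, ?_⟩
      · have := (hZ _ (s i).2 (hdom i)).2.1
        push_cast
        linarith
      · rw [Function.iterate_add_apply, hNeq, (hZ _ (s i).2 (hdom i)).2.2]
        exact if_neg (Nat.find_min hex' (by omega : i < k))
  obtain ⟨N, hN, hNeq⟩ := hrun k le_rfl
  have hfin : (P.step θ z0 ρ η)^[M (s k).1 (s k).2 + N] (Config.running c z0 0 (acgInit z0))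
      = P.accept θ z0 ρ η c (s k).1 (s k).2 (s (k + 1)).1 (V (s k).1 (s k).2) := by
    rw [Function.iterate_add_apply, hNeq, (hZ _ (s k).2 (hdom k)).2.2]
  have hR := hP.refined h0 h1 hc0 (hS.prox k)
  refine ⟨M (s k).1 (s k).2 + N, P.refineZ θ c (s k).1 (s k).2 (s (k + 1)).1 (V (s k).1 (s k).2),
    P.refineV θ c (s k).1 (s k).2 (s (k + 1)).1 (V (s k).1 (s k).2),
    (1 - θ) • (s k).2 + c • (P.A (P.refineZ θ c (s k).1 (s k).2 (s (k + 1)).1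
      (V (s k).1 (s k).2)) - P.b), ⟨?_, ?_, hkρ, ?_, ?_⟩, _, _, _, _, k, hS, hR⟩
  · have h2 := (hZ _ (s k).2 (hdom k)).2.1
    have h3 : ((k + 1 : ℕ) : ℝ) * P.innerBound θ c
        ≤ P.outerBound θ z0 ρ * P.innerBound θ c := by
      have := P.innerBound_nonneg h0 h1 c
      gcongr
      exact hkK
    push_cast at h3 ⊢
    linarith
  · refine Set.mem_add.2 ⟨_, Set.mem_add.2 ⟨_, Set.mem_singleton _, _, hR.subdiff, rfl⟩, _,
      Set.mem_singleton _, ?_⟩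
    abel
  · intro hf
    rw [hfin]
    exact (if_pos hkρ).trans (if_pos hf)
  · intro hf
    rw [hfin]
    exact (if_pos hkρ).trans (if_neg hf)

/-- The dynamic method stops after at most `I + 1` runs of the static method, if the last of them is
feasible. -/
theorem findsWithin_of_runs (h0 : 0 < θ) (h1 : θ ≤ 1) {z0 : Vec n} {ρ η : ℝ} (Y : ℝ) (I : ℕ) :
    ∀ c, 0 ≤ c → Y ≤ 2 ^ I * c → (∀ c', c ≤ c' → ∃ (N : ℕ) (zh vh : Vec n) (ph : Vec l),
      P.StaticRun θ z0 ρ η c' N zh vh ph ∧ (Y ≤ c' → ‖P.A zh - P.b‖ ≤ η)) →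
    P.FindsWithin θ z0 c ρ η (P.outerBound θ z0 ρ
      * ∑ i ∈ Finset.range (I + 1), P.innerBound θ (2 ^ i * c)) := by
  induction I with
  | zero =>
    intro c _ hY hrun
    obtain ⟨N, zh, vh, ph, hN, hf⟩ := hrun c le_rfl
    have hf' := hf (by simpa using hY)
    refine ⟨N, zh, vh, ph, ?_, hN.halted hf', hN.subdiff, hN.norm_le, hf'⟩
    simpa using hN.count
  | succ I ih =>
    intro c hc hY hrun
    obtain ⟨N, zh, vh, ph, hN, -⟩ := hrun c le_rfl
    have hsum : ∑ i ∈ Finset.range (I + 1 + 1), P.innerBound θ (2 ^ i * c)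
        = ∑ i ∈ Finset.range (I + 1), P.innerBound θ (2 ^ i * (2 * c)) + P.innerBound θ c := by
      rw [Finset.sum_range_succ']
      congr 1
      · refine Finset.sum_congr rfl fun i _ => ?_
        rw [pow_succ, mul_assoc]
      · simp
    have hpos : 0 ≤ ∑ i ∈ Finset.range (I + 1), P.innerBound θ (2 ^ i * (2 * c)) :=
      Finset.sum_nonneg fun i _ => P.innerBound_nonneg h0 h1 _
    have hcount := hN.count
    rw [hsum, mul_add]
    by_cases hf : ‖P.A zh - P.b‖ ≤ η
    · refine ⟨N, zh, vh, ph, ?_, hN.halted hf, hN.subdiff, hN.norm_le, hf⟩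
      have : 0 ≤ (P.outerBound θ z0 ρ : ℝ)
          * ∑ i ∈ Finset.range (I + 1), P.innerBound θ (2 ^ i * (2 * c)) := by positivity
      linarith
    · obtain ⟨N', z, v, p, hN', heq, hst⟩ := ih (2 * c) (by linarith [hc])
        (by rw [← mul_assoc, ← pow_succ]; exact hY) (fun c' hc' => hrun c' (by linarith [hc]))
      refine ⟨N' + N, z, v, p, ?_, ?_, hst⟩
      · push_cast
        linarith
      · rw [Function.iterate_add_apply, hN.restart hf]
        exact heq

/-- The constant in the complexity bound of the dynamic method, if the runs of the static method
with penalty parameter at least `C0 * X` are feasible. -/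
noncomputable def totalConst (θ C0 : ℝ) : ℝ :=
  ⌈577 / θ⌉₊ * (innerConst θ * ((1 + Real.log (2 * C0))
    * ((4 + 2 * Real.log C0) + 4 * √(2 * C0))))

theorem totalConst_nonneg (h0 : 0 < θ) (h1 : θ ≤ 1) {C0 : ℝ} (hC : 1 ≤ C0) :
    0 ≤ totalConst θ C0 := by
  have h2 := innerConst_pos h0 h1
  have h3 := Real.log_nonneg hC
  have h4 : 0 ≤ Real.log (2 * C0) := Real.log_nonneg (by linarith)
  unfold totalConst
  positivity

theorem sum_sqrt_le {c : ℝ} (hc : 0 ≤ c) (I : ℕ) :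
    ∑ i ∈ Finset.range (I + 1), √(2 ^ i * c) ≤ 4 * √(2 ^ I * c) := by
  induction I with
  | zero =>
    simp only [zero_add, Finset.sum_range_one, pow_zero, one_mul]
    linarith [Real.sqrt_nonneg c]
  | succ I ih =>
    rw [Finset.sum_range_succ]
    have e : √(2 ^ (I + 1) * c) = √2 * √(2 ^ I * c) := by
      rw [← Real.sqrt_mul (by norm_num), pow_succ]
      congr 1
      ring
    -- The induction step amounts to `4 + 4√2 ≤ 4√2 · √2 + ...` in the form `4 + √2 ≤ 4√2`, that is
    -- `√2 ≥ 4/3`.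
    have h2 : 4 / 3 ≤ √2 := by
      apply Real.le_sqrt_of_sq_le
      norm_num
    rw [e]
    nlinarith [Real.sqrt_nonneg (2 ^ I * c)]

theorem complexity_nonneg (P : Problem n l) (θ : ℝ) (z0 : Vec n) (c1 ρ X : ℝ) :
    0 ≤ P.complexity θ z0 c1 ρ X := by
  have h1 := one_le_logOne (X / c1)
  have h2 := one_le_logOne (P.lam θ * (P.L + max c1 X * ‖P.A‖ ^ 2) + 1)
  unfold complexity
  positivity

/-- The complexity of the dynamic method, if the runs of the static method with penalty parameter at
least `C0 * X` are feasible. -/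
theorem Standing.findsWithin (hP : P.Standing) (h0 : 0 < θ) (h1 : θ ≤ 1) {z0 : Vec n}
    {c1 ρ η X C0 : ℝ} (hc1 : 0 < c1) (hX : 0 ≤ X) (hC : 1 ≤ C0)
    (hrun : ∀ c, c1 ≤ c → ∃ (N : ℕ) (zh vh : Vec n) (ph : Vec l),
      P.StaticRun θ z0 ρ η c N zh vh ph ∧ (C0 * X ≤ c → ‖P.A zh - P.b‖ ≤ η)) :
    P.FindsWithin θ z0 c1 ρ η (totalConst θ C0 * P.complexity θ z0 c1 ρ X) := by
  have hl := hP.lam_pos h0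
  have hL := hP.L_pos
  have hA := hP.norm_A_pos
  have hI1 := innerConst_pos h0 h1
  have hlogC := Real.log_nonneg hC
  have hlog2C : 0 ≤ Real.log (2 * C0) := Real.log_nonneg (by linarith)
  have hexI : ∃ I : ℕ, C0 * X ≤ 2 ^ I * c1 := by
    obtain ⟨I, hI⟩ := pow_unbounded_of_one_lt (C0 * X / c1) (by norm_num : (1 : ℝ) < 2)
    exact ⟨I, ((div_lt_iff₀ hc1).1 hI).le⟩
  classical
  set I := Nat.find hexI with hIdef
  have hI : C0 * X ≤ 2 ^ I * c1 := Nat.find_spec hexI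
  obtain ⟨N, z, v, p, hN, heq, hst⟩ := findsWithin_of_runs h0 h1 (C0 * X) I c1 hc1.le hI hrun
  refine ⟨N, z, v, p, hN.trans ?_, heq, hst⟩
  set Q := P.lam θ * (P.L + max c1 X * ‖P.A‖ ^ 2) + 1 with hQ
  set m := max c1 X with hm
  have hm0 : 0 < m := lt_of_lt_of_le hc1 (le_max_left _ _)
  have hQ1 : 1 ≤ Q := by
    have : 0 < P.lam θ * (P.L + m * ‖P.A‖ ^ 2) := by positivity
    linarith
  have hlogX := one_le_logOne (X / c1)
  have hlogQ := one_le_logOne Q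
  -- By minimality of `I` the penalty before the last is below `C0 X`. This bounds the last penalty,
  -- and taking logarithms bounds the number of runs.
  have hlast : 2 ^ I * c1 ≤ 2 * C0 * m ∧
      ((I + 1 : ℕ) : ℝ) ≤ (4 + 2 * Real.log C0) * logOne (X / c1) := by
    rcases Nat.eq_zero_or_pos I with hI0 | hIpos
    · rw [hI0]
      constructor
      · have h2 : c1 ≤ m := le_max_left _ _
        have h3 : m ≤ C0 * m := le_mul_of_one_le_left hm0.le hC
        linarith
      · push_cast
        nlinarith
    · obtain ⟨J, hJ⟩ : ∃ J, I = J + 1 := ⟨I - 1, by omega⟩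
      have hnot : 2 ^ J * c1 < C0 * X := not_le.1 (Nat.find_min hexI (by omega : J < I))
      have hX0 : 0 < X := by
        have : 0 < 2 ^ J * c1 := by positivity
        by_contra! hneg
        have : X = 0 := le_antisymm hneg hX
        rw [this, mul_zero] at hnot
        linarith
      rw [hJ]
      constructor
      · have h2 : X ≤ m := le_max_right _ _
        have h3 : C0 * X ≤ C0 * m := by gcongr
        rw [pow_succ]
        linarith
      · have h2 : (2 : ℝ) ^ J ≤ C0 * (X / c1) := by
          rw [mul_div_assoc', le_div_iff₀ hc1]
          exact hnot.le
        have h3 := Real.log_le_log (by positivity) h2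
        rw [Real.log_pow] at h3
        have h4 := (log_le_logOne (C0 * (X / c1))).trans (logOne_mul_le hC (div_pos hX0 hc1))
        have h5 : (1 : ℝ) / 2 ≤ Real.log 2 := by
          have := Real.log_two_gt_d9
          linarith
        have h6 : (J : ℝ) * (1 / 2) ≤ J * Real.log 2 := by gcongr
        push_cast
        nlinarith
  have hterm : ∀ i ∈ Finset.range (I + 1), P.innerBound θ (2 ^ i * c1)
      ≤ innerConst θ * ((1 + Real.log (2 * C0)) * logOne Q)
        * (√(P.lam θ * P.L + 1) + ‖P.A‖ * √(P.lam θ) * √(2 ^ i * c1)) := by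
    intro i hi
    have hci : 0 < 2 ^ i * c1 := by positivity
    have hciI : 2 ^ i * c1 ≤ 2 ^ I * c1 := by
      gcongr
      · norm_num
      · exact Nat.lt_succ_iff.1 (Finset.mem_range.1 hi)
    have h2 : √(P.lam θ * P.Lc (2 ^ i * c1) + 1)
        ≤ √(P.lam θ * P.L + 1) + ‖P.A‖ * √(P.lam θ) * √(2 ^ i * c1) := by
      apply Real.sqrt_le_iff.2
      refine ⟨by positivity, ?_⟩
      have e1 := Real.sq_sqrt (by positivity : 0 ≤ P.lam θ * P.L + 1)
      have e2 := Real.sq_sqrt hl.le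
      have e3 := Real.sq_sqrt hci.le
      have e4 : (‖P.A‖ * √(P.lam θ) * √(2 ^ i * c1)) ^ 2
          = P.lam θ * (2 ^ i * c1 * ‖P.A‖ ^ 2) := by
        rw [mul_pow, mul_pow, e2, e3]
        ring
      have e5 : 0 ≤ √(P.lam θ * P.L + 1) * (‖P.A‖ * √(P.lam θ) * √(2 ^ i * c1)) := by
        positivity
      rw [add_sq, e1, e4]
      unfold Lc
      linarith
    have h3 : logOne (P.lam θ * P.Lc (2 ^ i * c1) + 1)
        ≤ (1 + Real.log (2 * C0)) * logOne Q := by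
      refine le_trans (logOne_mono ?_ ?_) (logOne_mul_le (by linarith : 1 ≤ 2 * C0) (by linarith))
      · have := hP.one_le h0 hci
        linarith
      · have h4 : 2 ^ i * c1 * ‖P.A‖ ^ 2 ≤ 2 * C0 * m * ‖P.A‖ ^ 2 :=
          mul_le_mul_of_nonneg_right (hciI.trans hlast.1) (sq_nonneg _)
        have h5 : P.lam θ * (2 ^ i * c1 * ‖P.A‖ ^ 2) ≤ P.lam θ * (2 * C0 * m * ‖P.A‖ ^ 2) := by
          gcongr
        have h6 : 0 ≤ (2 * C0 - 1) * (P.lam θ * P.L + 1) :=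
          mul_nonneg (by linarith) (by positivity)
        rw [hQ]
        unfold Lc
        linarith
    unfold innerBound
    rw [mul_assoc (innerConst θ), mul_comm ((1 + Real.log (2 * C0)) * logOne Q)]
    have h7 := one_le_logOne (P.lam θ * P.Lc (2 ^ i * c1) + 1)
    gcongr
  have hsum := Finset.sum_le_sum hterm
  rw [← Finset.mul_sum, Finset.sum_add_distrib, ← Finset.mul_sum, Finset.sum_const,
    Finset.card_range, nsmul_eq_mul] at hsum
  have hsq : ∑ i ∈ Finset.range (I + 1), √(2 ^ i * c1) ≤ 4 * (√(2 * C0) * √m) := by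
    refine (sum_sqrt_le hc1.le I).trans ?_
    rw [← Real.sqrt_mul (by linarith)]
    have := Real.sqrt_le_sqrt hlast.1
    linarith
  have hbr : ((I + 1 : ℕ) : ℝ) * √(P.lam θ * P.L + 1)
      + ‖P.A‖ * √(P.lam θ) * ∑ i ∈ Finset.range (I + 1), √(2 ^ i * c1)
      ≤ ((4 + 2 * Real.log C0) + 4 * √(2 * C0)) *
        (√(P.lam θ * m) * ‖P.A‖ + √(P.lam θ * P.L + 1) * logOne (X / c1)) := by
    have h2 : ((I + 1 : ℕ) : ℝ) * √(P.lam θ * P.L + 1)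
        ≤ (4 + 2 * Real.log C0) * logOne (X / c1) * √(P.lam θ * P.L + 1) :=
      mul_le_mul_of_nonneg_right hlast.2 (Real.sqrt_nonneg _)
    have h3 : ‖P.A‖ * √(P.lam θ) * ∑ i ∈ Finset.range (I + 1), √(2 ^ i * c1)
        ≤ ‖P.A‖ * √(P.lam θ) * (4 * (√(2 * C0) * √m)) := by gcongr
    have h4 : √(P.lam θ * m) = √(P.lam θ) * √m := Real.sqrt_mul hl.le _
    rw [h4]
    have h5 : 0 ≤ (4 + 2 * Real.log C0) * (√(P.lam θ) * √m * ‖P.A‖) := by positivity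
    have h6 : 0 ≤ 4 * √(2 * C0) * (√(P.lam θ * P.L + 1) * logOne (X / c1)) := by positivity
    linarith
  calc (P.outerBound θ z0 ρ : ℝ) * ∑ i ∈ Finset.range (I + 1), P.innerBound θ (2 ^ i * c1)
      ≤ P.outerBound θ z0 ρ * (innerConst θ * ((1 + Real.log (2 * C0)) * logOne Q)
        * (((4 + 2 * Real.log C0) + 4 * √(2 * C0)) *
        (√(P.lam θ * m) * ‖P.A‖ + √(P.lam θ * P.L + 1) * logOne (X / c1)))) := by
        have h2 : 0 ≤ innerConst θ * ((1 + Real.log (2 * C0)) * logOne Q) := by positivity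
        exact mul_le_mul_of_nonneg_left
          (hsum.trans (mul_le_mul_of_nonneg_left hbr h2)) (Nat.cast_nonneg _)
    _ = _ := by
        rw [totalConst, complexity, outerBound, Nat.cast_mul]
        ring

/-! ### Rates in the tolerances -/

theorem FindsWithin.mono {z0 : Vec n} {c1 ρ η B B' : ℝ} (h : P.FindsWithin θ z0 c1 ρ η B)
    (hB : B ≤ B') : P.FindsWithin θ z0 c1 ρ η B' := by
  obtain ⟨N, z, v, p, hN, h2⟩ := h
  exact ⟨N, z, v, p, hN.trans hB, h2⟩

/-- Only one logarithm survives: `log₁⁺ (X/c₁)` is absorbed into `1/√t` through `log x ≤ 2√x`. As `t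
≤ 1/2`, `log (1/t) ≥ 1/2` absorbs additive constants. -/
theorem Standing.complexity_rate (hP : P.Standing) (h0 : 0 < θ) (z0 : Vec n) {c1 Y : ℝ}
    (hc1 : 0 < c1) (hY : 0 ≤ Y) :
    ∃ K : ℝ, 0 ≤ K ∧ ∀ ρ t : ℝ, 0 < ρ → ρ ≤ 1 / 2 → 0 < t → t ≤ 1 / 2 →
      P.complexity θ z0 c1 ρ (Y / t) ≤ K * (Real.log (1 / t) / (√t * ρ ^ 2)) := by
  have hl := hP.lam_pos h0
  have hL := hP.L_pos
  have hR0 := hP.R0_nonneg h0 z0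
  set m := max c1 Y with hm
  have hm0 : 0 < m := lt_of_lt_of_le hc1 (le_max_left _ _)
  set V := P.lam θ * (P.L + m * ‖P.A‖ ^ 2) + 1 with hV
  have hV1 : 1 ≤ V := by
    have : 0 ≤ P.lam θ * (P.L + m * ‖P.A‖ ^ 2) := by positivity
    linarith
  have hlogV := Real.log_nonneg hV1
  set K1 := 1 + P.R0 θ z0 / P.lam θ ^ 2 with hK1
  have hK10 : 0 ≤ K1 := by positivity
  set K2 := √(P.lam θ * m) * ‖P.A‖ + √(P.lam θ * P.L + 1) * (2 * √(Y / c1) + 1) with hK2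
  have hK20 : 0 ≤ K2 := by positivity
  set K3 := 1 + 2 * (Real.log V + 1) with hK3
  have hK30 : 0 ≤ K3 := by positivity
  refine ⟨K1 * K2 * K3, by positivity, fun ρ t hρ0 hρ ht0 ht => ?_⟩
  have hst : 0 < √t := Real.sqrt_pos.2 ht0
  have hst1 : √t ≤ 1 := Real.sqrt_le_one.2 (by linarith)
  have hmax : max c1 (Y / t) ≤ m / t := by
    refine max_le ?_ ?_
    · rw [le_div_iff₀ ht0]
      have : c1 ≤ m := le_max_left _ _
      nlinarith
    · gcongr
      exact le_max_right _ _
  have hmaxpos : 0 < max c1 (Y / t) := lt_of_lt_of_le hc1 (le_max_left _ _)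
  have hlogt : 1 / 2 ≤ Real.log (1 / t) := by
    have h2 : Real.log 2 ≤ Real.log (1 / t) := by
      apply Real.log_le_log (by norm_num)
      rw [le_div_iff₀ ht0]
      linarith
    have := Real.log_two_gt_d9
    linarith
  have hρ2 : ρ ^ 2 ≤ 1 := by nlinarith
  have h1 : ((max 1 ⌈P.R0 θ z0 / (P.lam θ ^ 2 * ρ ^ 2)⌉₊ : ℕ) : ℝ) ≤ K1 / ρ ^ 2 := by
    have e : K1 / ρ ^ 2 = 1 / ρ ^ 2 + P.R0 θ z0 / (P.lam θ ^ 2 * ρ ^ 2) := by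
      rw [hK1]
      field_simp
    have h2 : 1 ≤ 1 / ρ ^ 2 := by
      rw [le_div_iff₀ (by positivity)]
      linarith
    have h3 : 0 ≤ P.R0 θ z0 / (P.lam θ ^ 2 * ρ ^ 2) := by positivity
    have h4 := (Nat.ceil_lt_add_one h3).le
    push_cast
    rw [e]
    exact max_le (by linarith) (by linarith)
  have h2 : √(P.lam θ * max c1 (Y / t)) * ‖P.A‖
      + √(P.lam θ * P.L + 1) * logOne (Y / t / c1) ≤ K2 / √t := by
    have h3 : √(P.lam θ * max c1 (Y / t)) ≤ √(P.lam θ * m) / √t := by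
      rw [← Real.sqrt_div (by positivity), mul_div_assoc]
      apply Real.sqrt_le_sqrt
      gcongr
    have h4 : logOne (Y / t / c1) ≤ (2 * √(Y / c1) + 1) / √t := by
      have e : √(Y / t / c1) = √(Y / c1) / √t := by
        rw [← Real.sqrt_div (by positivity)]
        congr 1
        field_simp
      have h5 : 1 ≤ 1 / √t := by
        rw [le_div_iff₀ hst]
        linarith
      have h6 : Real.log (Y / t / c1) ≤ 2 * √(Y / t / c1) := by
        have h7 : 0 ≤ Y / t / c1 := by positivity
        have h8 := Real.log_le_self (Real.sqrt_nonneg (Y / t / c1))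
        rw [Real.log_sqrt h7] at h8
        linarith
      rw [add_div, mul_div_assoc, ← e]
      refine max_le ?_ ?_
      · linarith
      · linarith [Real.sqrt_nonneg (Y / t / c1)]
    rw [hK2, add_div, mul_div_right_comm, mul_div_assoc (√(P.lam θ * P.L + 1))]
    gcongr
  have h3 : logOne (P.lam θ * (P.L + max c1 (Y / t) * ‖P.A‖ ^ 2) + 1)
      ≤ K3 * Real.log (1 / t) := by
    have h4 : P.lam θ * (P.L + max c1 (Y / t) * ‖P.A‖ ^ 2) + 1 ≤ V * (1 / t) := by
      have h5 : P.lam θ * (max c1 (Y / t) * ‖P.A‖ ^ 2) ≤ P.lam θ * (m / t * ‖P.A‖ ^ 2) := by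
        gcongr
      have h6 : P.lam θ * P.L + 1 ≤ (P.lam θ * P.L + 1) * (1 / t) := by
        apply le_mul_of_one_le_right (by positivity)
        rw [le_div_iff₀ ht0]
        linarith
      have e : V * (1 / t) = (P.lam θ * P.L + 1) * (1 / t)
          + P.lam θ * (m / t * ‖P.A‖ ^ 2) := by
        rw [hV]
        field_simp
        ring
      linarith
    have h5 : Real.log (P.lam θ * (P.L + max c1 (Y / t) * ‖P.A‖ ^ 2) + 1)
        ≤ Real.log V + Real.log (1 / t) := by
      rw [← Real.log_mul (by linarith) (by positivity)]
      exact Real.log_le_log (by positivity) h4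
    refine max_le ?_ ?_ <;> nlinarith
  have hl3 := one_le_logOne (P.lam θ * (P.L + max c1 (Y / t) * ‖P.A‖ ^ 2) + 1)
  have hl2 := one_le_logOne (Y / t / c1)
  unfold complexity
  calc _ ≤ K1 / ρ ^ 2 * (K2 / √t) * (K3 * Real.log (1 / t)) := by gcongr
    _ = _ := by
      field_simp

end Problem

open Problem in
/-- The explicit complexity bounds, with a constant that depends on `θ` only. -/
theorem exists_complexity_const {θ : ℝ} (h0 : 0 < θ) (h1 : θ ≤ 1) :
    ∃ C : ℝ, 0 < C ∧
      ∀ (n l : ℕ) (P : Problem n l), P.Standing →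
      ∀ z0 ∈ P.dom, ∀ c1 ρ η : ℝ, 2 * P.cbar < c1 → 0 < ρ → 0 < η →
        P.FindsWithin θ z0 c1 ρ η
          (C * P.complexity θ z0 c1 ρ (P.R0 θ z0 / (P.lam θ * η ^ 2))) ∧
        (P.BoundedLevels → P.BoundedSubdiff → ∀ zbar, P.IsSlater zbar →
          P.FindsWithin θ z0 c1 ρ η
            (C * P.complexity θ z0 c1 ρ (P.N0 θ z0 zbar / η))) := by
  have hC1 : 1 ≤ 160 / θ ^ 2 := by
    rw [le_div_iff₀ (by positivity)]
    nlinarith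
  have hC2 : 1 ≤ 6 / θ := by
    rw [le_div_iff₀ h0]
    linarith
  have hT1 := totalConst_nonneg h0 h1 hC1
  have hT2 := totalConst_nonneg h0 h1 hC2
  refine ⟨totalConst θ (160 / θ ^ 2) + totalConst θ (6 / θ) + 1, by linarith, ?_⟩
  intro n l P hP z0 hz0 c1 ρ η hc1 hρ hη
  have hc1pos : 0 < c1 := by
    have := hP.cbar_nonneg
    linarith
  have hl := hP.lam_pos h0
  have hR0 := hP.R0_nonneg h0 z0
  constructor
  · have h2 : P.FindsWithin θ z0 c1 ρ η (totalConst θ (160 / θ ^ 2)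
        * P.complexity θ z0 c1 ρ (P.R0 θ z0 / (P.lam θ * η ^ 2))) := by
      refine hP.findsWithin h0 h1 hc1pos (by positivity) hC1 fun c hc => ?_
      have hc0 : 0 < c := by linarith
      have hcbar : 2 * P.cbar < c := by linarith
      obtain ⟨N, zh, vh, ph, hN, z, p, v, ε, k, hS, hR⟩ :=
        hP.exists_staticRun h0 h1 hc0 hcbar hz0 hρ η
      refine ⟨N, zh, vh, ph, hN, fun hcX => ?_⟩
      have h3 := OuterSeq.infeasibility_refined_le hP h0 h1 hc0 hcbar hS k hR
      apply le_of_sq_le_sq _ hη.le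
      have h4 : 160 / θ ^ 2 * P.R0 θ z0 ≤ P.lam θ * c * η ^ 2 := by
        rw [mul_div_assoc', div_le_iff₀ (by positivity)] at hcX
        linarith
      exact le_of_mul_le_mul_left (h3.trans h4) (by positivity)
    refine h2.mono (mul_le_mul_of_nonneg_right (by linarith) (P.complexity_nonneg _ _ _ _ _))
  · intro hB2 hB3 zbar hz
    have hN0 := hP.N0_nonneg h0 z0 zbar
    have h2 : P.FindsWithin θ z0 c1 ρ η (totalConst θ (6 / θ)
        * P.complexity θ z0 c1 ρ (P.N0 θ z0 zbar / η)) := by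
      refine hP.findsWithin h0 h1 hc1pos (by positivity) hC2 fun c hc => ?_
      have hc0 : 0 < c := by linarith
      have hcbar : 2 * P.cbar < c := by linarith
      obtain ⟨N, zh, vh, ph, hN, z, p, v, ε, k, hS, hR⟩ :=
        hP.exists_staticRun h0 h1 hc0 hcbar hz0 hρ η
      refine ⟨N, zh, vh, ph, hN, fun hcX => ?_⟩
      have h3 := OuterSeq.infeasibility_slater hP h0 h1 hc0 hcbar hS hB2 hB3 hz k hR
      have h4 : 6 / θ * P.N0 θ z0 zbar ≤ c * η := by
        rw [mul_div_assoc', div_le_iff₀ hη] at hcX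
        linarith
      exact le_of_mul_le_mul_left (h3.trans h4) hc0
    refine h2.mono (mul_le_mul_of_nonneg_right (by linarith) (P.complexity_nonneg _ _ _ _ _))

end IPAAL

/-! ### From explicit bounds to rates in the tolerances -/

theorem theorem3p3 (θ : ℝ) (hθ0 : 0 < θ) (hθ1 : θ ≤ 1) :
    -- explicit bounds, with a constant that depends on `θ` only
    (∃ C : ℝ, 0 < C ∧
      ∀ (n l : ℕ) (P : IPAAL.Problem n l), P.Standing →
      ∀ z0 ∈ P.dom, ∀ c1 ρ η : ℝ, 2 * P.cbar < c1 → 0 < ρ → 0 < η →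
        P.FindsWithin θ z0 c1 ρ η
          (C * P.complexity θ z0 c1 ρ (P.R0 θ z0 / (P.lam θ * η ^ 2))) ∧
        (P.BoundedLevels → P.BoundedSubdiff → ∀ zbar, P.IsSlater zbar →
          P.FindsWithin θ z0 c1 ρ η
            (C * P.complexity θ z0 c1 ρ (P.N0 θ z0 zbar / η)))) ∧
    -- rates in the tolerances alone, for a fixed problem, starting point and initial penalty
    (∀ (n l : ℕ) (P : IPAAL.Problem n l), P.Standing →
      ∀ z0 ∈ P.dom, ∀ c1 : ℝ, 2 * P.cbar < c1 →
        (∃ K : ℝ, ∀ ρ η : ℝ, 0 < ρ → ρ ≤ 1 / 2 → 0 < η → η ≤ 1 / 2 →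
          P.FindsWithin θ z0 c1 ρ η (K * (Real.log (1 / η) / (η * ρ ^ 2)))) ∧
        (P.BoundedLevels → P.BoundedSubdiff → (∃ zbar, P.IsSlater zbar) →
          ∃ K : ℝ, ∀ ρ η : ℝ, 0 < ρ → ρ ≤ 1 / 2 → 0 < η → η ≤ 1 / 2 →
            P.FindsWithin θ z0 c1 ρ η (K * (Real.log (1 / η) / (√η * ρ ^ 2))))) := by
  obtain ⟨C, hC0, hC⟩ := IPAAL.exists_complexity_const hθ0 hθ1
  refine ⟨⟨C, hC0, hC⟩, fun n l P hP z0 hz0 c1 hc1 => ?_⟩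
  have hc1pos : 0 < c1 := by
    have := hP.cbar_nonneg
    linarith
  have hl := hP.lam_pos hθ0
  constructor
  · obtain ⟨K, hK0, hK⟩ := hP.complexity_rate hθ0 z0 hc1pos
      (div_nonneg (hP.R0_nonneg hθ0 z0) hl.le)
    refine ⟨C * (2 * K), fun ρ η hρ0 hρ hη0 hη => ?_⟩
    -- Without a Slater point the penalty scales like `1/η²`, hence `t = η²`: `√t = η` and the
    -- logarithm doubles.
    have h1 := hK ρ (η ^ 2) hρ0 hρ (by positivity) (by nlinarith)
    rw [div_div] at h1
    refine (hC n l P hP z0 hz0 c1 ρ η hc1 hρ0 hη0).1.mono ?_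
    rw [Real.sqrt_sq hη0.le] at h1
    have e : Real.log (1 / η ^ 2) = 2 * Real.log (1 / η) := by
      rw [← one_div_pow, Real.log_pow]
      norm_num
    rw [e] at h1
    calc _ ≤ C * (K * (2 * Real.log (1 / η) / (η * ρ ^ 2))) :=
          mul_le_mul_of_nonneg_left h1 hC0.le
      _ = _ := by ring
  · rintro hB2 hB3 ⟨zbar, hz⟩
    obtain ⟨K, hK0, hK⟩ := hP.complexity_rate hθ0 z0 hc1pos (hP.N0_nonneg hθ0 z0 zbar)
    refine ⟨C * K, fun ρ η hρ0 hρ hη0 hη => ?_⟩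
    refine ((hC n l P hP z0 hz0 c1 ρ η hc1 hρ0 hη0).2 hB2 hB3 zbar hz).mono ?_
    calc _ ≤ C * (K * (Real.log (1 / η) / (√η * ρ ^ 2))) :=
          mul_le_mul_of_nonneg_left (hK ρ η hρ0 hρ hη0 hη) hC0.le
      _ = _ := by ring
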